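/- Let $d\in\{2,3\}$, let $\Omega\subset\mathbb R^d$ be a bounded polyhedral Lipschitz domain, $0<T<\infty$, $I=(0,T)$, $Q_T=I\times\Omega$, and let $\nu_0>0$, $\delta>0$. Let $p\in C^{0,1,1}(\overline{Q_T})$, i.e. $|p(t,x)-p(\tilde t,\tilde x)|\le c\,(|t-\tilde t|+|x-\tilde x|)$ on $\overline{Q_T}$ for some constant $c$, and let $p^-:=\operatorname{ess\,inf}_{Q_T}p\ge 2$, $p^+:=\operatorname{ess\,sup}_{Q_T}p$. A prime denotes the conjugate exponent, $s'=s/(s-1)$. For $A\in\mathbb R^{d\times d}$ put $$S(t,x,A)=\nu_0(\delta+|A^{\rm sym}|)^{p(t,x)-2}A^{\rm sym},\qquad F(t,x,A)=(\delta+|A^{\rm sym}|)^{\frac{p(t,x)-2}{2}}A^{\rm sym}.$$ Write $u\in L^{s(\cdot)}$ if $u$ is measurable and $\int|u|^{s(\cdot)}<\infty$, let $W^{1,s(\cdot)}$ be the space of all $u\in L^{s(\cdot)}$ with weak gradient in $L^{s(\cdot)}$, and let $W^{1,s(\cdot)}_0$ be the closure of $C_c^\infty$ in $W^{1,s(\cdot)}$.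 Let $D_xv$ be the symmetric part of the spatial gradient of $v$, and let $H$ be the closure of $\{\varphi\in C_c^\infty(\Omega)^d:\operatorname{div}\varphi=0\}$ in $L^2(\Omega)^d$. Let $g\in L^{(p^-)'}(Q_T)^d$, let $G\in L^{p'(\cdot,\cdot)}(Q_T)^{d\times d}$ be symmetric, and let $v_0\in H$. Let $(v,q)$ be a weak solution of the unsteady $p(\cdot,\cdot)$-Stokes equations with these data, in the following sense: $v\in L^{p(\cdot,\cdot)}(Q_T)^d$ with $D_xv\in L^{p(\cdot,\cdot)}(Q_T)^{d\times d}$ and $v(t)\in W_0^{1,p(t,\cdot)}(\Omega)^d$ for a.e. $t\in I$; $q\in W^{-1,\infty}(I;L_0^{(p^+)'}(\Omega))$, i.e. $q=u_0+\partial_tu_1$ as a distribution on $Q_T$ with $u_0,u_1\in L^\infty(I;L^{(p^+)'}(\Omega))$ whose values have mean zero over $\Omega$; $v$ has a representative in $C([0,T];L^2(\Omega)^d)$ that takes the value $v_0$ at $t=0$; and for all $\varphi\in C_c^\infty(Q_T)^d$ and $\eta\in C_c^\infty(Q_T)$ $$\langle\partial_tv,\varphi\rangle+\int_{Q_T}S(\cdot,\cdot,D_xv):D_x\varphi-\langle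 q,\operatorname{div}_x\varphi\rangle=\int_{Q_T}g\cdot\varphi+\int_{Q_T}G:D_x\varphi,\qquad \int_{Q_T}\eta\,\operatorname{div}_xv=0 .$$ Assume that $F(\cdot,\cdot,D_xv)\in W^{1,2}(I;L^2(\Omega)^{d\times d})\cap L^2(I;W^{1,2}(\Omega)^{d\times d})$ and $v\in L^\infty(I;W^{1,2}(\Omega)^d)$. Assume further that the force is given by a locally integrable vector field $f$ on $Q_T$, i.e. $\int_{Q_T}f\cdot\varphi=\int_{Q_T}g\cdot\varphi+\int_{Q_T}G:D_x\varphi$ for all $\varphi\in C_c^\infty(Q_T)^d$. Then: (i) If $f\in L^{p'(\cdot,\cdot)}(Q_T)^d$, then $q$ is a locally integrable function on $Q_T$, $q(t,\cdot)\in W^{1,p'(t,\cdot)}(\Omega)$ for a.e. $t\in I$, and $|\nabla_xq|\in L^{p'(\cdot,\cdot)}(Q_T)$. (ii) If $(\delta+|D_xv|)^{2-p(\cdot,\cdot)}|f|^2\in L^1(Q_T)$, then $q$ is a locally integrable function on $Q_T$, $q(t,\cdot)\in W^{1,p'(t,\cdot)}(\Omega)$ for a.e. $t\in I$, and $(\delta+|D_xv|)^{2-p(\cdot,\cdot)}|\nabla_xq|^2\in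 L^1(Q_T)$. -/

import Mathlib

open Set Filter Topology MeasureTheory TopologicalSpace
open scoped ENNReal NNReal Distributions LineDeriv

noncomputable section

namespace PxStokes

/-- The Euclidean space `ℝᵈ`. -/
abbrev Sp (d : ℕ) : Type := EuclideanSpace ℝ (Fin d)

/-- The standard basis vectors of `ℝᵈ`. -/
abbrev stdVec {d : ℕ} (i : Fin d) : Sp d := EuclideanSpace.single i (1 : ℝ)

/-! ### Domains -/

/-- Near each of its boundary points, `Ω` is, in suitable Cartesian coordinates, the region strictly
above the graph of a Lipschitz function. Here `e` is the vertical direction and `y - ⟪e, y⟫ e` is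
the horizontal part of `y`. -/
def HasLipschitzBoundary {d : ℕ} (Ω : Set (Sp d)) : Prop :=
  ∀ x ∈ frontier Ω, ∃ (r : ℝ) (e : Sp d) (h : Sp d → ℝ) (L : ℝ≥0),
    0 < r ∧ ‖e‖ = 1 ∧ LipschitzWith L h ∧
      ∀ y ∈ Metric.ball x r, y ∈ Ω ↔ h (y - inner ℝ e y • e) < inner ℝ e y

/-- The closure of `Ω` is a finite union of convex polytopes. -/
def IsPolyhedral {d : ℕ} (Ω : Set (Sp d)) : Prop :=
  ∃ K : Finset (Finset (Sp d)), closure Ω = ⋃ P ∈ K, convexHull ℝ (P : Set (Sp d))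

/-- Bounded polyhedral Lipschitz domains (a domain is open, non-empty and connected). -/
structure IsPolyhedralLipschitzDomain {d : ℕ} (Ω : Opens (Sp d)) : Prop where
  connected : IsConnected (Ω : Set (Sp d))
  bounded : Bornology.IsBounded (Ω : Set (Sp d))
  polyhedral : IsPolyhedral (Ω : Set (Sp d))
  lipschitz : HasLipschitzBoundary (Ω : Set (Sp d))

/-- The space-time cylinder `Q_T = (0, T) × Ω`. -/
def cyl {d : ℕ} (T : ℝ) (Ω : Opens (Sp d)) : Opens (ℝ × Sp d) :=
  ⟨Ioo 0 T ×ˢ (Ω : Set (Sp d)), isOpen_Ioo.prod Ω.isOpen⟩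

/-- The Lebesgue measure on an open set. -/
abbrev vol {V : Type*} [TopologicalSpace V] [MeasureSpace V] (U : Opens V) : Measure V :=
  volume.restrict (U : Set V)

/-- The Lebesgue measure on the time interval `(0, T)`. -/
abbrev volI (T : ℝ) : Measure ℝ := volume.restrict (Ioo 0 T)

/-- The time direction in space-time. -/
abbrev dirT (d : ℕ) : ℝ × Sp d := (1, 0)

/-- The `i`-th space direction in space-time. -/
abbrev dirX {d : ℕ} (i : Fin d) : ℝ × Sp d := (0, stdVec i)

/-! ### Variable Lebesgue spaces -/

section Lebesgue

variable {V : Type*} [MeasurableSpace V]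

/-- The modular `∫ |u|^{s(·)}`. -/
def modular (μ : Measure V) (s : V → ℝ) (u : V → ℝ) : ℝ≥0∞ :=
  ∫⁻ x, ENNReal.ofReal (|u x| ^ s x) ∂μ

/-- `u ∈ L^{s(·)}`, for a bounded exponent `s`. -/
def InLp (μ : Measure V) (s : V → ℝ) (u : V → ℝ) : Prop :=
  AEStronglyMeasurable u μ ∧ modular μ s u < ∞

/-- The Luxembourg norm. -/
def luxNorm (μ : Measure V) (s : V → ℝ) (u : V → ℝ) : ℝ≥0∞ :=
  ⨅ (l : ℝ) (_ : 0 < l) (_ : modular μ s (fun x => u x / l) ≤ 1), ENNReal.ofReal l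

/-- The conjugate exponent `s' = s / (s - 1)`. -/
def conj (s : V → ℝ) : V → ℝ := fun x => s x / (s x - 1)

end Lebesgue

/-! ### Weak derivatives and variable Sobolev spaces -/

/-- `w` is the weak derivative of `u` on `U` in the direction `m`. -/
def HasWeakDeriv {V : Type*} [NormedAddCommGroup V] [NormedSpace ℝ V] [MeasureSpace V]
    (U : Opens V) (u w : V → ℝ) (m : V) : Prop :=
  LocallyIntegrableOn u (U : Set V) ∧ LocallyIntegrableOn w (U : Set V) ∧
    ∀ φ : 𝓓(U, ℝ), ∫ x, u x * fderiv ℝ φ x m ∂(vol U) = - ∫ x, w x * φ x ∂(vol U)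

/-- `u ∈ W^{1,s(·)}(U)`, with weak gradient `Du`. -/
def InW1 {d : ℕ} (U : Opens (Sp d)) (s : Sp d → ℝ) (u : Sp d → ℝ) (Du : Sp d → Sp d) : Prop :=
  InLp (vol U) s u ∧
    ∀ i, HasWeakDeriv U u (fun x => Du x i) (stdVec i) ∧ InLp (vol U) s (fun x => Du x i)

/-- `u ∈ W₀^{1,s(·)}(U)`, the closure of `C_c^∞(U)` in `W^{1,s(·)}(U)`. -/
def InW10 {d : ℕ} (U : Opens (Sp d)) (s : Sp d → ℝ) (u : Sp d → ℝ) : Prop :=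
  ∃ Du : Sp d → Sp d, InW1 U s u Du ∧
    ∀ ε : ℝ≥0∞, 0 < ε → ∃ φ : 𝓓(U, ℝ),
      luxNorm (vol U) s (fun x => u x - φ x)
        + luxNorm (vol U) s (fun x => ‖Du x - gradient φ x‖) < ε

/-! ### Exponents -/

/-- `p ∈ C^{0,1,1}` on the closed cylinder `[0, T] × closure Ω`. -/
def InC011 {d : ℕ} (T : ℝ) (Ω : Opens (Sp d)) (p : ℝ × Sp d → ℝ) : Prop :=
  ∃ c : ℝ, ∀ t ∈ Icc 0 T, ∀ x ∈ closure (Ω : Set (Sp d)),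
    ∀ t' ∈ Icc 0 T, ∀ x' ∈ closure (Ω : Set (Sp d)),
      |p (t, x) - p (t', x')| ≤ c * (|t - t'| + ‖x - x'‖)

/-- `p⁻`, the essential infimum of `p` over `Q_T`. -/
def pMinus {d : ℕ} (T : ℝ) (Ω : Opens (Sp d)) (p : ℝ × Sp d → ℝ) : ℝ := essInf p (vol (cyl T Ω))

/-- `p⁺`, the essential supremum of `p` over `Q_T`. -/
def pPlus {d : ℕ} (T : ℝ) (Ω : Opens (Sp d)) (p : ℝ × Sp d → ℝ) : ℝ := essSup p (vol (cyl T Ω))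

/-! ### Tensors -/

/-- Real `d × d` tensors. -/
abbrev Tensor (d : ℕ) : Type := Matrix (Fin d) (Fin d) ℝ

/-- The scalar product `A : B` of tensors. -/
def ddot {d : ℕ} (A B : Tensor d) : ℝ := ∑ i, ∑ j, A i j * B i j

/-- The Euclidean (Frobenius) norm of a tensor. -/
def tnorm {d : ℕ} (A : Tensor d) : ℝ := Real.sqrt (ddot A A)

/-- The symmetric part of a tensor. -/
def tsym {d : ℕ} (A : Tensor d) : Tensor d := (1 / 2 : ℝ) • (A + A.transpose)

/-- The extra-stress tensor `S(t, x, A) = ν₀ (δ + |A^sym|)^{p(t,x) - 2} A^sym`. -/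
def stress {d : ℕ} (ν₀ δ : ℝ) (p : ℝ × Sp d → ℝ) (z : ℝ × Sp d) (A : Tensor d) : Tensor d :=
  (ν₀ * (δ + tnorm (tsym A)) ^ (p z - 2)) • tsym A

/-- The mapping `F(t, x, A) = (δ + |A^sym|)^{(p(t,x) - 2) / 2} A^sym`. -/
def Fmap {d : ℕ} (δ : ℝ) (p : ℝ × Sp d → ℝ) (z : ℝ × Sp d) (A : Tensor d) : Tensor d :=
  ((δ + tnorm (tsym A)) ^ ((p z - 2) / 2)) • tsym A

/-! ### The weak formulation -/

/-- `Dv` is the (weak, spatial) symmetric gradient of the vector field `v` on `Q_T`. -/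
def HasSymGrad {d : ℕ} (T : ℝ) (Ω : Opens (Sp d)) (v : ℝ × Sp d → Sp d)
    (Dv : ℝ × Sp d → Tensor d) : Prop :=
  (∀ i, LocallyIntegrableOn (fun z => v z i) (cyl T Ω : Set (ℝ × Sp d))) ∧
  (∀ i j, LocallyIntegrableOn (fun z => Dv z i j) (cyl T Ω : Set (ℝ × Sp d))) ∧
  ∀ i j, ∀ φ : 𝓓(cyl T Ω, ℝ),
    ∫ z, (1 / 2 : ℝ) * (v z i * fderiv ℝ φ z (dirX j) + v z j * fderiv ℝ φ z (dirX i))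
        ∂(vol (cyl T Ω))
      = - ∫ z, Dv z i j * φ z ∂(vol (cyl T Ω))

/-- The velocity `v` lies in the space `𝓥`, and `Dv` is its symmetric gradient. -/
structure InVelocitySpace {d : ℕ} (T : ℝ) (Ω : Opens (Sp d)) (p : ℝ × Sp d → ℝ)
    (v : ℝ × Sp d → Sp d) (Dv : ℝ × Sp d → Tensor d) : Prop where
  memLp : ∀ i, InLp (vol (cyl T Ω)) p (fun z => v z i)
  symGrad : HasSymGrad T Ω v Dv
  memLp_symGrad : ∀ i j, InLp (vol (cyl T Ω)) p (fun z => Dv z i j)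
  slice : ∀ᵐ t ∂(volI T), ∀ i, InW10 Ω (fun x => p (t, x)) (fun x => v (t, x) i)

/-- `u ∈ L^∞(0, T; L₀^r(Ω))`, where `L₀^r(Ω)` are the functions in `L^r(Ω)` with mean zero. -/
def InLinftyLr0 {d : ℕ} (T : ℝ) (Ω : Opens (Sp d)) (r : ℝ) (u : ℝ × Sp d → ℝ) : Prop :=
  AEStronglyMeasurable u (vol (cyl T Ω)) ∧
    ∃ C : ℝ≥0, ∀ᵐ t ∂(volI T),
      MemLp (fun x => u (t, x)) (ENNReal.ofReal r) (vol Ω) ∧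
      eLpNorm (fun x => u (t, x)) (ENNReal.ofReal r) (vol Ω) ≤ C ∧
      ∫ x, u (t, x) ∂(vol Ω) = 0

/-- The distribution `q` on `Q_T` lies in `W^{-1,∞}(0, T; L₀^r(Ω))`: it is of the form
`q = u₀ + ∂ₜ u₁` with `u₀, u₁ ∈ L^∞(0, T; L₀^r(Ω))`. -/
def InPressureSpace {d : ℕ} (T : ℝ) (Ω : Opens (Sp d)) (r : ℝ) (q : 𝓓'(cyl T Ω, ℝ)) : Prop :=
  ∃ u₀ u₁ : ℝ × Sp d → ℝ, InLinftyLr0 T Ω r u₀ ∧ InLinftyLr0 T Ω r u₁ ∧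
    ∀ η : 𝓓(cyl T Ω, ℝ), q η = ∫ z, u₀ z * η z ∂(vol (cyl T Ω))
      - ∫ z, u₁ z * fderiv ℝ η z (dirT d) ∂(vol (cyl T Ω))

/-- The space `H`: the closure in `L²(Ω)ᵈ` of the divergence-free test functions. -/
def solenoidal {d : ℕ} (Ω : Opens (Sp d)) : Set (Lp (Sp d) 2 (vol Ω)) :=
  closure {u | ∃ φ : 𝓓(Ω, Sp d), (∀ x, ∑ i, fderiv ℝ φ x (stdVec i) i = 0) ∧ u =ᵐ[vol Ω] φ}

/-- The spatial symmetric gradient of a space-time test vector field. -/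
def testSymGrad {d : ℕ} {T : ℝ} {Ω : Opens (Sp d)} (φ : Fin d → 𝓓(cyl T Ω, ℝ))
    (z : ℝ × Sp d) : Tensor d :=
  Matrix.of fun i j =>
    (1 / 2 : ℝ) * (fderiv ℝ (φ i) z (dirX j) + fderiv ℝ (φ j) z (dirX i))

/-- The spatial divergence of a space-time test vector field, as a test function. -/
def testDiv {d : ℕ} {T : ℝ} {Ω : Opens (Sp d)} (φ : Fin d → 𝓓(cyl T Ω, ℝ)) : 𝓓(cyl T Ω, ℝ) :=
  ∑ i, ∂_{(dirX i : ℝ × Sp d)} (φ i)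

/-- The right-hand side `(g, φ) + (G, D φ)` of the momentum equation. -/
def forceFunctional {d : ℕ} (T : ℝ) (Ω : Opens (Sp d)) (g : ℝ × Sp d → Sp d)
    (G : ℝ × Sp d → Tensor d) (φ : Fin d → 𝓓(cyl T Ω, ℝ)) : ℝ :=
  ∫ z, ∑ i, g z i * φ i z ∂(vol (cyl T Ω))
    + ∫ z, ddot (G z) (testSymGrad φ z) ∂(vol (cyl T Ω))

/-- `(v, q)`, where `v` has the symmetric gradient `Dv`, is a weak solution of the unsteady
`p(·,·)`-Stokes equations with data `g`, `G`, `v₀`. -/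
structure IsWeakSolution {d : ℕ} (T : ℝ) (Ω : Opens (Sp d)) (ν₀ δ : ℝ) (p : ℝ × Sp d → ℝ)
    (g : ℝ × Sp d → Sp d) (G : ℝ × Sp d → Tensor d) (v₀ : Lp (Sp d) 2 (vol Ω))
    (v : ℝ × Sp d → Sp d) (Dv : ℝ × Sp d → Tensor d) (q : 𝓓'(cyl T Ω, ℝ)) : Prop where
  velocity : InVelocitySpace T Ω p v Dv
  pressure : InPressureSpace T Ω (pPlus T Ω p / (pPlus T Ω p - 1)) q
  /-- `v(0) = v₀`, for the representative of `v` in `C([0, T]; L²(Ω)ᵈ)`. -/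
  initial : ∃ w : ℝ → Lp (Sp d) 2 (vol Ω), ContinuousOn w (Icc 0 T) ∧
    (∀ᵐ t ∂(volI T), w t =ᵐ[vol Ω] fun x => v (t, x)) ∧ w 0 = v₀
  momentum : ∀ φ : Fin d → 𝓓(cyl T Ω, ℝ),
    - ∫ z, ∑ i, v z i * fderiv ℝ (φ i) z (dirT d) ∂(vol (cyl T Ω))
      + ∫ z, ddot (stress ν₀ δ p z (Dv z)) (testSymGrad φ z) ∂(vol (cyl T Ω))
      - q (testDiv φ) = forceFunctional T Ω g G φ
  incompressible : ∀ η : 𝓓(cyl T Ω, ℝ), ∫ z, η z * (Dv z).trace ∂(vol (cyl T Ω)) = 0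

/-- The external force, i.e. the right-hand side of the momentum equation, is given by the
locally integrable vector field `f`. -/
def IsForce {d : ℕ} (T : ℝ) (Ω : Opens (Sp d)) (g : ℝ × Sp d → Sp d)
    (G : ℝ × Sp d → Tensor d) (f : ℝ × Sp d → Sp d) : Prop :=
  (∀ i, LocallyIntegrableOn (fun z => f z i) (cyl T Ω : Set (ℝ × Sp d))) ∧
  ∀ φ : Fin d → 𝓓(cyl T Ω, ℝ),
    ∫ z, ∑ i, f z i * φ i z ∂(vol (cyl T Ω)) = forceFunctional T Ω g G φ

/-! ### Regularity -/

/-- `u ∈ W^{1,2}(0, T; L²(Ω))`. -/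
def InW12L2 {d : ℕ} (T : ℝ) (Ω : Opens (Sp d)) (u : ℝ × Sp d → ℝ) : Prop :=
  MemLp u 2 (vol (cyl T Ω)) ∧
    ∃ w : ℝ × Sp d → ℝ, HasWeakDeriv (cyl T Ω) u w (dirT d) ∧ MemLp w 2 (vol (cyl T Ω))

/-- `u ∈ L²(0, T; W^{1,2}(Ω))`. -/
def InL2W12 {d : ℕ} (T : ℝ) (Ω : Opens (Sp d)) (u : ℝ × Sp d → ℝ) : Prop :=
  MemLp u 2 (vol (cyl T Ω)) ∧
    ∀ j : Fin d, ∃ w : ℝ × Sp d → ℝ,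
      HasWeakDeriv (cyl T Ω) u w (dirX j) ∧ MemLp w 2 (vol (cyl T Ω))

/-- `u ∈ L^∞(0, T; W^{1,2}(Ω))`. -/
def InLinftyW12 {d : ℕ} (T : ℝ) (Ω : Opens (Sp d)) (u : ℝ × Sp d → ℝ) : Prop :=
  AEStronglyMeasurable u (vol (cyl T Ω)) ∧
    ∃ C : ℝ≥0, ∀ᵐ t ∂(volI T),
      MemLp (fun x => u (t, x)) 2 (vol Ω) ∧ eLpNorm (fun x => u (t, x)) 2 (vol Ω) ≤ C ∧
      ∀ j : Fin d, ∃ w : Sp d → ℝ, HasWeakDeriv Ω (fun x => u (t, x)) w (stdVec j) ∧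
        MemLp w 2 (vol Ω) ∧ eLpNorm w 2 (vol Ω) ≤ C

/-- The distribution `q` on `Q_T` is given by the locally integrable function `π`, for almost every
`t` one has `π(t, ·) ∈ W^{1,s(t,·)}(Ω)`, and the measurable vector field `Dπ` is the spatial
gradient of `π`. -/
structure IsSobolevPressure {d : ℕ} (T : ℝ) (Ω : Opens (Sp d)) (s : ℝ × Sp d → ℝ)
    (q : 𝓓'(cyl T Ω, ℝ)) (π : ℝ × Sp d → ℝ) (Dπ : ℝ × Sp d → Sp d) : Prop where
  locallyIntegrable : LocallyIntegrableOn π (cyl T Ω : Set (ℝ × Sp d))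
  represents : ∀ η : 𝓓(cyl T Ω, ℝ), q η = ∫ z, π z * η z ∂(vol (cyl T Ω))
  measurable_grad : AEStronglyMeasurable Dπ (vol (cyl T Ω))
  slice : ∀ᵐ t ∂(volI T),
    InW1 Ω (fun x => s (t, x)) (fun x => π (t, x)) (fun x => Dπ (t, x))

end PxStokes

end

/-! Write `Q` for the space-time cylinder and `a = (δ + |Dv|) ^ ((p - 2) / 2)`, so that `F = a Dv` and
the stress is `ν₀ a F`. Testing the momentum equation with `η eᵢ` gives, in the sense of
distributions, `∂ᵢ q = fᵢ - ∂ₜ vᵢ + (div S)ᵢ` (`IsWeakSolution.pressure_gradient`). Two facts about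
the right-hand side carry the result: `div S = a κ` with `κ ∈ L²(Q)`, and `∂ₜ v ∈ L²(Q)`. As `a` is
bounded from below, the gradient of `q` is then `f + a H` with `H ∈ L²(Q)`. Since
`a⁻² = (δ + |Dv|) ^ (2 - p)`, this is the weighted estimate, and Young's inequality
`(a |H|) ^ p' ≤ (δ + |Dv|) ^ p + |H| ^ 2` (`rpow_conj_le`) is the estimate in `L^{p'(·,·)}`.

The first fact is a chain rule for a function of `F` and of the variable exponent. It is replaced
by an argument with increments (`HasWeakDeriv.exists_of_increments`): pointwise, the increment of
`S` is bounded by `a₁ + a₂`, the sum of the weights at the two points, times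
`|F₁ - F₂| + |p₁ - p₂| ((1 + |F₁|) ^ (1 + ε) + (1 + |F₂|) ^ (1 + ε))` (`exists_norm_sub_le`), where
the exponent `ε > 0` absorbs the logarithm that comes from differentiating a power in its exponent.
The term with `p` is harmless because `F ∈ W^{1,2}(Q)` lies in `L^{2 (d + 1) / d}(Q)`
(`lintegral_rpow_cyl_lt_top`), so `ε = 1 / d` is admissible. Hence `φ ↦ ∫ S ∂φ` is bounded in the
norm of `L²(a² dz)`, and the Riesz representation theorem yields `κ`
(`HasWeakDeriv.exists_of_bound`).

For the second fact the same argument gives `∂ₜ (Dv)ᵢᵢ = ∂ₜ ∂ᵢ vᵢ ∈ L²(Q)`. Since the slices of `vᵢ`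
have zero boundary values, the one-dimensional Poincaré inequality in the direction `eᵢ`, applied to
differences in time, bounds the difference quotients of `vᵢ` (`exists_timeDeriv_of_spatial`). Only
the diagonal of `Dv` enters, so that Korn's inequality is not needed.

It remains to see that `q = u₀ + ∂ₜ u₁` is a function with the right slices. Averages of `q` over
short time steps are functions with mean value zero on the slices. By the Poincaré inequality on `Ω`,
they are controlled by the averages of the gradient, which converge in `L¹(Q)`; so they converge to a
function `π ∈ L¹(Q)` that represents `q` (`exists_integrable_of_gradient`). Finally, almost every
slice of `π` has a gradient in `L^{p'(t,·)}(Ω)`, and finitely many local Sobolev embeddings raise the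
integrability of the slice itself from `L¹` to `L^{p'(t,·)}`
(`lintegral_rpow_lt_top_of_hasWeakGrad`).

Everything near the boundary of `Ω` rests on one device: a Lipschitz domain has, near each point of
its closure, a basis of directions along which one can slide into the domain
(`exists_inward_basis`). Sobolev and Poincaré inequalities are obtained by integrating along these
directions, without extension operators. -/

set_option linter.unusedSectionVars false

namespace PxStokes

/-! ### Translating and averaging along segments -/

section Translation

variable {V : Type*} [NormedAddCommGroup V] [NormedSpace ℝ V]

/-- The set `K + [0, s] m` swept out by translating `K` along the segment from `0` to `s m`. -/
def sweep (K : Set V) (s : ℝ) (m : V) : Set V := (fun z : V × ℝ => z.1 + z.2 • m) '' (K ×ˢ Icc 0 s)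

lemma isCompact_sweep {K : Set V} (hK : IsCompact K) (s : ℝ) (m : V) : IsCompact (sweep K s m) :=
  (hK.prod isCompact_Icc).image (by fun_prop)

lemma mem_sweep {K : Set V} {s : ℝ} {m x : V} (hx : x ∈ K) {τ : ℝ} (hτ : τ ∈ Icc 0 s) :
    x + τ • m ∈ sweep K s m := ⟨(x, τ), ⟨hx, hτ⟩, rfl⟩

/-- All segments `[x, x + s m]` that start in `A` stay in `U`. -/
def Slides (A U : Set V) (s : ℝ) (m : V) : Prop := ∀ x ∈ A, ∀ τ ∈ Icc 0 s, x + τ • m ∈ U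

lemma Slides.sweep_subset {A U K : Set V} {s : ℝ} {m : V} (h : Slides A U s m) (hK : K ⊆ A) :
    sweep K s m ⊆ U := by
  rintro _ ⟨⟨x, τ⟩, ⟨hx, hτ⟩, rfl⟩
  exact h x (hK hx) τ hτ

lemma Slides.subset {A U : Set V} {s : ℝ} {m : V} (h : Slides A U s m) (hs : 0 ≤ s) : A ⊆ U := by
  intro x hx
  simpa using h x hx 0 ⟨le_rfl, hs⟩

variable [FiniteDimensional ℝ V]

/-- The integral of the translates of a test function along a segment is a test function, whose
derivative along the segment is a difference. -/
lemma exists_testFunction_average {U A : Opens V} {s : ℝ} (hs : 0 ≤ s) {m : V}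
    (hA : Slides (A : Set V) U s m) (φ : 𝓓(A, ℝ)) :
    ∃ ψ : 𝓓(U, ℝ), (∀ x, ψ x = ∫ τ in (0 : ℝ)..s, φ (x - τ • m)) ∧
      (∀ x e, fderiv ℝ ψ x e = ∫ τ in (0 : ℝ)..s, fderiv ℝ φ (x - τ • m) e) ∧
      (∀ x, fderiv ℝ ψ x m = φ x - φ (x - s • m)) ∧
      (∀ x, x ∉ sweep (tsupport φ) s m → ψ x = 0) := by
  borelize V
  let μ₀ : Measure V := (volume.restrict (Ioc 0 s)).map (fun τ : ℝ => τ • m)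
  have hmeas : Measurable (fun τ : ℝ => τ • m) := by fun_prop
  let F : V → ℝ := convolution (fun _ => (1 : ℝ)) φ (ContinuousLinearMap.lsmul ℝ ℝ) μ₀
  have hF : ∀ x, F x = ∫ τ in (0 : ℝ)..s, φ (x - τ • m) := by
    intro x
    simp only [F, convolution, μ₀, ContinuousLinearMap.lsmul_apply, one_smul]
    rw [integral_map hmeas.aemeasurable, intervalIntegral.integral_of_le hs]
    exact (Continuous.aestronglyMeasurable (by fun_prop))
  have hloc : LocallyIntegrable (fun _ : V => (1 : ℝ)) μ₀ := locallyIntegrable_const _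
  have hzero : ∀ x, x ∉ sweep (tsupport φ) s m → F x = 0 := by
    intro x hx
    rw [hF, intervalIntegral.integral_of_le hs]
    refine setIntegral_eq_zero_of_forall_eq_zero fun τ hτ => ?_
    by_contra hne
    apply hx
    have : x = (x - τ • m) + τ • m := by abel
    rw [this]
    exact mem_sweep (subset_tsupport _ hne) ⟨hτ.1.le, hτ.2⟩
  have hKc : IsCompact (sweep (tsupport φ) s m) := isCompact_sweep φ.hasCompactSupport s m
  have htsupp : tsupport F ⊆ sweep (tsupport φ) s m := by
    refine closure_minimal ?_ hKc.isClosed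
    intro x hx
    by_contra h
    exact hx (hzero x h)
  have hderiv : ∀ x e, fderiv ℝ F x e = ∫ τ in (0 : ℝ)..s, fderiv ℝ φ (x - τ • m) e := by
    intro x e
    have hcf : Continuous (fderiv ℝ φ) := φ.contDiff.continuous_fderiv (by simp)
    obtain ⟨C, hC⟩ := hcf.bounded_above_of_compact_support (φ.hasCompactSupport.fderiv ℝ)
    have h1 : HasFDerivAt (fun x => ∫ τ in (0 : ℝ)..s, φ (x - τ • m))
        (∫ τ in (0 : ℝ)..s, fderiv ℝ φ (x - τ • m)) x := by
      refine intervalIntegral.hasFDerivAt_integral_of_dominated_of_fderiv_le (bound := fun _ => C)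
        (F' := fun x τ => fderiv ℝ φ (x - τ • m)) univ_mem ?_ ?_ ?_ ?_ ?_ ?_
      · exact Eventually.of_forall fun x => Continuous.aestronglyMeasurable (by fun_prop)
      · exact Continuous.intervalIntegrable (by fun_prop) _ _
      · exact Continuous.aestronglyMeasurable (by fun_prop)
      · exact ae_of_all _ fun τ _ x _ => hC _
      · exact intervalIntegrable_const
      · refine ae_of_all _ fun τ _ x _ => ?_
        have h3 : HasFDerivAt φ (fderiv ℝ φ (x - τ • m)) (x - τ • m) :=
          ((φ.contDiff.differentiable (by simp)) _).hasFDerivAt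
        exact h3.comp x (f := fun x => x - τ • m) ((hasFDerivAt_id x).sub_const (τ • m))
    rw [show F = _ from funext hF, h1.fderiv, intervalIntegral.integral_of_le hs,
      intervalIntegral.integral_of_le hs, ContinuousLinearMap.integral_apply]
    exact (Continuous.integrableOn_Icc (by fun_prop)).mono_set Ioc_subset_Icc_self
  refine ⟨⟨F, ?_, ?_, ?_⟩, hF, hderiv, ?_, hzero⟩
  · exact φ.hasCompactSupport.contDiff_convolution_right _ hloc φ.contDiff
  · exact hKc.of_isClosed_subset (isClosed_tsupport _) htsupp
  · exact htsupp.trans (hA.sweep_subset φ.tsupport_subset)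
  · intro x
    have h2 : ∀ τ : ℝ, HasDerivAt (fun τ : ℝ => - φ (x - τ • m)) (fderiv ℝ φ (x - τ • m) m) τ := by
      intro τ
      have h3 : HasFDerivAt φ (fderiv ℝ φ (x - τ • m)) (x - τ • m) :=
        ((φ.contDiff.differentiable (by simp)) _).hasFDerivAt
      have h4 : HasDerivAt (fun τ : ℝ => x - τ • m) (-m) τ := by
        simpa using ((hasDerivAt_id τ).smul_const m).const_sub x
      have h5 := (h3.comp_hasDerivAt τ h4).neg
      rw [map_neg, neg_neg] at h5
      exact h5
    change fderiv ℝ F x m = _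
    rw [hderiv, intervalIntegral.integral_eq_sub_of_hasDerivAt (fun τ _ => h2 τ)]
    · simp; ring
    · have hcf : Continuous (fderiv ℝ φ) := φ.contDiff.continuous_fderiv (by simp)
      exact (Continuous.intervalIntegrable (by fun_prop) _ _)

variable [MeasureSpace V] [BorelSpace V] [(volume : Measure V).IsAddHaarMeasure]

lemma measurePreserving_shear (s : ℝ) (m : V) :
    MeasurePreserving (fun z : ℝ × V => (z.1, z.2 + z.1 • m))
      ((volume.restrict (Ioc 0 s)).prod (volume : Measure V))
      ((volume.restrict (Ioc 0 s)).prod (volume : Measure V)) := by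
  refine (MeasurePreserving.id (volume.restrict (Ioc 0 s))).skew_product
    (g := fun (τ : ℝ) (x : V) => x + τ • m) (by fun_prop) (ae_of_all _ fun τ => ?_)
  exact (measurePreserving_add_right volume (τ • m)).map_eq

lemma integrable_shear {w : V → ℝ} (hw : Integrable w) (s : ℝ) (m : V) :
    Integrable (fun z : ℝ × V => w (z.2 + z.1 • m))
      ((volume.restrict (Ioc 0 s)).prod (volume : Measure V)) :=
  (measurePreserving_shear s m).integrable_comp_of_integrable
    (g := fun z : ℝ × V => w z.2) (hw.comp_snd _)

lemma integrable_average {w : V → ℝ} (hw : Integrable w) {s : ℝ} (hs : 0 ≤ s) (m : V) :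
    Integrable (fun x => ∫ τ in (0 : ℝ)..s, w (x + τ • m)) := by
  simp only [intervalIntegral.integral_of_le hs]
  exact (integrable_shear hw s m).swap.integral_prod_left

/-- Integrals of `w` over segments that start in a set `K` only see `w` on the sweep of `K`. -/
lemma average_indicator {w : V → ℝ} {K : Set V} {s : ℝ} (hs : 0 ≤ s) {m x : V} (hx : x ∈ K) :
    ∫ τ in (0 : ℝ)..s, (sweep K s m).indicator w (x + τ • m)
      = ∫ τ in (0 : ℝ)..s, w (x + τ • m) := by
  refine intervalIntegral.integral_congr fun τ hτ => ?_
  rw [uIcc_of_le hs] at hτ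
  exact indicator_of_mem (mem_sweep hx hτ) _

lemma locallyIntegrableOn_average {U A : Opens V} {s : ℝ} (hs : 0 ≤ s) {m : V}
    (hA : Slides (A : Set V) U s m) {w : V → ℝ} (hw : LocallyIntegrableOn w (U : Set V)) :
    LocallyIntegrableOn (fun x => ∫ τ in (0 : ℝ)..s, w (x + τ • m)) (A : Set V) := by
  rw [locallyIntegrableOn_iff A.isOpen.isLocallyClosed]
  intro K hKA hK
  have h1 : IntegrableOn w (sweep K s m) :=
    hw.integrableOn_compact_subset (hA.sweep_subset hKA) (isCompact_sweep hK s m)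
  have h2 := integrable_average
    ((integrable_indicator_iff (isCompact_sweep hK s m).measurableSet).2 h1) hs m
  refine h2.integrableOn.congr_fun (fun x hx => ?_) hK.measurableSet
  exact average_indicator hs hx

lemma locallyIntegrableOn_translate {U A : Opens V} {s : ℝ} (hs : 0 ≤ s) {m : V}
    (hA : Slides (A : Set V) U s m) {u : V → ℝ} (hu : LocallyIntegrableOn u (U : Set V)) :
    LocallyIntegrableOn (fun x => u (x + s • m)) (A : Set V) := by
  rw [locallyIntegrableOn_iff A.isOpen.isLocallyClosed]
  intro K hKA hK
  have h1 : IntegrableOn u (sweep K s m) :=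
    hu.integrableOn_compact_subset (hA.sweep_subset hKA) (isCompact_sweep hK s m)
  have h2 := ((integrable_indicator_iff (isCompact_sweep hK s m).measurableSet).2 h1).comp_add_right
    (s • m)
  refine h2.integrableOn.congr_fun (fun x hx => ?_) hK.measurableSet
  exact indicator_of_mem (mem_sweep hx ⟨hs, le_rfl⟩) _

lemma integral_vol_eq {U : Opens V} {g : V → ℝ} (h : ∀ x, x ∉ (U : Set V) → g x = 0) :
    ∫ x, g x ∂(vol U) = ∫ x, g x :=
  setIntegral_eq_integral_of_forall_compl_eq_zero h

lemma integrable_mul_of_compact {w : V → ℝ} {K : Set V} (hK : IsCompact K)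
    (hw : IntegrableOn w K) {φ : V → ℝ} (hφ : Continuous φ) (h0 : ∀ x, x ∉ K → φ x = 0) :
    Integrable (fun x => w x * φ x) := by
  have h1 : IntegrableOn (fun x => w x * φ x) K :=
    hw.mul_continuousOn hφ.continuousOn hK
  refine (integrableOn_iff_integrable_of_support_subset fun x hx => ?_).1 h1
  by_contra hxK
  exact hx (by simp [h0 x hxK])

/-- Averaging along a segment is adjoint to averaging along the opposite segment. -/
lemma integral_mul_average {U A : Opens V} {s : ℝ} (hs : 0 ≤ s) {m : V}
    (hA : Slides (A : Set V) U s m) {w : V → ℝ} (hw : LocallyIntegrableOn w (U : Set V))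
    (φ : 𝓓(A, ℝ)) {ψ : 𝓓(U, ℝ)} (hψ : ∀ x, ψ x = ∫ τ in (0 : ℝ)..s, φ (x - τ • m)) :
    ∫ x, w x * ψ x ∂(vol U) = ∫ x, (∫ τ in (0 : ℝ)..s, w (x + τ • m)) * φ x ∂(vol A) := by
  set K := tsupport φ with hKdef
  have hK : IsCompact K := φ.hasCompactSupport
  have hS := isCompact_sweep hK s m
  have hwS : IntegrableOn w (sweep K s m) :=
    hw.integrableOn_compact_subset (hA.sweep_subset φ.tsupport_subset) hS
  set w' := (sweep K s m).indicator w with hw'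
  have hw'i : Integrable w' := (integrable_indicator_iff hS.measurableSet).2 hwS
  have hφ0 : ∀ x, x ∉ K → φ x = 0 := fun x hx => image_eq_zero_of_notMem_tsupport hx
  obtain ⟨C, hC⟩ := φ.continuous.bounded_above_of_compact_support φ.hasCompactSupport
  rw [integral_vol_eq (fun x hx => by
      rw [image_eq_zero_of_notMem_tsupport (fun h => hx (ψ.tsupport_subset h)), mul_zero]),
    integral_vol_eq (fun x hx => by
      rw [image_eq_zero_of_notMem_tsupport (fun h => hx (φ.tsupport_subset h)), mul_zero])]
  -- both sides are integrals of the same function on `(0, s] × V`, in sheared coordinates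
  have e1 : ∫ x, w x * ψ x
      = ∫ z : ℝ × V, w' z.2 * φ (z.2 - z.1 • m) ∂((volume.restrict (Ioc 0 s)).prod volume) := by
    rw [integral_prod_symm]
    · refine integral_congr_ae (ae_of_all _ fun x => ?_)
      simp only
      rw [integral_const_mul, ← intervalIntegral.integral_of_le hs, ← hψ]
      by_cases hx : x ∈ sweep K s m
      · rw [hw', indicator_of_mem hx]
      · have : ψ x = 0 := by
          rw [hψ, intervalIntegral.integral_of_le hs]
          refine setIntegral_eq_zero_of_forall_eq_zero fun τ hτ => hφ0 _ fun h => hx ?_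
          have h3 : x = (x - τ • m) + τ • m := by abel
          rw [h3]
          exact mem_sweep h ⟨hτ.1.le, hτ.2⟩
        simp [this]
    · refine (hw'i.comp_snd _).mul_bdd (c := C) ?_ (ae_of_all _ fun z => hC _)
      exact (Continuous.aestronglyMeasurable (by fun_prop))
  have e2 : ∫ x, (∫ τ in (0 : ℝ)..s, w (x + τ • m)) * φ x
      = ∫ z : ℝ × V, w' (z.2 + z.1 • m) * φ z.2 ∂((volume.restrict (Ioc 0 s)).prod volume) := by
    rw [integral_prod_symm]
    · refine integral_congr_ae (ae_of_all _ fun x => ?_)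
      simp only
      rw [integral_mul_const, ← intervalIntegral.integral_of_le hs]
      by_cases hx : x ∈ K
      · rw [hw', average_indicator hs hx]
      · simp [hφ0 x hx]
    · refine (integrable_shear hw'i s m).mul_bdd (c := C) ?_ (ae_of_all _ fun z => hC _)
      exact (Continuous.aestronglyMeasurable (by fun_prop))
  rw [e1, e2, ← (measurePreserving_shear s m).integral_comp' (f := 
    { toFun := fun z : ℝ × V => (z.1, z.2 + z.1 • m)
      invFun := fun z : ℝ × V => (z.1, z.2 - z.1 • m)
      left_inv := fun z => by simp
      right_inv := fun z => by simp
      measurable_toFun := by simp only [Equiv.coe_fn_mk]; fun_prop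
      measurable_invFun := by simp only [Equiv.coe_fn_symm_mk]; fun_prop })]
  simp

lemma integral_mul_translate {U A : Opens V} {s : ℝ} (hs : 0 ≤ s) {m : V}
    (hA : Slides (A : Set V) U s m) (u : V → ℝ) (φ : 𝓓(A, ℝ)) :
    ∫ x, u x * φ (x - s • m) ∂(vol U) = ∫ x, u (x + s • m) * φ x ∂(vol A) := by
  rw [integral_vol_eq, integral_vol_eq, ← integral_add_right_eq_self _ (s • m)]
  · simp
  · intro x hx
    rw [image_eq_zero_of_notMem_tsupport (fun h => hx (φ.tsupport_subset h)), mul_zero]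
  · intro x hx
    rw [image_eq_zero_of_notMem_tsupport (f := φ) (fun h => hx ?_), mul_zero]
    simpa using hA _ (φ.tsupport_subset h) s ⟨hs, le_rfl⟩

/-- A locally integrable function on an open set that annihilates all test functions vanishes. -/
lemma ae_eq_zero_of_forall_testFunction {U : Opens V} {f : V → ℝ}
    (hf : LocallyIntegrableOn f (U : Set V))
    (h : ∀ φ : 𝓓(U, ℝ), ∫ x, f x * φ x ∂(vol U) = 0) : ∀ᵐ x ∂(vol U), f x = 0 := by
  rw [ae_restrict_iff' U.isOpen.measurableSet]
  refine U.isOpen.ae_eq_zero_of_integral_contDiff_smul_eq_zero hf fun g hg hgc hgs => ?_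
  have h1 := h ⟨g, hg, hgc, hgs⟩
  rw [integral_vol_eq] at h1
  · simpa [mul_comm] using h1
  · intro x hx
    rw [image_eq_zero_of_notMem_tsupport (f := (⟨g, hg, hgc, hgs⟩ : 𝓓(U, ℝ)))
      (fun h => hx (TestFunction.tsupport_subset _ h)), mul_zero]

/-- The increment of `u` along a segment is the integral of its weak derivative: test with the
average of a test function along the opposite segment. -/
theorem HasWeakDeriv.translate {U A : Opens V} {u w : V → ℝ} {s : ℝ} (hs : 0 ≤ s) {m : V}
    (h : HasWeakDeriv U u w m) (hA : Slides (A : Set V) U s m) :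
    ∀ᵐ x ∂(vol A), u (x + s • m) - u x = ∫ τ in (0 : ℝ)..s, w (x + τ • m) := by
  obtain ⟨hu, hw, hd⟩ := h
  have hu1 := locallyIntegrableOn_translate hs hA hu
  have hu2 : LocallyIntegrableOn u (A : Set V) := hu.mono_set (hA.subset hs)
  have hw1 := locallyIntegrableOn_average hs hA hw
  have key : ∀ᵐ x ∂(vol A), (u (x + s • m) - u x) - ∫ τ in (0 : ℝ)..s, w (x + τ • m) = 0 := by
    refine ae_eq_zero_of_forall_testFunction ((hu1.sub hu2).sub hw1) fun φ => ?_
    obtain ⟨ψ, hψ, -, hψd, hψ0⟩ := exists_testFunction_average hs hA φ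
    have i0 : ∀ {g : V → ℝ}, LocallyIntegrableOn g (A : Set V) →
        Integrable (fun x => g x * φ x) (vol A) := fun hg =>
      (integrable_mul_of_compact φ.hasCompactSupport
        (hg.integrableOn_compact_subset φ.tsupport_subset φ.hasCompactSupport) φ.continuous
        fun x hx => image_eq_zero_of_notMem_tsupport hx).restrict
    have e := hd ψ
    rw [integral_mul_average hs hA hw φ hψ] at e
    simp only [hψd, mul_sub] at e
    have hS := isCompact_sweep φ.hasCompactSupport s m
    have huS : IntegrableOn u (sweep (tsupport φ) s m) :=
      hu.integrableOn_compact_subset (hA.sweep_subset φ.tsupport_subset) hS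
    rw [integral_sub, integral_mul_translate hs hA, integral_vol_eq, ← integral_vol_eq (U := A)] at e
    · simp only [sub_mul]
      rw [integral_sub (f := fun x => u (x + s • m) * φ x - u x * φ x) ((i0 hu1).sub (i0 hu2))
        (i0 hw1), integral_sub (i0 hu1) (i0 hu2)]
      linarith
    · intro x hx
      rw [image_eq_zero_of_notMem_tsupport (fun h => hx (φ.tsupport_subset h)), mul_zero]
    · intro x hx
      rw [image_eq_zero_of_notMem_tsupport
        (fun h => hx (hA.subset hs (φ.tsupport_subset h))), mul_zero]
    · refine (integrable_mul_of_compact hS huS φ.continuous fun x hx => ?_).restrict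
      refine image_eq_zero_of_notMem_tsupport fun h => hx ?_
      simpa using mem_sweep (m := m) h (τ := 0) ⟨le_rfl, hs⟩
    · refine (integrable_mul_of_compact (φ := fun x => φ (x - s • m)) hS huS
        (by fun_prop) fun x hx => ?_).restrict
      refine image_eq_zero_of_notMem_tsupport fun h => hx ?_
      simpa using mem_sweep (m := m) h (τ := s) ⟨hs, le_rfl⟩
  filter_upwards [key] with x hx
  linarith

end Translation

/-! ### Weak derivatives -/

section WeakDerivative

variable {V : Type*} [NormedAddCommGroup V] [NormedSpace ℝ V] [FiniteDimensional ℝ V]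
  [MeasureSpace V] [BorelSpace V] [(volume : Measure V).IsAddHaarMeasure]

lemma HasWeakDeriv.congr {U : Opens V} {u u' w w' : V → ℝ} {m : V} (h : HasWeakDeriv U u w m)
    (hu : u =ᵐ[vol U] u') (hw : w =ᵐ[vol U] w') : HasWeakDeriv U u' w' m := by
  refine ⟨h.1.congr hu, h.2.1.congr hw, fun φ => ?_⟩
  rw [← integral_congr_ae (f := fun x => u x * fderiv ℝ φ x m)
      (g := fun x => u' x * fderiv ℝ φ x m) (by filter_upwards [hu] with x hx; rw [hx]),
    ← integral_congr_ae (f := fun x => w x * φ x) (g := fun x => w' x * φ x)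
      (by filter_upwards [hw] with x hx; rw [hx])]
  exact h.2.2 φ

lemma HasWeakDeriv.exists_measurable {U : Opens V} {u w : V → ℝ} {m : V}
    (h : HasWeakDeriv U u w m) :
    ∃ w', Measurable w' ∧ w =ᵐ[vol U] w' ∧ HasWeakDeriv U u w' m := by
  have hm := h.2.1.aestronglyMeasurable.aemeasurable
  exact ⟨_, hm.measurable_mk, hm.ae_eq_mk, h.congr (ae_eq_refl u) hm.ae_eq_mk⟩

lemma integrable_mul_testFunction {U : Opens V} {u : V → ℝ}
    (hu : LocallyIntegrableOn u (U : Set V)) (φ : 𝓓(U, ℝ)) :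
    Integrable (fun x => u x * φ x) (vol U) :=
  (integrable_mul_of_compact φ.hasCompactSupport
    (hu.integrableOn_compact_subset φ.tsupport_subset φ.hasCompactSupport) φ.continuous
    fun _ hx => image_eq_zero_of_notMem_tsupport hx).restrict

lemma continuous_fderiv_apply {U : Opens V} (φ : 𝓓(U, ℝ)) (m : V) :
    Continuous (fun x => fderiv ℝ φ x m) := by
  have hcf : Continuous (fderiv ℝ φ) := φ.contDiff.continuous_fderiv (by simp)
  fun_prop

lemma fderiv_eq_zero_of_notMem {U : Opens V} (φ : 𝓓(U, ℝ)) {x : V} (hx : x ∉ tsupport φ) (m : V) :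
    fderiv ℝ φ x m = 0 := by
  rw [image_eq_zero_of_notMem_tsupport (f := fderiv ℝ φ)
    (fun h => hx (tsupport_fderiv_subset ℝ h))]
  rfl

lemma integrable_mul_fderiv {U : Opens V} {u : V → ℝ}
    (hu : LocallyIntegrableOn u (U : Set V)) (φ : 𝓓(U, ℝ)) (m : V) :
    Integrable (fun x => u x * fderiv ℝ φ x m) (vol U) :=
  (integrable_mul_of_compact φ.hasCompactSupport
    (hu.integrableOn_compact_subset φ.tsupport_subset φ.hasCompactSupport)
    (continuous_fderiv_apply φ m) fun _ hx => fderiv_eq_zero_of_notMem φ hx m).restrict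

lemma HasWeakDeriv.mono {U A : Opens V} (hAU : A ≤ U) {u w : V → ℝ} {m : V}
    (h : HasWeakDeriv U u w m) : HasWeakDeriv A u w m := by
  refine ⟨h.1.mono_set hAU, h.2.1.mono_set hAU, fun φ => ?_⟩
  have hφ := h.2.2 ⟨φ, φ.contDiff, φ.hasCompactSupport, φ.tsupport_subset.trans hAU⟩
  have h0 : ∀ x, x ∉ tsupport φ → φ x = 0 := fun x hx => image_eq_zero_of_notMem_tsupport hx
  simp only [TestFunction.coe_mk] at hφ
  rw [integral_vol_eq, integral_vol_eq] at hφ ⊢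
  · exact hφ
  all_goals intro x hx
  · rw [h0 x (fun h => hx (φ.tsupport_subset h)), mul_zero]
  · rw [h0 x (fun h => hx (hAU (φ.tsupport_subset h))), mul_zero]
  · rw [fderiv_eq_zero_of_notMem φ (fun h => hx (φ.tsupport_subset h)), mul_zero]
  · rw [fderiv_eq_zero_of_notMem φ (fun h => hx (hAU (φ.tsupport_subset h))), mul_zero]

lemma HasWeakDeriv.sub {U : Opens V} {u u' w w' : V → ℝ} {m : V}
    (h : HasWeakDeriv U u w m) (h' : HasWeakDeriv U u' w' m) :
    HasWeakDeriv U (fun x => u x - u' x) (fun x => w x - w' x) m := by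
  refine ⟨h.1.sub h'.1, h.2.1.sub h'.2.1, fun φ => ?_⟩
  simp only [sub_mul]
  rw [integral_sub (integrable_mul_fderiv h.1 φ m) (integrable_mul_fderiv h'.1 φ m),
    integral_sub (integrable_mul_testFunction h.2.1 φ) (integrable_mul_testFunction h'.2.1 φ),
    h.2.2, h'.2.2]
  ring

lemma HasWeakDeriv.sum_smul {ι : Type*} {I : Finset ι} {U : Opens V} {u : V → ℝ} {w : ι → V → ℝ}
    {m : ι → V} (hu : LocallyIntegrableOn u (U : Set V))
    (h : ∀ i ∈ I, HasWeakDeriv U u (w i) (m i)) (c : ι → ℝ) :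
    HasWeakDeriv U u (fun x => ∑ i ∈ I, c i * w i x) (∑ i ∈ I, c i • m i) := by
  have hloc : ∀ i ∈ I, LocallyIntegrableOn (fun x => c i * w i x) (U : Set V) := fun i hi =>
    (h i hi).2.1.smul (c i)
  have hs : LocallyIntegrableOn (fun x => ∑ i ∈ I, c i * w i x) (U : Set V) := by
    rw [locallyIntegrableOn_iff U.isOpen.isLocallyClosed]
    intro K hKU hK
    exact integrable_finsetSum _ fun i hi => (hloc i hi).integrableOn_compact_subset hKU hK
  refine ⟨hu, hs, fun φ => ?_⟩
  simp only [map_sum, map_smul, smul_eq_mul, Finset.mul_sum, Finset.sum_mul]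
  rw [integral_finsetSum, integral_finsetSum, ← Finset.sum_neg_distrib]
  · refine Finset.sum_congr rfl fun i hi => ?_
    have := (h i hi).2.2 φ
    calc ∫ x, u x * (c i * fderiv ℝ φ x (m i)) ∂(vol U)
        = c i * ∫ x, u x * fderiv ℝ φ x (m i) ∂(vol U) := by
          rw [← integral_const_mul]; congr 1 with x; ring
      _ = - ∫ x, c i * w i x * φ x ∂(vol U) := by
          rw [this, mul_neg, ← integral_const_mul]; congr 2 with x; ring
  · exact fun i hi => integrable_mul_testFunction (hloc i hi) φ
  · intro i hi
    exact ((integrable_mul_fderiv hu φ (m i)).const_mul (c i)).congr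
      (ae_of_all _ fun x => by simp only; ring)

lemma HasWeakDeriv.ae_unique {U : Opens V} {u w w' : V → ℝ} {m : V} (h : HasWeakDeriv U u w m)
    (h' : HasWeakDeriv U u w' m) : w =ᵐ[vol U] w' := by
  have := ae_eq_zero_of_forall_testFunction (h.2.1.sub h'.2.1) fun φ => by
    simp only [Pi.sub_apply, sub_mul]
    rw [integral_sub (integrable_mul_testFunction h.2.1 φ) (integrable_mul_testFunction h'.2.1 φ)]
    linarith [h.2.2 φ, h'.2.2 φ]
  filter_upwards [this] with x hx
  exact sub_eq_zero.1 hx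

/-! ### Difference quotients -/

lemma lintegral_slide_le {U A : Opens V} {s : ℝ} {m : V} (hA : Slides (A : Set V) U s m)
    {τ : ℝ} (hτ : τ ∈ Icc 0 s) (g : V → ℝ≥0∞) :
    ∫⁻ x, g (x + τ • m) ∂(vol A) ≤ ∫⁻ x, g x ∂(vol U) := by
  calc ∫⁻ x, g (x + τ • m) ∂(vol A)
      = ∫⁻ x in (A : Set V), (U : Set V).indicator g (x + τ • m) := by
        refine setLIntegral_congr_fun A.isOpen.measurableSet fun x hx => ?_
        exact (indicator_of_mem (hA x hx τ hτ) g).symm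
    _ ≤ ∫⁻ x, (U : Set V).indicator g (x + τ • m) := setLIntegral_le_lintegral _ _
    _ = ∫⁻ x, (U : Set V).indicator g x := lintegral_add_right_eq_self _ _
    _ = ∫⁻ x, g x ∂(vol U) := lintegral_indicator U.isOpen.measurableSet _

lemma rpow_lintegral_Ioc_le {r : ℝ} (hr : 1 ≤ r) (s : ℝ) {g : ℝ → ℝ≥0∞} (hg : Measurable g) :
    (∫⁻ τ in Ioc 0 s, g τ) ^ r ≤ ENNReal.ofReal s ^ (r - 1) * ∫⁻ τ in Ioc 0 s, g τ ^ r := by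
  rcases hr.eq_or_lt with rfl | hr
  · simp
  have hpq := Real.HolderConjugate.conjExponent hr
  have h := ENNReal.lintegral_mul_le_Lp_mul_Lq (volume.restrict (Ioc 0 s)) hpq
    hg.aemeasurable (aemeasurable_const (b := (1 : ℝ≥0∞)))
  simp only [Pi.mul_apply, mul_one, ENNReal.one_rpow, lintegral_const, one_mul,
    Measure.restrict_apply MeasurableSet.univ, univ_inter, Real.volume_Ioc, sub_zero] at h
  have h2 := ENNReal.rpow_le_rpow h (by linarith : 0 ≤ r)
  rw [ENNReal.mul_rpow_of_nonneg _ _ (by linarith), ← ENNReal.rpow_mul, ← ENNReal.rpow_mul,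
    one_div_mul_cancel (by linarith), ENNReal.rpow_one, mul_comm] at h2
  refine h2.trans (le_of_eq ?_)
  congr 2
  have hr1 : r - 1 ≠ 0 := by linarith
  have hr0 : r ≠ 0 := by linarith
  rw [Real.conjExponent]
  field_simp

lemma enorm_average_le {w : V → ℝ} {s : ℝ} (hs : 0 ≤ s) (x m : V) :
    ‖∫ τ in (0 : ℝ)..s, w (x + τ • m)‖ₑ ≤ ∫⁻ τ in Ioc 0 s, ‖w (x + τ • m)‖ₑ := by
  rw [intervalIntegral.integral_of_le hs]
  exact enorm_integral_le_lintegral_enorm _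

lemma lintegral_average_rpow_le {U A : Opens V} {w : V → ℝ} {s : ℝ} {m : V} {r : ℝ}
    (hr : 1 ≤ r) (hs : 0 ≤ s) (hw : Measurable w) (hA : Slides (A : Set V) U s m) :
    ∫⁻ x, (∫⁻ τ in Ioc 0 s, ‖w (x + τ • m)‖ₑ) ^ r ∂(vol A)
      ≤ ENNReal.ofReal s ^ r * ∫⁻ x, ‖w x‖ₑ ^ r ∂(vol U) := by
  have hm : Measurable fun z : V × ℝ => ‖w (z.1 + z.2 • m)‖ₑ ^ r := by fun_prop
  calc ∫⁻ x, (∫⁻ τ in Ioc 0 s, ‖w (x + τ • m)‖ₑ) ^ r ∂(vol A)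
      ≤ ∫⁻ x, ENNReal.ofReal s ^ (r - 1) *
          (∫⁻ τ in Ioc 0 s, ‖w (x + τ • m)‖ₑ ^ r) ∂(vol A) :=
        lintegral_mono fun x => rpow_lintegral_Ioc_le hr s (by fun_prop)
    _ = ENNReal.ofReal s ^ (r - 1) * ∫⁻ τ in Ioc (0 : ℝ) s, ∫⁻ x, ‖w (x + τ • m)‖ₑ ^ r ∂(vol A) := by
        rw [lintegral_const_mul _ (hm.lintegral_prod_right'), lintegral_lintegral_swap]
        exact hm.aemeasurable
    _ ≤ ENNReal.ofReal s ^ (r - 1) * ∫⁻ _ in Ioc (0 : ℝ) s, ∫⁻ x, ‖w x‖ₑ ^ r ∂(vol U) := by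
        gcongr _ * ?_
        exact setLIntegral_mono measurable_const fun τ hτ =>
          lintegral_slide_le hA ⟨hτ.1.le, hτ.2⟩ (fun x => ‖w x‖ₑ ^ r)
    _ = ENNReal.ofReal s ^ r * ∫⁻ x, ‖w x‖ₑ ^ r ∂(vol U) := by
        rw [setLIntegral_const, Real.volume_Ioc, sub_zero, mul_comm (∫⁻ x, _ ∂_), ← mul_assoc]
        rcases hs.eq_or_lt with rfl | hs'
        · simp [ENNReal.zero_rpow_of_pos (by linarith : 0 < r)]
        · congr 1
          nth_rewrite 2 [← ENNReal.rpow_one (ENNReal.ofReal s)]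
          rw [← ENNReal.rpow_add _ _ (by simpa using hs') ENNReal.ofReal_ne_top]
          congr 1; ring

/-- Difference quotients are bounded in `L^r` by the weak derivative. -/
theorem HasWeakDeriv.lintegral_diff_rpow_le {U A : Opens V} {u w : V → ℝ} {s : ℝ} {m : V} {r : ℝ}
    (h : HasWeakDeriv U u w m) (hr : 1 ≤ r) (hs : 0 ≤ s) (hA : Slides (A : Set V) U s m) :
    ∫⁻ x, ‖u (x + s • m) - u x‖ₑ ^ r ∂(vol A)
      ≤ ENNReal.ofReal s ^ r * ∫⁻ x, ‖w x‖ₑ ^ r ∂(vol U) := by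
  obtain ⟨w', hw', hww', h'⟩ := h.exists_measurable
  have e : ∫⁻ x, ‖w x‖ₑ ^ r ∂(vol U) = ∫⁻ x, ‖w' x‖ₑ ^ r ∂(vol U) :=
    lintegral_congr_ae (by filter_upwards [hww'] with x hx; rw [hx])
  rw [e]
  refine le_trans (lintegral_mono_ae ?_) (lintegral_average_rpow_le hr hs hw' hA)
  filter_upwards [h'.translate hs hA] with x hx
  rw [hx]
  exact ENNReal.rpow_le_rpow (enorm_average_le hs x m) (by linarith)

/-! ### Gain of integrability -/

/-- On a set from which one can slide inwards in the direction `m`, a power of `u` is bounded by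
integrals over whole lines. -/
lemma HasWeakDeriv.enorm_rpow_le_lintegral_line {U A : Opens V} {u w : V → ℝ} {s : ℝ} {m : V}
    {r : ℝ} (h : HasWeakDeriv U u w m) (hu : Measurable u) (hw : Measurable w)
    (hr : 1 ≤ r) (hs : 0 < s) (hA : Slides (A : Set V) U s m) :
    ∀ᵐ x ∂(vol A), ‖u x‖ₑ ^ r ≤ ∫⁻ τ : ℝ, (ENNReal.ofReal (s⁻¹) * 2 ^ (r - 1) *
      (1 + ENNReal.ofReal s ^ r)) * (U : Set V).indicator (fun y => ‖u y‖ₑ ^ r + ‖w y‖ₑ ^ r)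
        (x + τ • m) := by
  have hr0 : 0 ≤ r := by linarith
  have h1 : ∀ᵐ τ : ℝ ∂(volume.restrict (Ioc 0 s)), ∀ᵐ x ∂(vol A),
      ‖u x‖ₑ ≤ ‖u (x + τ • m)‖ₑ + ∫⁻ σ in Ioc 0 s, ‖w (x + σ • m)‖ₑ := by
    filter_upwards [ae_restrict_mem measurableSet_Ioc] with τ hτ
    have hA' : Slides (A : Set V) U τ m := fun x hx σ hσ => hA x hx σ ⟨hσ.1, hσ.2.trans hτ.2⟩
    filter_upwards [h.translate hτ.1.le hA'] with x hx
    have h2 : u x = u (x + τ • m) - ∫ σ in (0 : ℝ)..τ, w (x + σ • m) := by rw [← hx]; ring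
    calc ‖u x‖ₑ ≤ ‖u (x + τ • m)‖ₑ + ‖∫ σ in (0 : ℝ)..τ, w (x + σ • m)‖ₑ := by
          nth_rewrite 1 [h2]; exact enorm_sub_le
      _ ≤ _ := by
          gcongr
          exact (enorm_average_le hτ.1.le x m).trans
            (lintegral_mono_set (Ioc_subset_Ioc_right hτ.2))
  have hm : Measurable fun z : V × ℝ => ‖w (z.1 + z.2 • m)‖ₑ := by fun_prop
  have hms : MeasurableSet {z : ℝ × V | ‖u z.2‖ₑ ≤ ‖u (z.2 + z.1 • m)‖ₑ
      + ∫⁻ σ in Ioc 0 s, ‖w (z.2 + σ • m)‖ₑ} := by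
    have := hm.lintegral_prod_right' (ν := volume.restrict (Ioc 0 s))
    refine measurableSet_le (by fun_prop) (Measurable.add (by fun_prop) (this.comp measurable_snd))
  rw [Measure.ae_ae_comm hms] at h1
  filter_upwards [h1, ae_restrict_mem A.isOpen.measurableSet] with x hx hxA
  set c : ℝ≥0∞ := ENNReal.ofReal (s⁻¹) * 2 ^ (r - 1) with hc
  have hs1 : ENNReal.ofReal s⁻¹ * ENNReal.ofReal s = 1 := by
    rw [← ENNReal.ofReal_mul (by positivity), inv_mul_cancel₀ hs.ne', ENNReal.ofReal_one]
  have hGu : Measurable ((U : Set V).indicator fun y => ‖u y‖ₑ ^ r + ‖w y‖ₑ ^ r) :=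
    Measurable.indicator (by fun_prop) U.isOpen.measurableSet
  -- average the bound for the increment over the length of the segment, so that only integrals
  -- along the line remain
  calc ‖u x‖ₑ ^ r
      = ENNReal.ofReal s⁻¹ * ∫⁻ _ in Ioc (0 : ℝ) s, ‖u x‖ₑ ^ r := by
        rw [setLIntegral_const, Real.volume_Ioc, sub_zero, mul_comm (‖u x‖ₑ ^ r), ← mul_assoc, hs1,
          one_mul]
    _ ≤ ENNReal.ofReal s⁻¹ * ∫⁻ τ in Ioc 0 s, 2 ^ (r - 1) * (‖u (x + τ • m)‖ₑ ^ r
          + (∫⁻ σ in Ioc 0 s, ‖w (x + σ • m)‖ₑ) ^ r) := by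
        gcongr _ * ?_
        refine lintegral_mono_ae ?_
        filter_upwards [hx] with τ hτ
        exact (ENNReal.rpow_le_rpow hτ hr0).trans (ENNReal.rpow_add_le_mul_rpow_add_rpow _ _ hr)
    _ = c * ((∫⁻ τ in Ioc 0 s, ‖u (x + τ • m)‖ₑ ^ r)
          + ENNReal.ofReal s * (∫⁻ σ in Ioc 0 s, ‖w (x + σ • m)‖ₑ) ^ r) := by
        rw [lintegral_const_mul _ (by fun_prop), lintegral_add_right _ measurable_const,
          setLIntegral_const, Real.volume_Ioc, sub_zero, ← mul_assoc, hc, mul_comm (_ ^ r)]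
    _ ≤ c * ((∫⁻ τ in Ioc 0 s, ‖u (x + τ • m)‖ₑ ^ r)
          + ENNReal.ofReal s * (ENNReal.ofReal s ^ (r - 1) *
            ∫⁻ σ in Ioc 0 s, ‖w (x + σ • m)‖ₑ ^ r)) := by
        gcongr
        exact rpow_lintegral_Ioc_le hr s (by fun_prop)
    _ = c * ((∫⁻ τ in Ioc 0 s, ‖u (x + τ • m)‖ₑ ^ r)
          + ENNReal.ofReal s ^ r * ∫⁻ σ in Ioc 0 s, ‖w (x + σ • m)‖ₑ ^ r) := by
        rw [← mul_assoc (ENNReal.ofReal s)]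
        congr 3
        nth_rewrite 1 [← ENNReal.rpow_one (ENNReal.ofReal s)]
        rw [← ENNReal.rpow_add _ _ (by simpa using hs) ENNReal.ofReal_ne_top]
        congr 1; ring
    _ ≤ c * ((1 + ENNReal.ofReal s ^ r) * ∫⁻ τ in Ioc 0 s, (‖u (x + τ • m)‖ₑ ^ r
          + ‖w (x + τ • m)‖ₑ ^ r)) := by
        rw [lintegral_add_left (by fun_prop), add_mul, one_mul]
        gcongr
        · exact le_self_add
        · exact le_add_self
    _ = c * (1 + ENNReal.ofReal s ^ r) * ∫⁻ τ in Ioc 0 s,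
          (U : Set V).indicator (fun y => ‖u y‖ₑ ^ r + ‖w y‖ₑ ^ r) (x + τ • m) := by
        rw [mul_assoc c, setLIntegral_congr_fun (measurableSet_Ioc (a := (0 : ℝ)) (b := s))]
        intro τ hτ
        exact (indicator_of_mem (hA x hxA τ ⟨hτ.1.le, hτ.2⟩)
          (fun y => ‖u y‖ₑ ^ r + ‖w y‖ₑ ^ r)).symm
    _ ≤ _ := by
        rw [← lintegral_const_mul _ (by fun_prop)]
        exact setLIntegral_le_lintegral _ _

/-- If a set `A` can be slid inwards in `n` linearly independent directions, then functions in
`W^{1,r}` gain integrability on `A`: they lie in `L^{r n / (n - 1)}`. This is the Gagliardo argument: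
bound `|u|^r` by integrals over lines in each of the directions, and apply the grid-lines lemma. -/
theorem lintegral_rpow_lt_top_of_slides {ι : Type*} [Fintype ι] (hn : 2 ≤ Fintype.card ι)
    (b : Module.Basis ι ℝ V) {U A : Opens V} {u : V → ℝ} {w : ι → V → ℝ} {s r : ℝ}
    (hr : 1 ≤ r) (hs : 0 < s) (h : ∀ i, HasWeakDeriv U u (w i) (b i))
    (hA : ∀ i, Slides (A : Set V) U s (b i)) (hu : ∫⁻ x, ‖u x‖ₑ ^ r ∂(vol U) < ∞)
    (hw : ∀ i, ∫⁻ x, ‖w i x‖ₑ ^ r ∂(vol U) < ∞) :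
    ∫⁻ x, ‖u x‖ₑ ^ (r * (Fintype.card ι / (Fintype.card ι - 1) : ℝ)) ∂(vol A) < ∞ := by
  classical
  have hn1 : (1 : ℝ) < Fintype.card ι := by exact_mod_cast hn
  obtain ⟨i₀⟩ : Nonempty ι := Fintype.card_pos_iff.1 (by omega)
  have hAU : (A : Set V) ⊆ U := (hA i₀).subset hs.le
  -- pass to measurable representatives
  choose w' hw'm hww' h' using fun i => (h i).exists_measurable
  have hum := (h i₀).1.aestronglyMeasurable.aemeasurable
  set u' := hum.mk u with hu'def
  have huu' : u =ᵐ[vol U] u' := hum.ae_eq_mk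
  have hu'm : Measurable u' := hum.measurable_mk
  have h'' : ∀ i, HasWeakDeriv U u' (w' i) (b i) := fun i => (h' i).congr huu' (ae_eq_refl _)
  have hu' : ∫⁻ x, ‖u' x‖ₑ ^ r ∂(vol U) < ∞ := by
    rwa [lintegral_congr_ae (g := fun x => ‖u x‖ₑ ^ r)
      (by filter_upwards [huu'] with x hx; rw [hx])]
  have hw' : ∀ i, ∫⁻ x, ‖w' i x‖ₑ ^ r ∂(vol U) < ∞ := fun i => by
    rw [lintegral_congr_ae (g := fun x => ‖w i x‖ₑ ^ r)
      (by filter_upwards [hww' i] with x hx; rw [hx])]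
    exact hw i
  rw [lintegral_congr_ae (g := fun x => ‖u' x‖ₑ ^ (r * (Fintype.card ι / (Fintype.card ι - 1) : ℝ)))
    (by filter_upwards [ae_mono (Measure.restrict_mono hAU le_rfl) huu'] with x hx; rw [hx])]
  set c : ℝ≥0∞ := ENNReal.ofReal (s⁻¹) * 2 ^ (r - 1) * (1 + ENNReal.ofReal s ^ r) with hc
  have hctop : c ≠ ∞ := by
    refine ENNReal.mul_ne_top (ENNReal.mul_ne_top ENNReal.ofReal_ne_top ?_) ?_
    · exact ENNReal.rpow_ne_top_of_nonneg (by linarith) (by simp)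
    · simp [ENNReal.rpow_eq_top_iff]; intro; linarith
  set G : V → ℝ≥0∞ := fun x => c * (U : Set V).indicator
    (fun y => ‖u' y‖ₑ ^ r + ∑ i, ‖w' i y‖ₑ ^ r) x with hG
  have hGm : Measurable G :=
    (Measurable.indicator (by fun_prop) U.isOpen.measurableSet).const_mul c
  have hGint : ∫⁻ x, G x < ∞ := by
    rw [hG, lintegral_const_mul _ (Measurable.indicator (by fun_prop) U.isOpen.measurableSet),
      lintegral_indicator U.isOpen.measurableSet, lintegral_add_left (by fun_prop),
      lintegral_finsetSum _ (fun i _ => by fun_prop)]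
    refine ENNReal.mul_lt_top hctop.lt_top (ENNReal.add_lt_top.2 ⟨hu', ?_⟩)
    exact ENNReal.sum_lt_top.2 fun i _ => hw' i
  have hline : ∀ᵐ x ∂(vol A), ∀ i, ‖u' x‖ₑ ^ r ≤ ∫⁻ τ : ℝ, G (x + τ • b i) := by
    rw [ae_all_iff]
    intro i
    filter_upwards [(h'' i).enorm_rpow_le_lintegral_line hu'm (hw'm i) hr hs (hA i)] with x hx
    refine hx.trans (lintegral_mono fun τ => ?_)
    simp only [hG]
    gcongr
    exact Finset.single_le_sum (f := fun i => ‖w' i _‖ₑ ^ r) (fun _ _ => zero_le)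
      (Finset.mem_univ i)
  -- coordinates with respect to the basis
  let e : V ≃L[ℝ] (ι → ℝ) := b.equivFun.toContinuousLinearEquiv
  have he : ∀ (y : ι → ℝ) (i : ι) (t : ℝ),
      e.symm (Function.update y i t) = e.symm y + (t - y i) • b i := by
    intro y i t
    have : Function.update y i t = y + (t - y i) • Pi.single i (1 : ℝ) := by
      ext j
      by_cases hj : j = i
      · subst hj; simp
      · simp [hj]
    rw [this, map_add, map_smul]
    congr 2
    change b.equivFun.symm _ = _
    simp
  let μ : Measure (ι → ℝ) := Measure.map e volume
  have hμ : μ.IsAddHaarMeasure := e.isAddHaarMeasure_map volume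
  obtain ⟨k, hk0, hktop, hkμ⟩ : ∃ k : ℝ≥0∞, k ≠ 0 ∧ k ≠ ∞ ∧
      (volume : Measure V) = k • Measure.map e.symm (Measure.pi fun _ : ι => (volume : Measure ℝ)) := by
    have h1 : μ = Measure.addHaarScalarFactor μ volume • (volume : Measure (ι → ℝ)) :=
      Measure.isAddLeftInvariant_eq_smul _ _
    refine ⟨(Measure.addHaarScalarFactor μ volume : ℝ≥0), ?_, ENNReal.coe_ne_top, ?_⟩
    · exact_mod_cast (Measure.addHaarScalarFactor_pos_of_isAddHaarMeasure μ volume).ne'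
    · have h2 : Measure.map e.symm μ = volume := by
        rw [Measure.map_map e.symm.continuous.measurable e.continuous.measurable]
        simp
      have h3 := congrArg (Measure.map e.symm) h1
      rw [h2, Measure.map_smul] at h3
      exact h3
  have hesm : Measurable e.symm := e.symm.continuous.measurable
  have hconj : (Fintype.card ι : ℝ).HolderConjugate (Fintype.card ι / (Fintype.card ι - 1)) :=
    Real.HolderConjugate.conjExponent hn1
  have hgrid := lintegral_prod_lintegral_pow_le (fun _ : ι => (volume : Measure ℝ)) hconj
    (f := fun y => G (e.symm y)) (hGm.comp hesm)
  have hlineint : ∀ i, Measurable fun x : V => ∫⁻ τ : ℝ, G (x + τ • b i) := by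
    intro i
    exact Measurable.lintegral_prod_right' (f := fun z : V × ℝ => G (z.1 + z.2 • b i))
      (by fun_prop)
  have hn0 : (0 : ℝ) < Fintype.card ι - 1 := by linarith
  calc ∫⁻ x, ‖u' x‖ₑ ^ (r * (Fintype.card ι / (Fintype.card ι - 1) : ℝ)) ∂(vol A)
      = ∫⁻ x, ∏ _i : ι, (‖u' x‖ₑ ^ r) ^ ((1 : ℝ) / (Fintype.card ι - 1)) ∂(vol A) := by
        refine lintegral_congr fun x => ?_
        rw [Finset.prod_const, Finset.card_univ, ← ENNReal.rpow_natCast, ← ENNReal.rpow_mul,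
          ← ENNReal.rpow_mul]
        congr 1
        field_simp
    _ ≤ ∫⁻ x, ∏ i : ι, (∫⁻ τ : ℝ, G (x + τ • b i)) ^ ((1 : ℝ) / (Fintype.card ι - 1)) ∂(vol A) := by
        refine lintegral_mono_ae ?_
        filter_upwards [hline] with x hx
        exact Finset.prod_le_prod' fun i _ => ENNReal.rpow_le_rpow (hx i) (by positivity)
    _ ≤ ∫⁻ x, ∏ i : ι, (∫⁻ τ : ℝ, G (x + τ • b i)) ^ ((1 : ℝ) / (Fintype.card ι - 1)) :=
        setLIntegral_le_lintegral _ _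
    _ = k * ∫⁻ y, ∏ i : ι, (∫⁻ τ : ℝ, G (e.symm y + τ • b i)) ^ ((1 : ℝ) / (Fintype.card ι - 1))
          ∂(Measure.pi fun _ : ι => (volume : Measure ℝ)) := by
        conv_lhs => rw [hkμ]
        rw [lintegral_smul_measure, lintegral_map _ hesm, smul_eq_mul]
        exact Finset.measurable_prod _ fun i _ => (hlineint i).pow_const _
    _ = k * ∫⁻ y, ∏ i : ι, (∫⁻ t : ℝ, G (e.symm (Function.update y i t))) ^
          ((1 : ℝ) / (Fintype.card ι - 1)) ∂(Measure.pi fun _ : ι => (volume : Measure ℝ)) := by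
        congr 1
        refine lintegral_congr fun y => Finset.prod_congr rfl fun i _ => ?_
        congr 1
        simp only [he]
        exact (lintegral_sub_right_eq_self (fun t => G (e.symm y + t • b i)) (y i)).symm
    _ ≤ k * (∫⁻ y, G (e.symm y) ∂(Measure.pi fun _ : ι => (volume : Measure ℝ))) ^
          (Fintype.card ι / (Fintype.card ι - 1) : ℝ) := by
        gcongr
    _ < ∞ := by
        refine ENNReal.mul_lt_top hktop.lt_top (ENNReal.rpow_lt_top_of_nonneg (by positivity) ?_)
        rw [hkμ, lintegral_smul_measure, lintegral_map hGm hesm, smul_eq_mul] at hGint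
        intro htop
        rw [htop, ENNReal.mul_top hk0] at hGint
        exact lt_irrefl _ hGint

end WeakDerivative

/-! ### Weak derivatives from dual bounds -/

section Riesz

/-- A linear functional that is bounded by the norm of a linear map `T` into a Hilbert space is `T`
followed by an inner product: extend it from the range of `T`, which need not be closed, by
Hahn-Banach, and represent the extension. -/
lemma exists_eq_inner_of_bound {X H : Type*} [AddCommGroup X] [Module ℝ X] [NormedAddCommGroup H]
    [InnerProductSpace ℝ H] [CompleteSpace H] (T : X →ₗ[ℝ] H) (l : X →ₗ[ℝ] ℝ) (C : ℝ)
    (h : ∀ x, |l x| ≤ C * ‖T x‖) : ∃ k : H, ∀ x, l x = inner ℝ k (T x) := by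
  obtain ⟨g, hg⟩ := T.rangeRestrict.exists_rightInverse_of_surjective T.range_rangeRestrict
  have hTg : ∀ y : T.range, T (g y) = y := fun y => congrArg Subtype.val (LinearMap.congr_fun hg y)
  let l' : StrongDual ℝ T.range := (l ∘ₗ g).mkContinuous C fun y => by
    have := h (g y)
    rw [hTg] at this
    exact this
  obtain ⟨L, hL, -⟩ := exists_extension_norm_eq T.range l'
  refine ⟨(InnerProductSpace.toDual ℝ H).symm L, fun x => ?_⟩
  rw [InnerProductSpace.toDual_symm_apply]
  have h1 := hL ⟨T x, LinearMap.mem_range_self T x⟩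
  have h2 : l (g ⟨T x, LinearMap.mem_range_self T x⟩) = l x := by
    have h3 := h (g ⟨T x, LinearMap.mem_range_self T x⟩ - x)
    rw [map_sub, map_sub, hTg, sub_self, norm_zero, mul_zero] at h3
    linarith [abs_nonpos_iff.1 h3]
  exact h2.symm.trans h1.symm

variable {V : Type*} [NormedAddCommGroup V] [NormedSpace ℝ V] [FiniteDimensional ℝ V]
  [MeasureSpace V] [BorelSpace V] [(volume : Measure V).IsAddHaarMeasure]

lemma memLp_mul_testFunction {U : Opens V} {a : V → ℝ} (ha : MemLp a 2 (vol U)) (φ : 𝓓(U, ℝ)) :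
    MemLp (fun x => a x * φ x) 2 (vol U) := by
  have := ha.mul (q := 2) (r := 2) (p := ∞) (φ.memLp_top (μ := vol U))
  exact this.ae_eq (ae_of_all _ fun x => by simp [mul_comm])

/-- If `φ ↦ ∫ u ∂ₘφ` is bounded in the norm of `L²(a² dx)`, then `u` has a weak derivative of the
form `a κ` with `κ ∈ L²`. -/
theorem HasWeakDeriv.exists_of_bound {U : Opens V} {u a : V → ℝ} {m : V} {C : ℝ}
    (hu : LocallyIntegrableOn u (U : Set V)) (ha : MemLp a 2 (vol U))
    (h : ∀ φ : 𝓓(U, ℝ), |∫ x, u x * fderiv ℝ φ x m ∂(vol U)|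
      ≤ C * √(∫ x, (a x * φ x) ^ 2 ∂(vol U))) :
    ∃ κ : V → ℝ, MemLp κ 2 (vol U) ∧ HasWeakDeriv U u (fun x => a x * κ x) m := by
  let T : 𝓓(U, ℝ) →ₗ[ℝ] Lp ℝ 2 (vol U) :=
    { toFun := fun φ => (memLp_mul_testFunction ha φ).toLp
      map_add' := fun φ ψ => by
        rw [← MemLp.toLp_add]
        congr 1
        ext x
        simp [mul_add]
      map_smul' := fun c φ => by
        rw [RingHom.id_apply, ← MemLp.toLp_const_smul]
        congr 1
        ext x
        simp; ring }
  have hdiff : ∀ φ : 𝓓(U, ℝ), ∀ x, DifferentiableAt ℝ φ x := fun φ x =>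
    (φ.contDiff.differentiable (by simp)) x
  let l : 𝓓(U, ℝ) →ₗ[ℝ] ℝ :=
    { toFun := fun φ => ∫ x, u x * fderiv ℝ φ x m ∂(vol U)
      map_add' := fun φ ψ => by
        rw [← integral_add (integrable_mul_fderiv hu φ m) (integrable_mul_fderiv hu ψ m)]
        congr 1 with x
        have : fderiv ℝ (⇑(φ + ψ)) x = fderiv ℝ φ x + fderiv ℝ ψ x := by
          rw [FunLike.coe_add]
          exact fderiv_add (hdiff φ x) (hdiff ψ x)
        rw [this, add_apply, mul_add]
      map_smul' := fun c φ => by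
        rw [RingHom.id_apply, smul_eq_mul, ← integral_const_mul]
        congr 1 with x
        have : fderiv ℝ (⇑(c • φ)) x = c • fderiv ℝ φ x := by
          rw [FunLike.coe_smul]
          exact fderiv_const_smul (hdiff φ x) c
        rw [this, smul_apply, smul_eq_mul]
        ring }
  have hT : ∀ φ, ‖T φ‖ = √(∫ x, (a x * φ x) ^ 2 ∂(vol U)) := by
    intro φ
    rw [eq_comm, Real.sqrt_eq_iff_mul_self_eq (integral_nonneg fun x => sq_nonneg _)
      (norm_nonneg _), ← real_inner_self_eq_norm_mul_norm, L2.inner_def]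
    refine integral_congr_ae ?_
    filter_upwards [(memLp_mul_testFunction ha φ).coeFn_toLp] with x hx
    simp only [T, LinearMap.coe_mk, AddHom.coe_mk, hx]
    rw [real_inner_self_eq_norm_sq, Real.norm_eq_abs, sq_abs]
  obtain ⟨k, hk⟩ := exists_eq_inner_of_bound T l C fun φ => by rw [hT]; exact h φ
  refine ⟨fun x => - k x, (Lp.memLp k).neg, hu, ?_, fun φ => ?_⟩
  · have h1 : Integrable (fun x => a x * - k x) (vol U) := ha.integrable_mul (Lp.memLp k).neg
    exact IntegrableOn.locallyIntegrableOn h1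
  · have h1 : l φ = ∫ x, u x * fderiv ℝ φ x m ∂(vol U) := rfl
    rw [← h1, hk, L2.inner_def, ← integral_neg]
    refine integral_congr_ae ?_
    filter_upwards [(memLp_mul_testFunction ha φ).coeFn_toLp] with x hx
    simp only [T, LinearMap.coe_mk, AddHom.coe_mk, hx]
    simp; ring

/-- The previous criterion, in terms of difference quotients. -/
theorem HasWeakDeriv.exists_of_diff_bound {U : Opens V} {u a : V → ℝ} {m : V} {C : ℝ}
    (hu : Integrable u (vol U)) (ha : MemLp a 2 (vol U))
    (h : ∀ φ : 𝓓(U, ℝ), ∀ᶠ s in 𝓝[>] (0 : ℝ), |∫ x, u x * (φ (x - s • m) - φ x) ∂(vol U)|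
      ≤ s * (C * (√(∫ x, (a x * φ x) ^ 2 ∂(vol U))
        + √(∫ x, (a x * φ (x - s • m)) ^ 2 ∂(vol U))))) :
    ∃ κ : V → ℝ, MemLp κ 2 (vol U) ∧ HasWeakDeriv U u (fun x => a x * κ x) m := by
  refine HasWeakDeriv.exists_of_bound (C := C * 2) (IntegrableOn.locallyIntegrableOn hu) ha
    fun φ => ?_
  have hdiff : ∀ x, DifferentiableAt ℝ φ x := fun x => (φ.contDiff.differentiable (by simp)) x
  obtain ⟨K, hK⟩ : ∃ K, LipschitzWith K φ :=
    (φ.contDiff.of_le (by exact_mod_cast le_top)).lipschitzWith_of_hasCompactSupport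
      φ.hasCompactSupport one_ne_zero
  obtain ⟨B, hB⟩ := φ.continuous.bounded_above_of_compact_support φ.hasCompactSupport
  have t1 : Tendsto (fun s : ℝ => ∫ x, u x * (s⁻¹ * (φ (x - s • m) - φ x)) ∂(vol U)) (𝓝[>] 0)
      (𝓝 (∫ x, u x * (- fderiv ℝ φ x m) ∂(vol U))) := by
    refine tendsto_integral_filter_of_dominated_convergence (fun x => ‖u x‖ * (K * ‖m‖)) ?_ ?_
      (hu.norm.mul_const _) (ae_of_all _ fun x => ?_)
    · exact Eventually.of_forall fun s => hu.aestronglyMeasurable.mul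
        (Continuous.aestronglyMeasurable (by fun_prop))
    · filter_upwards [self_mem_nhdsWithin] with s hs
      refine ae_of_all _ fun x => ?_
      rw [norm_mul]
      gcongr
      have hs' : (0 : ℝ) < s := hs
      have h1 := hK.dist_le_mul (x - s • m) x
      rw [dist_eq_norm, dist_eq_norm, sub_sub_cancel_left, norm_neg, norm_smul, Real.norm_eq_abs s,
        abs_of_pos hs'] at h1
      rw [norm_mul, norm_inv, Real.norm_eq_abs s, abs_of_pos hs']
      calc s⁻¹ * ‖φ (x - s • m) - φ x‖ ≤ s⁻¹ * (K * (s * ‖m‖)) := by gcongr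
        _ = K * ‖m‖ := by field_simp
    · have h1 : HasDerivAt (fun s : ℝ => φ (x - s • m)) (- fderiv ℝ φ x m) 0 := by
        have h3 : HasFDerivAt φ (fderiv ℝ φ x) (x - (0 : ℝ) • m) := by
          simpa using (hdiff x).hasFDerivAt
        have h4 : HasDerivAt (fun s : ℝ => x - s • m) (-m) 0 := by
          simpa using ((hasDerivAt_id (0 : ℝ)).smul_const m).const_sub x
        have h5 := h3.comp_hasDerivAt (0 : ℝ) h4
        rw [map_neg] at h5
        exact h5
      have h2 := h1.tendsto_slope_zero_right
      simp only [zero_add, zero_smul, sub_zero, smul_eq_mul] at h2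
      exact h2.const_mul (u x)
  have ha2 : Integrable (fun x => a x ^ 2) (vol U) := ha.integrable_sq
  have t2 : Tendsto (fun s : ℝ => ∫ x, (a x * φ (x - s • m)) ^ 2 ∂(vol U)) (𝓝[>] 0)
      (𝓝 (∫ x, (a x * φ x) ^ 2 ∂(vol U))) := by
    refine tendsto_integral_filter_of_dominated_convergence (fun x => a x ^ 2 * B ^ 2) ?_ ?_
      (ha2.mul_const _) (ae_of_all _ fun x => ?_)
    · exact Eventually.of_forall fun s => (ha.aestronglyMeasurable.mul
        (Continuous.aestronglyMeasurable (by fun_prop))).pow 2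
    · refine Eventually.of_forall fun s => ae_of_all _ fun x => ?_
      rw [Real.norm_eq_abs, abs_of_nonneg (sq_nonneg _), mul_pow]
      refine mul_le_mul_of_nonneg_left ?_ (sq_nonneg _)
      have h1 : |φ (x - s • m)| ≤ B := hB _
      exact sq_le_sq' (abs_le.1 h1).1 (abs_le.1 h1).2
    · have hc : Continuous fun s : ℝ => (a x * φ (x - s • m)) ^ 2 := by fun_prop
      have := (hc.tendsto 0).mono_left (nhdsWithin_le_nhds (s := Ioi 0))
      simpa using this
  have t3 := ((t2.sqrt).const_add (√(∫ x, (a x * φ x) ^ 2 ∂(vol U)))).const_mul C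
  have h3 := le_of_tendsto_of_tendsto t1.abs t3 (by
    filter_upwards [h φ, self_mem_nhdsWithin] with s hs hs0
    have hs' : (0 : ℝ) < s := hs0
    have e : ∫ x, u x * (s⁻¹ * (φ (x - s • m) - φ x)) ∂(vol U)
        = s⁻¹ * ∫ x, u x * (φ (x - s • m) - φ x) ∂(vol U) := by
      rw [← integral_const_mul]; congr 1 with x; ring
    rw [e, abs_mul, abs_of_pos (inv_pos.2 hs'), inv_mul_le_iff₀ hs']
    exact hs)
  simp only [mul_neg, integral_neg, abs_neg] at h3
  linarith

end Riesz

/-! ### Time slices of functions on the cylinder -/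

section Slices

variable {d : ℕ} {T : ℝ} {Ω : Opens (Sp d)}

lemma vol_cyl (T : ℝ) (Ω : Opens (Sp d)) : vol (cyl T Ω) = (volI T).prod (vol Ω) :=
  (Measure.prod_restrict _ _).symm

instance (T : ℝ) : IsFiniteMeasure (volI T) := ⟨by simp [volI]⟩

lemma isFiniteMeasure_vol (hb : Bornology.IsBounded (Ω : Set (Sp d))) :
    IsFiniteMeasure (vol Ω) :=
  ⟨by simpa [vol] using hb.measure_lt_top⟩

lemma isFiniteMeasure_vol_cyl (hb : Bornology.IsBounded (Ω : Set (Sp d))) (T : ℝ) :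
    IsFiniteMeasure (vol (cyl T Ω)) := by
  have := isFiniteMeasure_vol hb
  rw [vol_cyl]
  infer_instance

/-- The product of a test function in time and a test function in space. -/
lemma exists_testFunction_prod (ρ : 𝓓((⟨Ioo 0 T, isOpen_Ioo⟩ : Opens ℝ), ℝ)) (ψ : 𝓓(Ω, ℝ)) :
    ∃ φ : 𝓓(cyl T Ω, ℝ), (∀ t x, φ (t, x) = ρ t * ψ x) ∧
      ∀ t x (i : Fin d), fderiv ℝ φ (t, x) (dirX i) = ρ t * fderiv ℝ ψ x (stdVec i) := by
  let F : ℝ × Sp d → ℝ := fun z => ρ z.1 * ψ z.2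
  have hF : ContDiff ℝ ((⊤ : ℕ∞) : WithTop ℕ∞) F :=
    (ρ.contDiff.comp contDiff_fst).mul (ψ.contDiff.comp contDiff_snd)
  have hK : IsCompact (tsupport ρ ×ˢ tsupport ψ) := ρ.hasCompactSupport.prod ψ.hasCompactSupport
  have hs : tsupport F ⊆ tsupport ρ ×ˢ tsupport ψ := by
    refine closure_minimal (fun z hz => ?_) hK.isClosed
    exact ⟨subset_tsupport _ (left_ne_zero_of_mul hz), subset_tsupport _ (right_ne_zero_of_mul hz)⟩
  refine ⟨⟨F, hF, hK.of_isClosed_subset (isClosed_tsupport _) hs,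
    hs.trans (prod_mono ρ.tsupport_subset ψ.tsupport_subset)⟩, fun t x => rfl, fun t x i => ?_⟩
  change fderiv ℝ F (t, x) (dirX i) = _
  have h1 : HasFDerivAt (fun z : ℝ × Sp d => ρ z.1) ((fderiv ℝ ρ t).comp (.fst ℝ ℝ (Sp d))) (t, x) :=
    ((ρ.contDiff.differentiable (by simp)) t).hasFDerivAt.comp (t, x) hasFDerivAt_fst
  have h2 : HasFDerivAt (fun z : ℝ × Sp d => ψ z.2) ((fderiv ℝ ψ x).comp (.snd ℝ ℝ (Sp d))) (t, x) :=
    ((ψ.contDiff.differentiable (by simp)) x).hasFDerivAt.comp (t, x) hasFDerivAt_snd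
  rw [show fderiv ℝ F (t, x) = _ from (h1.mul h2).fderiv]
  simp

/-- The test functions on a bounded set are separable in the `C¹` norm. -/
lemma exists_countable_testFunctions (hb : Bornology.IsBounded (Ω : Set (Sp d))) (e : Sp d) :
    ∃ S : Set 𝓓(Ω, ℝ), S.Countable ∧ ∀ φ : 𝓓(Ω, ℝ), ∀ ε > 0, ∃ ψ ∈ S, ∀ x ∈ Ω,
      |φ x - ψ x| ≤ ε ∧ |fderiv ℝ φ x e - fderiv ℝ ψ x e| ≤ ε := by
  have hK : IsCompact (closure (Ω : Set (Sp d))) := hb.isCompact_closure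
  have : CompactSpace (closure (Ω : Set (Sp d))) := isCompact_iff_compactSpace.1 hK
  let K := closure (Ω : Set (Sp d))
  let Φ : 𝓓(Ω, ℝ) → C(K, ℝ) × C(K, ℝ) := fun φ =>
    (⟨fun x => φ x, by fun_prop⟩,
      ⟨fun x => fderiv ℝ φ x e, (continuous_fderiv_apply φ e).comp continuous_subtype_val⟩)
  obtain ⟨D, hDc, hDd⟩ := TopologicalSpace.exists_countable_dense (range Φ)
  choose g hg using fun y : range Φ => y.2
  refine ⟨g '' D, hDc.image g, fun φ ε hε => ?_⟩
  obtain ⟨y, hyD, hy⟩ := hDd.exists_dist_lt ⟨Φ φ, mem_range_self φ⟩ hε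
  refine ⟨g y, mem_image_of_mem g hyD, fun x hx => ?_⟩
  have h1 : dist (Φ φ) (Φ (g y)) < ε := by rw [hg]; exact hy
  rw [Prod.dist_eq, max_lt_iff] at h1
  have hx' : x ∈ K := subset_closure hx
  exact ⟨(ContinuousMap.dist_apply_le_dist (⟨x, hx'⟩ : K)).trans h1.1.le,
    (ContinuousMap.dist_apply_le_dist (⟨x, hx'⟩ : K)).trans h1.2.le⟩

/-- Almost every time slice of a function with a weak spatial derivative is weakly differentiable. The
exceptional set of times does not depend on the test function, as countably many suffice. -/
theorem HasWeakDeriv.slice (hb : Bornology.IsBounded (Ω : Set (Sp d))) {u w : ℝ × Sp d → ℝ}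
    {i : Fin d} (hu : Integrable u (vol (cyl T Ω))) (hw : Integrable w (vol (cyl T Ω)))
    (h : ∀ φ : 𝓓(cyl T Ω, ℝ), ∫ z, u z * fderiv ℝ φ z (dirX i) ∂(vol (cyl T Ω))
      = - ∫ z, w z * φ z ∂(vol (cyl T Ω))) :
    ∀ᵐ t ∂(volI T), HasWeakDeriv Ω (fun x => u (t, x)) (fun x => w (t, x)) (stdVec i) := by
  have := isFiniteMeasure_vol hb
  rw [vol_cyl] at hu hw h
  have hψ : ∀ ψ : 𝓓(Ω, ℝ), ∀ᵐ t ∂(volI T),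
      ∫ x, (u (t, x) * fderiv ℝ ψ x (stdVec i) + w (t, x) * ψ x) ∂(vol Ω) = 0 := by
    intro ψ
    obtain ⟨B, hB⟩ := ψ.continuous.bounded_above_of_compact_support ψ.hasCompactSupport
    have hc := continuous_fderiv_apply ψ (stdVec i)
    obtain ⟨B', hB'⟩ := hc.bounded_above_of_compact_support (ψ.hasCompactSupport.mono'
      fun x hx => by
        by_contra hn
        exact hx (fderiv_eq_zero_of_notMem ψ hn _))
    have i1 : Integrable (fun z : ℝ × Sp d => u z * fderiv ℝ ψ z.2 (stdVec i))
        ((volI T).prod (vol Ω)) :=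
      hu.mul_bdd (Continuous.aestronglyMeasurable (by fun_prop)) (ae_of_all _ fun z => hB' z.2)
    have i2 : Integrable (fun z : ℝ × Sp d => w z * ψ z.2) ((volI T).prod (vol Ω)) :=
      hw.mul_bdd (Continuous.aestronglyMeasurable (by fun_prop)) (ae_of_all _ fun z => hB z.2)
    have i3 := (i1.add i2).integral_prod_left
    refine ae_eq_zero_of_forall_testFunction (U := ⟨Ioo 0 T, isOpen_Ioo⟩)
      (IntegrableOn.locallyIntegrableOn i3) fun ρ => ?_
    obtain ⟨Br, hBr⟩ := ρ.continuous.bounded_above_of_compact_support ρ.hasCompactSupport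
    obtain ⟨φ, hφ, hφd⟩ := exists_testFunction_prod ρ ψ
    have e1 := h φ
    rw [eq_neg_iff_add_eq_zero, ← integral_add] at e1
    · have hint : Integrable (fun z : ℝ × Sp d => (u z * fderiv ℝ ψ z.2 (stdVec i) + w z * ψ z.2)
          * ρ z.1) ((volI T).prod (vol Ω)) :=
        (i1.add i2).mul_bdd (Continuous.aestronglyMeasurable (by fun_prop))
          (ae_of_all _ fun z => hBr z.1)
      have e2 : ∫ z : ℝ × Sp d, (u z * fderiv ℝ ψ z.2 (stdVec i) + w z * ψ z.2)
          * ρ z.1 ∂((volI T).prod (vol Ω)) = 0 := by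
        refine Eq.trans ?_ e1
        congr 1 with z
        rw [show φ z = ρ z.1 * ψ z.2 from hφ z.1 z.2,
          show fderiv ℝ φ z (dirX i) = _ from hφd z.1 z.2 i]
        ring
      rw [integral_prod _ hint] at e2
      refine Eq.trans ?_ e2
      congr 1 with t
      rw [← integral_mul_const]
    · refine (i1.mul_bdd (g := fun z : ℝ × Sp d => ρ z.1) (c := Br)
        (Continuous.aestronglyMeasurable (by fun_prop)) (ae_of_all _ fun z => hBr z.1)).congr (ae_of_all _ fun z => ?_)
      simp only
      rw [show fderiv ℝ φ z (dirX i) = _ from hφd z.1 z.2 i]; ring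
    · refine (i2.mul_bdd (g := fun z : ℝ × Sp d => ρ z.1) (c := Br)
        (Continuous.aestronglyMeasurable (by fun_prop)) (ae_of_all _ fun z => hBr z.1)).congr (ae_of_all _ fun z => ?_)
      simp only
      rw [show φ z = ρ z.1 * ψ z.2 from hφ z.1 z.2]; ring
  obtain ⟨S, hSc, hS⟩ := exists_countable_testFunctions hb (stdVec i)
  have hall : ∀ᵐ t ∂(volI T), ∀ ψ ∈ S,
      ∫ x, (u (t, x) * fderiv ℝ ψ x (stdVec i) + w (t, x) * ψ x) ∂(vol Ω) = 0 :=
    (ae_ball_iff hSc).2 fun ψ _ => hψ ψ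
  filter_upwards [hall, hu.prod_right_ae, hw.prod_right_ae] with t ht hut hwt
  have hul : LocallyIntegrableOn (fun x => u (t, x)) (Ω : Set (Sp d)) :=
    IntegrableOn.locallyIntegrableOn hut
  have hwl : LocallyIntegrableOn (fun x => w (t, x)) (Ω : Set (Sp d)) :=
    IntegrableOn.locallyIntegrableOn hwt
  refine ⟨hul, hwl, fun φ => ?_⟩
  have iφ : ∀ φ : 𝓓(Ω, ℝ), Integrable (fun x => u (t, x) * fderiv ℝ φ x (stdVec i)
      + w (t, x) * φ x) (vol Ω) := fun φ =>
    (integrable_mul_fderiv hul φ (stdVec i)).add (integrable_mul_testFunction hwl φ)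
  rw [eq_neg_iff_add_eq_zero, ← integral_add (integrable_mul_fderiv hul φ _)
    (integrable_mul_testFunction hwl φ)]
  set M := (∫ x, ‖u (t, x)‖ ∂(vol Ω)) + ∫ x, ‖w (t, x)‖ ∂(vol Ω) with hM
  have hM0 : 0 ≤ M := add_nonneg (integral_nonneg fun _ => norm_nonneg _)
    (integral_nonneg fun _ => norm_nonneg _)
  by_contra hne
  set X := ∫ x, (u (t, x) * fderiv ℝ φ x (stdVec i) + w (t, x) * φ x) ∂(vol Ω) with hX
  have hXpos : 0 < |X| := abs_pos.2 hne
  obtain ⟨ψ, hψS, hψ⟩ := hS φ (|X| / (2 * (M + 1))) (by positivity)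
  have e1 : X = ∫ x, ((u (t, x) * fderiv ℝ φ x (stdVec i) + w (t, x) * φ x)
      - (u (t, x) * fderiv ℝ ψ x (stdVec i) + w (t, x) * ψ x)) ∂(vol Ω) := by
    rw [integral_sub (iφ φ) (iφ ψ), ht ψ hψS, sub_zero]
  have e2 : |X| ≤ ∫ x, |X| / (2 * (M + 1)) * (‖u (t, x)‖ + ‖w (t, x)‖) ∂(vol Ω) := by
    refine (le_of_eq (congrArg norm e1 : ‖X‖ = _)).trans ?_
    refine norm_integral_le_of_norm_le ((hut.norm.add hwt.norm).const_mul _) ?_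
    filter_upwards [ae_restrict_mem Ω.isOpen.measurableSet] with x hx
    obtain ⟨h1, h2⟩ := hψ x hx
    calc ‖_‖ = ‖u (t, x) * (fderiv ℝ φ x (stdVec i) - fderiv ℝ ψ x (stdVec i))
          + w (t, x) * (φ x - ψ x)‖ := by congr 1; ring
      _ ≤ ‖u (t, x)‖ * |fderiv ℝ φ x (stdVec i) - fderiv ℝ ψ x (stdVec i)|
          + ‖w (t, x)‖ * |φ x - ψ x| := by
        refine (norm_add_le _ _).trans (le_of_eq ?_)
        rw [norm_mul, norm_mul]; rfl
      _ ≤ ‖u (t, x)‖ * (|X| / (2 * (M + 1))) + ‖w (t, x)‖ * (|X| / (2 * (M + 1))) := by gcongr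
      _ = _ := by ring
  rw [integral_const_mul, integral_add hut.norm hwt.norm, ← hM] at e2
  have e3 : |X| / (2 * (M + 1)) * M < |X| := by
    rw [div_mul_eq_mul_div, div_lt_iff₀ (by positivity)]
    nlinarith
  linarith

end Slices

/-! ### Directions that point into a Lipschitz domain -/

section Geometry

variable {d : ℕ}

lemma sum_smul_stdVec (e : Sp d) : ∑ i, e i • (stdVec i : Sp d) = e := by
  ext j
  simp [Pi.single_apply]

/-- Every open cone around a unit vector contains a basis, of the form `e + κ eᵢ`. -/
lemma exists_basis_near (e : Sp d) {κ₀ : ℝ} (hκ₀ : 0 < κ₀) :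
    ∃ κ ∈ Ioc 0 κ₀, ∃ b : Module.Basis (Fin d) ℝ (Sp d), ∀ i, b i = e + κ • stdVec i := by
  -- the vectors `e + κ eᵢ` are dependent only for `κ = 0` and `κ = - ∑ eⱼ`
  obtain ⟨κ, hκ, hne⟩ : ∃ κ ∈ Ioc 0 κ₀, κ + ∑ j, e j ≠ 0 := by
    by_cases h : κ₀ + ∑ j, e j = 0
    · refine ⟨κ₀ / 2, ⟨by linarith, by linarith⟩, fun h' => ?_⟩
      linarith
    · exact ⟨κ₀, ⟨hκ₀, le_rfl⟩, h⟩
  have hli : LinearIndependent ℝ (fun i : Fin d => e + κ • (stdVec i : Sp d)) := by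
    rw [Fintype.linearIndependent_iff]
    intro c hc
    have h1 : ∀ j, (∑ i, c i) * e j + κ * c j = 0 := by
      intro j
      have := congrArg (fun v : Sp d => v j) hc
      simp only [WithLp.ofLp_sum, Finset.sum_apply, PiLp.smul_apply, PiLp.add_apply,
        smul_eq_mul, mul_add, Finset.sum_add_distrib, PiLp.zero_apply] at this
      rw [← Finset.sum_mul] at this
      have h2 : ∑ i, c i * (κ * (stdVec i : Sp d) j) = κ * c j := by
        simp [mul_comm]
      rw [h2] at this
      exact this
    have h2 : (∑ i, c i) * (κ + ∑ j, e j) = 0 := by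
      have : ∑ j, ((∑ i, c i) * e j + κ * c j) = 0 := Finset.sum_eq_zero fun j _ => h1 j
      rw [Finset.sum_add_distrib, ← Finset.mul_sum, ← Finset.mul_sum] at this
      linarith
    have h3 : ∑ i, c i = 0 := (mul_eq_zero.1 h2).resolve_right hne
    intro j
    have := h1 j
    rw [h3, zero_mul, zero_add] at this
    exact (mul_eq_zero.1 this).resolve_left hκ.1.ne'
  refine ⟨κ, hκ, basisOfLinearIndependentOfCardEqFinrank' _ hli (by simp), fun i => ?_⟩
  simp

/-- Near every point of the closure of a Lipschitz domain there is a basis of directions that point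
into the domain. -/
theorem exists_inward_basis {Ω : Opens (Sp d)} (hΩ : HasLipschitzBoundary (Ω : Set (Sp d)))
    {x : Sp d} (hx : x ∈ closure (Ω : Set (Sp d))) :
    ∃ N : Opens (Sp d), x ∈ N ∧ ∃ s > 0, ∃ b : Module.Basis (Fin d) ℝ (Sp d),
      (∀ i, Slides ((N ⊓ Ω : Opens (Sp d)) : Set (Sp d)) Ω s (b i)) ∧
      ∀ i, ∀ τ ∈ Ioc 0 s, x + τ • b i ∈ Ω := by
  by_cases hxΩ : x ∈ Ω
  · obtain ⟨ρ, hρ, hball⟩ := Metric.isOpen_iff.1 Ω.isOpen x hxΩ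
    have key : ∀ y ∈ Metric.ball x (ρ / 2), ∀ i : Fin d, ∀ τ ∈ Icc 0 (ρ / 4),
        y + τ • (EuclideanSpace.basisFun (Fin d) ℝ).toBasis i ∈ Ω := by
      intro y hy i τ hτ
      apply hball
      rw [Metric.mem_ball, dist_eq_norm] at hy ⊢
      have h1 : ‖τ • (EuclideanSpace.basisFun (Fin d) ℝ).toBasis i‖ ≤ ρ / 4 := by
        simp [norm_smul, abs_of_nonneg hτ.1, hτ.2]
      calc ‖y + τ • (EuclideanSpace.basisFun (Fin d) ℝ).toBasis i - x‖
          = ‖(y - x) + τ • (EuclideanSpace.basisFun (Fin d) ℝ).toBasis i‖ := by congr 1; abel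
        _ ≤ _ := norm_add_le _ _
        _ < ρ := by linarith
    refine ⟨⟨Metric.ball x (ρ / 2), Metric.isOpen_ball⟩, Metric.mem_ball_self (by linarith),
      ρ / 4, by linarith, (EuclideanSpace.basisFun (Fin d) ℝ).toBasis,
      fun i y hy τ hτ => key y hy.1 i τ hτ,
      fun i τ hτ => key x (Metric.mem_ball_self (by linarith)) i τ ⟨hτ.1.le, hτ.2⟩⟩
  · have hxf : x ∈ frontier (Ω : Set (Sp d)) := by
      rw [Ω.isOpen.frontier_eq]; exact ⟨hx, hxΩ⟩
    obtain ⟨r, e, h, L, hr, he, hL, hiff⟩ := hΩ x hxf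
    obtain ⟨κ, hκ, b, hb⟩ := exists_basis_near e (κ₀ := 1 / (2 + 2 * L)) (by positivity)
    have hκ1 : κ * (2 + 2 * L) ≤ 1 := by
      have := hκ.2
      rwa [le_div_iff₀ (by positivity)] at this
    have hκL : 0 ≤ κ * L := mul_nonneg hκ.1.le L.2
    have hκ0 : 0 < κ := hκ.1
    -- the basis vectors lie in the cone of steep directions
    have hinner : ∀ i, inner ℝ e (b i) = 1 + κ * e i := by
      intro i
      rw [hb, inner_add_right, inner_smul_right, real_inner_self_eq_norm_sq, he]
      simp [EuclideanSpace.inner_single_right]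
    have hei : ∀ i, |e i| ≤ 1 := fun i => by
      have := PiLp.norm_apply_le e i
      rwa [he] at this
    have hperp : ∀ i, ‖b i - inner ℝ e (b i) • e‖ ≤ 2 * κ := by
      intro i
      have h1 : b i - inner ℝ e (b i) • e = κ • (stdVec i - e i • e) := by
        rw [hinner, hb]; module
      rw [h1, norm_smul, Real.norm_eq_abs, abs_of_pos hκ0, mul_comm]
      gcongr
      calc ‖(stdVec i : Sp d) - e i • e‖ ≤ ‖(stdVec i : Sp d)‖ + ‖e i • e‖ := norm_sub_le _ _
        _ ≤ 2 := by
          rw [norm_smul, he]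
          have := hei i
          simp
          linarith
    have hsteep : ∀ i, L * ‖b i - inner ℝ e (b i) • e‖ < inner ℝ e (b i) := by
      intro i
      have h1 : L * ‖b i - inner ℝ e (b i) • e‖ ≤ L * (2 * κ) :=
        mul_le_mul_of_nonneg_left (hperp i) L.2
      have h2 := mul_le_mul_of_nonneg_left (abs_le.1 (hei i)).1 hκ0.le
      have h3 := hinner i
      linarith
    have hnorm : ∀ i, ‖b i‖ ≤ 2 := by
      intro i
      rw [hb]
      calc ‖e + κ • (stdVec i : Sp d)‖ ≤ ‖e‖ + ‖κ • (stdVec i : Sp d)‖ := norm_add_le _ _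
        _ ≤ 2 := by
          rw [he, norm_smul, Real.norm_eq_abs, abs_of_pos hκ0]
          simp
          nlinarith
    have key : ∀ y ∈ Metric.ball x (r / 2), h (y - inner ℝ e y • e) ≤ inner ℝ e y →
        ∀ i, ∀ τ ∈ Ioc 0 (r / 8), y + τ • b i ∈ Ω := by
      intro y hy hyh i τ hτ
      have hτ0 : 0 < τ := hτ.1
      refine (hiff _ ?_).2 ?_
      · rw [Metric.mem_ball, dist_eq_norm] at hy ⊢
        have h1 : ‖τ • b i‖ ≤ r / 8 * 2 := by
          rw [norm_smul, Real.norm_eq_abs, abs_of_pos hτ0]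
          exact mul_le_mul hτ.2 (hnorm i) (norm_nonneg _) (by linarith)
        calc ‖y + τ • b i - x‖ = ‖(y - x) + τ • b i‖ := by congr 1; abel
          _ ≤ ‖y - x‖ + ‖τ • b i‖ := norm_add_le _ _
          _ < r := by linarith
      · have h1 := hL.dist_le_mul (y + τ • b i - inner ℝ e (y + τ • b i) • e)
          (y - inner ℝ e y • e)
        have h2 : (y + τ • b i - inner ℝ e (y + τ • b i) • e) - (y - inner ℝ e y • e)
            = τ • (b i - inner ℝ e (b i) • e) := by
          rw [inner_add_right, inner_smul_right]; module
        rw [dist_eq_norm, dist_eq_norm, h2, norm_smul, Real.norm_eq_abs, Real.norm_eq_abs,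
          abs_of_pos hτ0] at h1
        have h3 := mul_lt_mul_of_pos_left (hsteep i) hτ0
        have h4 := (le_abs_self _).trans h1
        have h5 : inner ℝ e (y + τ • b i) = inner ℝ e y + τ * inner ℝ e (b i) := by
          rw [inner_add_right, inner_smul_right]
        linarith
    have hxh : h (x - inner ℝ e x • e) ≤ inner ℝ e x := by
      have hc : IsClosed {y : Sp d | h (y - inner ℝ e y • e) ≤ inner ℝ e y} := by
        have := hL.continuous
        exact isClosed_le (by fun_prop) (by fun_prop)
      have hxc : x ∈ closure (Metric.ball x r ∩ (Ω : Set (Sp d))) :=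
        Metric.isOpen_ball.inter_closure ⟨Metric.mem_ball_self hr, hx⟩
      refine closure_minimal (fun y hy => ?_) hc hxc
      exact ((hiff y hy.1).1 hy.2).le
    refine ⟨⟨Metric.ball x (r / 2), Metric.isOpen_ball⟩, Metric.mem_ball_self (by linarith),
      r / 8, by linarith, b, fun i y hy τ hτ => ?_,
      fun i τ hτ => key x (Metric.mem_ball_self (by linarith)) hxh i τ hτ⟩
    have hyb : y ∈ Metric.ball x (r / 2) := hy.1
    rcases hτ.1.eq_or_lt with rfl | hτ0
    · simpa using hy.2
    · exact key y hyb ((hiff y (Metric.ball_subset_ball (by linarith) hyb)).1 hy.2).le i τ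
        ⟨hτ0, hτ.2⟩

end Geometry

/-! ### The Poincaré inequality -/

section Poincare

variable {d : ℕ} {Ω : Opens (Sp d)}

/-- `Du` is the weak gradient of `u` on `Ω`. -/
def HasWeakGrad (Ω : Opens (Sp d)) (u : Sp d → ℝ) (Du : Fin d → Sp d → ℝ) : Prop :=
  ∀ i, HasWeakDeriv Ω u (Du i) (stdVec i)

/-- The total mass `∑ᵢ ∫ |∂ᵢ u|` of a gradient. -/
noncomputable def gradMass (Ω : Opens (Sp d)) (Du : Fin d → Sp d → ℝ) : ℝ≥0∞ := ∑ i, ∫⁻ x, ‖Du i x‖ₑ ∂(vol Ω)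

lemma HasWeakGrad.hasWeakDeriv {u : Sp d → ℝ} {Du : Fin d → Sp d → ℝ} (h : HasWeakGrad Ω u Du)
    (hu : LocallyIntegrableOn u (Ω : Set (Sp d))) (e : Sp d) :
    HasWeakDeriv Ω u (fun x => ∑ i, e i * Du i x) e := by
  have := HasWeakDeriv.sum_smul (I := Finset.univ) hu (fun i _ => h i) (fun i => e i)
  rwa [sum_smul_stdVec] at this

lemma HasWeakGrad.lintegral_diff_le {u : Sp d → ℝ} {Du : Fin d → Sp d → ℝ}
    (h : HasWeakGrad Ω u Du) (hu : LocallyIntegrableOn u (Ω : Set (Sp d))) {A : Opens (Sp d)}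
    {e : Sp d} (hA : Slides (A : Set (Sp d)) Ω 1 e) :
    ∫⁻ x, ‖u (x + e) - u x‖ₑ ∂(vol A) ≤ ‖e‖ₑ * gradMass Ω Du := by
  have h1 := (h.hasWeakDeriv hu e).lintegral_diff_rpow_le le_rfl zero_le_one hA
  simp only [one_smul, ENNReal.rpow_one, ENNReal.ofReal_one, one_mul] at h1
  refine h1.trans ?_
  calc ∫⁻ x, ‖∑ i, e i * Du i x‖ₑ ∂(vol Ω) ≤ ∫⁻ x, ∑ i, ‖e‖ₑ * ‖Du i x‖ₑ ∂(vol Ω) := by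
        refine lintegral_mono fun x => (enorm_sum_le _ _).trans (Finset.sum_le_sum fun i _ => ?_)
        rw [enorm_mul]
        gcongr
        exact enorm_le_iff_norm_le.2 (PiLp.norm_apply_le e i)
    _ = ∑ i, ‖e‖ₑ * ∫⁻ x, ‖Du i x‖ₑ ∂(vol Ω) := by
        have hm := fun i => (h i).2.1.aestronglyMeasurable.enorm
        rw [lintegral_finsetSum' _ (fun i _ => (hm i).const_mul _)]
        exact Finset.sum_congr rfl fun i _ => lintegral_const_mul'' _ (hm i)
    _ = _ := by rw [gradMass, Finset.mul_sum]

/-- The Poincaré inequality holds on `A`, with the mean value over `B`, for functions on `Ω`. -/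
def PoincareOn (Ω B A : Opens (Sp d)) : Prop :=
  ∃ C : ℝ≥0, ∀ u Du, HasWeakGrad Ω u Du → Integrable u (vol Ω) →
    ∫⁻ x, ‖u x - ⨍ y, u y ∂(vol B)‖ₑ ∂(vol A) ≤ C * gradMass Ω Du

lemma PoincareOn.mono {B A A' : Opens (Sp d)} (h : PoincareOn Ω B A) (hA : A' ≤ A) :
    PoincareOn Ω B A' := by
  obtain ⟨C, hC⟩ := h
  exact ⟨C, fun u Du h1 h2 => (lintegral_mono_set hA).trans (hC u Du h1 h2)⟩

lemma PoincareOn.sup {B A A' : Opens (Sp d)} (h : PoincareOn Ω B A) (h' : PoincareOn Ω B A') :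
    PoincareOn Ω B (A ⊔ A') := by
  obtain ⟨C, hC⟩ := h
  obtain ⟨C', hC'⟩ := h'
  refine ⟨C + C', fun u Du h1 h2 => ?_⟩
  refine (lintegral_union_le _ _ _).trans ?_
  push_cast
  rw [add_mul]
  exact add_le_add (hC u Du h1 h2) (hC' u Du h1 h2)

/-- The Poincaré inequality carries over to a set that can be slid into a good set. -/
lemma PoincareOn.of_slides {B A A' : Opens (Sp d)} (h : PoincareOn Ω B A) {e : Sp d}
    (hA' : Slides (A' : Set (Sp d)) Ω 1 e) (hAA' : ∀ x ∈ A', x + e ∈ A) :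
    PoincareOn Ω B A' := by
  obtain ⟨C, hC⟩ := h
  refine ⟨‖e‖₊ + C, fun u Du h1 h2 => ?_⟩
  have hul : LocallyIntegrableOn u (Ω : Set (Sp d)) := IntegrableOn.locallyIntegrableOn h2
  set c := ⨍ y, u y ∂(vol B)
  have hm1 : AEMeasurable (fun x => u (x + e)) (vol A') := by
    have := (locallyIntegrableOn_translate zero_le_one hA' hul).aestronglyMeasurable.aemeasurable
    simpa using this
  have hm2 : AEMeasurable u (vol A') :=
    (hul.mono_set (hA'.subset zero_le_one)).aestronglyMeasurable.aemeasurable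
  calc ∫⁻ x, ‖u x - c‖ₑ ∂(vol A')
      ≤ ∫⁻ x, (‖u (x + e) - u x‖ₑ + ‖u (x + e) - c‖ₑ) ∂(vol A') := by
        refine lintegral_mono fun x => ?_
        have e1 : u x - c = (u (x + e) - c) - (u (x + e) - u x) := by ring
        rw [e1, add_comm ‖u (x + e) - u x‖ₑ]
        exact enorm_sub_le
    _ = ∫⁻ x, ‖u (x + e) - u x‖ₑ ∂(vol A') + ∫⁻ x, ‖u (x + e) - c‖ₑ ∂(vol A') :=
        lintegral_add_left' (hm1.sub hm2).enorm _
    _ ≤ ‖e‖ₑ * gradMass Ω Du + C * gradMass Ω Du := by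
        gcongr
        · exact h1.lintegral_diff_le hul hA'
        · refine le_trans ?_ (hC u Du h1 h2)
          calc ∫⁻ x, ‖u (x + e) - c‖ₑ ∂(vol A')
              = ∫⁻ x in (A' : Set (Sp d)),
                  (A : Set (Sp d)).indicator (fun y => ‖u y - c‖ₑ) (x + e) := by
                refine setLIntegral_congr_fun A'.isOpen.measurableSet fun x hx => ?_
                exact (indicator_of_mem (hAA' x hx) (fun y => ‖u y - c‖ₑ)).symm
            _ ≤ ∫⁻ x, (A : Set (Sp d)).indicator (fun y => ‖u y - c‖ₑ) (x + e) :=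
                setLIntegral_le_lintegral _ _
            _ = ∫⁻ x, (A : Set (Sp d)).indicator (fun y => ‖u y - c‖ₑ) x :=
                lintegral_add_right_eq_self _ _
            _ = _ := lintegral_indicator A.isOpen.measurableSet _
    _ = _ := by rw [← add_mul, ENNReal.coe_add]; rfl

/-- The open ball, as a bundled open set. -/
def oball (x : Sp d) (ρ : ℝ) : Opens (Sp d) := ⟨Metric.ball x ρ, Metric.isOpen_ball⟩

/-- The Poincaré inequality on a ball: average over all translations that map points of the ball
into the ball. -/
lemma poincareOn_ball {x₀ : Sp d} {ρ : ℝ} (hρ : 0 < ρ) (hB : oball x₀ ρ ≤ Ω) :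
    PoincareOn Ω (oball x₀ ρ) (oball x₀ ρ) := by
  set B := oball x₀ ρ with hBdef
  have hv0 : volume (B : Set (Sp d)) ≠ 0 := (Metric.measure_ball_pos volume x₀ hρ).ne'
  have hvt : volume (B : Set (Sp d)) ≠ ∞ := Metric.isBounded_ball.measure_lt_top.ne
  have hB2t : volume (Metric.ball (0 : Sp d) (2 * ρ)) ≠ ∞ := Metric.isBounded_ball.measure_lt_top.ne
  set K : ℝ≥0∞ := (volume (B : Set (Sp d)))⁻¹ *
    (ENNReal.ofReal (2 * ρ) * volume (Metric.ball (0 : Sp d) (2 * ρ))) with hK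
  have hKt : K ≠ ∞ := ENNReal.mul_ne_top (ENNReal.inv_ne_top.2 hv0)
    (ENNReal.mul_ne_top ENNReal.ofReal_ne_top hB2t)
  refine ⟨K.toNNReal, fun u Du h1 h2 => ?_⟩
  rw [ENNReal.coe_toNNReal hKt]
  -- a measurable representative
  obtain ⟨u', hu'm, huu'⟩ : ∃ u', Measurable u' ∧ u =ᵐ[vol Ω] u' :=
    ⟨_, h2.aestronglyMeasurable.aemeasurable.measurable_mk,
      h2.aestronglyMeasurable.aemeasurable.ae_eq_mk⟩
  have huB : u =ᵐ[vol B] u' := ae_mono (Measure.restrict_mono hB le_rfl) huu'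
  have h1' : HasWeakGrad Ω u' Du := fun i => (h1 i).congr huu' (ae_eq_refl _)
  have h2' : Integrable u' (vol Ω) := h2.congr huu'
  rw [average_congr huB, lintegral_congr_ae (g := fun x => ‖u' x - ⨍ y, u' y ∂(vol B)‖ₑ)
    (by filter_upwards [huB] with x hx; rw [hx])]
  have hul : LocallyIntegrableOn u' (Ω : Set (Sp d)) := IntegrableOn.locallyIntegrableOn h2'
  have huBi : Integrable u' (vol B) := h2'.mono_measure (Measure.restrict_mono hB le_rfl)
  have hfin : IsFiniteMeasure (vol B) := ⟨by simpa [vol] using hvt.lt_top⟩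
  have hne : NeZero (vol B) := ⟨by simpa [vol] using hv0⟩
  have s1 : ∀ x, ‖u' x - ⨍ y, u' y ∂(vol B)‖ₑ
      ≤ (volume (B : Set (Sp d)))⁻¹ * ∫⁻ y, ‖u' x - u' y‖ₑ ∂(vol B) := by
    intro x
    have e1 : u' x - ⨍ y, u' y ∂(vol B) = ⨍ y, (u' x - u' y) ∂(vol B) := by
      rw [average, average, integral_sub, ← average, ← average, average_const]
      · exact integrable_const _
      · exact huBi.smul_measure (ENNReal.inv_ne_top.2 (by simpa [vol] using hv0))
    rw [e1, average]
    refine (enorm_integral_le_lintegral_enorm _).trans (le_of_eq ?_)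
    rw [lintegral_smul_measure]
    simp [vol]
  have hmeas2 : Measurable fun z : Sp d × Sp d => (B : Set (Sp d)).indicator (fun _ => (1 : ℝ≥0∞)) z.2
      * (B : Set (Sp d)).indicator (fun _ => (1 : ℝ≥0∞)) (z.2 + z.1)
      * ‖u' z.2 - u' (z.2 + z.1)‖ₑ := by
    have hi : Measurable ((B : Set (Sp d)).indicator (fun _ => (1 : ℝ≥0∞))) :=
      measurable_const.indicator B.isOpen.measurableSet
    fun_prop
  have s2 : ∫⁻ x, ∫⁻ y, ‖u' x - u' y‖ₑ ∂(vol B) ∂(vol B)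
      = ∫⁻ z, ∫⁻ x, (B : Set (Sp d)).indicator (fun _ => (1 : ℝ≥0∞)) x
        * (B : Set (Sp d)).indicator (fun _ => (1 : ℝ≥0∞)) (x + z) * ‖u' x - u' (x + z)‖ₑ := by
    rw [← lintegral_indicator B.isOpen.measurableSet, lintegral_lintegral_swap hmeas2.aemeasurable]
    refine lintegral_congr fun x => ?_
    by_cases hx : x ∈ (B : Set (Sp d))
    · rw [indicator_of_mem hx, ← lintegral_indicator B.isOpen.measurableSet,
        ← lintegral_add_left_eq_self _ x]
      refine lintegral_congr fun z => ?_
      rw [indicator_of_mem hx, one_mul]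
      by_cases hz : x + z ∈ (B : Set (Sp d)) <;> simp [hz]
    · rw [indicator_of_notMem hx]
      simp [hx]
  have s3 : ∀ z, ∫⁻ x, (B : Set (Sp d)).indicator (fun _ => (1 : ℝ≥0∞)) x
        * (B : Set (Sp d)).indicator (fun _ => (1 : ℝ≥0∞)) (x + z) * ‖u' x - u' (x + z)‖ₑ
      ≤ (Metric.ball (0 : Sp d) (2 * ρ)).indicator
        (fun _ => ENNReal.ofReal (2 * ρ) * gradMass Ω Du) z := by
    intro z
    by_cases hz : z ∈ Metric.ball (0 : Sp d) (2 * ρ)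
    · rw [indicator_of_mem hz]
      let A : Opens (Sp d) := B ⊓ ⟨(fun x => x + z) ⁻¹' B, B.isOpen.preimage (by fun_prop)⟩
      have hA : Slides (A : Set (Sp d)) Ω 1 z := by
        intro x hx τ hτ
        have h3 : x + τ • z = (1 - τ) • x + τ • (x + z) := by module
        rw [h3]
        exact hB ((convex_ball x₀ ρ) hx.1 hx.2 (by linarith [hτ.2]) hτ.1 (by ring))
      calc ∫⁻ x, (B : Set (Sp d)).indicator (fun _ => (1 : ℝ≥0∞)) x
            * (B : Set (Sp d)).indicator (fun _ => (1 : ℝ≥0∞)) (x + z) * ‖u' x - u' (x + z)‖ₑ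
          = ∫⁻ x, (A : Set (Sp d)).indicator (fun x => ‖u' (x + z) - u' x‖ₑ) x := by
            refine lintegral_congr fun x => ?_
            by_cases hx : x ∈ (B : Set (Sp d)) <;> by_cases hxz : x + z ∈ (B : Set (Sp d))
            · have : x ∈ (A : Set (Sp d)) := ⟨hx, hxz⟩
              rw [indicator_of_mem this, indicator_of_mem hx, indicator_of_mem hxz, one_mul,
                one_mul, enorm_sub_rev]
            · have : x ∉ (A : Set (Sp d)) := fun h => hxz h.2
              rw [indicator_of_notMem this, indicator_of_notMem hxz]; simp
            · have : x ∉ (A : Set (Sp d)) := fun h => hx h.1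
              rw [indicator_of_notMem this, indicator_of_notMem hx]; simp
            · have : x ∉ (A : Set (Sp d)) := fun h => hx h.1
              rw [indicator_of_notMem this, indicator_of_notMem hx]; simp
        _ = ∫⁻ x, ‖u' (x + z) - u' x‖ₑ ∂(vol A) := lintegral_indicator A.isOpen.measurableSet _
        _ ≤ ‖z‖ₑ * gradMass Ω Du := h1'.lintegral_diff_le hul hA
        _ ≤ _ := by
            gcongr
            rw [← ofReal_norm]
            exact ENNReal.ofReal_le_ofReal (by simpa using (mem_ball_zero_iff.1 hz).le)
    · rw [indicator_of_notMem hz, nonpos_iff_eq_zero]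
      refine (lintegral_congr fun x => ?_).trans lintegral_zero
      by_cases hx : x ∈ (B : Set (Sp d)) <;> by_cases hxz : x + z ∈ (B : Set (Sp d))
      · exfalso
        apply hz
        rw [mem_ball_zero_iff]
        have h3 : dist x x₀ < ρ := hx
        have h4 : dist (x + z) x₀ < ρ := hxz
        rw [dist_eq_norm] at h3 h4
        calc ‖z‖ = ‖(x + z - x₀) - (x - x₀)‖ := by congr 1; abel
          _ ≤ ‖x + z - x₀‖ + ‖x - x₀‖ := norm_sub_le _ _
          _ < 2 * ρ := by linarith
      · simp [hxz]
      · simp [hx]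
      · simp [hx]
  calc ∫⁻ x, ‖u' x - ⨍ y, u' y ∂(vol B)‖ₑ ∂(vol B)
      ≤ ∫⁻ x, (volume (B : Set (Sp d)))⁻¹ * (∫⁻ y, ‖u' x - u' y‖ₑ ∂(vol B)) ∂(vol B) :=
        lintegral_mono s1
    _ = (volume (B : Set (Sp d)))⁻¹ * ∫⁻ x, (∫⁻ y, ‖u' x - u' y‖ₑ ∂(vol B)) ∂(vol B) :=
        lintegral_const_mul' _ _ (ENNReal.inv_ne_top.2 hv0)
    _ ≤ (volume (B : Set (Sp d)))⁻¹ * ∫⁻ z, (Metric.ball (0 : Sp d) (2 * ρ)).indicator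
        (fun _ => ENNReal.ofReal (2 * ρ) * gradMass Ω Du) z := by
        rw [s2]
        gcongr with z
        exact s3 z
    _ = K * gradMass Ω Du := by
        rw [lintegral_indicator Metric.isOpen_ball.measurableSet, setLIntegral_const, hK]
        ring

/-- Poincaré's inequality on a bounded connected Lipschitz domain. -/
theorem exists_poincare (hd : 0 < d) (hc : IsConnected (Ω : Set (Sp d)))
    (hb : Bornology.IsBounded (Ω : Set (Sp d))) (hL : HasLipschitzBoundary (Ω : Set (Sp d))) :
    ∃ C : ℝ≥0, ∀ u Du, HasWeakGrad Ω u Du → Integrable u (vol Ω) → ∫ x, u x ∂(vol Ω) = 0 →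
      ∫⁻ x, ‖u x‖ₑ ∂(vol Ω) ≤ C * gradMass Ω Du := by
  obtain ⟨x₀, hx₀⟩ := hc.nonempty
  obtain ⟨ρ₀, hρ₀, hball⟩ := Metric.isOpen_iff.1 Ω.isOpen x₀ hx₀
  set B := oball x₀ ρ₀
  have hB : PoincareOn Ω B B := poincareOn_ball hρ₀ hball
  -- the points around which the inequality holds form an open and relatively closed set
  let G : Set (Sp d) := {x | ∃ ρ > 0, PoincareOn Ω B (oball x ρ)}
  have hGo : IsOpen G := by
    rw [Metric.isOpen_iff]
    rintro x ⟨ρ, hρ, hx⟩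
    refine ⟨ρ, hρ, fun y hy => ⟨ρ - dist y x, sub_pos.2 hy, hx.mono ?_⟩⟩
    exact Metric.ball_subset_ball' (by linarith)
  have hGΩ : (Ω : Set (Sp d)) ⊆ G := by
    refine hc.isPreconnected.subset_of_closure_inter_subset hGo ⟨x₀, hx₀, ρ₀, hρ₀, hB⟩ ?_
    rintro x ⟨hxG, hxΩ⟩
    obtain ⟨r, hr, hxr⟩ := Metric.isOpen_iff.1 Ω.isOpen x hxΩ
    obtain ⟨y, hyG, hyr⟩ := Metric.mem_closure_iff.1 hxG (r / 2) (by linarith)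
    obtain ⟨ρ, hρ, hy⟩ := hyG
    refine ⟨min ρ (r / 2), by positivity, hy.of_slides (e := y - x) ?_ ?_⟩
    · intro z hz τ hτ
      apply hxr
      have h1 : dist z x < min ρ (r / 2) := hz
      have h2 := h1.trans_le (min_le_right _ _)
      rw [dist_comm] at hyr
      rw [Metric.mem_ball]
      rw [dist_eq_norm] at h2 hyr ⊢
      calc ‖z + τ • (y - x) - x‖ = ‖(z - x) + τ • (y - x)‖ := by congr 1; abel
        _ ≤ ‖z - x‖ + ‖τ • (y - x)‖ := norm_add_le _ _
        _ ≤ ‖z - x‖ + 1 * ‖y - x‖ := by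
            rw [norm_smul, Real.norm_eq_abs, abs_of_nonneg hτ.1]
            gcongr
            exact hτ.2
        _ < r := by linarith
    · intro z hz
      have h1 : dist z x < min ρ (r / 2) := hz
      have h2 := h1.trans_le (min_le_left _ _)
      change dist (z + (y - x)) y < ρ
      rw [dist_eq_norm] at h2 ⊢
      have : z + (y - x) - y = z - x := by abel
      rwa [this]
  -- near the boundary, slide into the domain; then cover the closure by finitely many sets
  have hloc : ∀ x ∈ closure (Ω : Set (Sp d)), ∃ N : Opens (Sp d), x ∈ N ∧
      PoincareOn Ω B (N ⊓ Ω) := by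
    intro x hx
    obtain ⟨N, hxN, s, hs, b, hN, hxb⟩ := exists_inward_basis hL hx
    let i : Fin d := ⟨0, hd⟩
    obtain ⟨ρ, hρ, hy⟩ := hGΩ (hxb i s ⟨hs, le_rfl⟩)
    refine ⟨N ⊓ oball x ρ, ⟨hxN, Metric.mem_ball_self hρ⟩, hy.of_slides (e := s • b i) ?_ ?_⟩
    · intro z hz τ hτ
      rw [smul_smul]
      exact hN i z ⟨hz.1.1, hz.2⟩ (τ * s) ⟨mul_nonneg hτ.1 hs.le, by nlinarith [hτ.2]⟩
    · intro z hz
      have h1 : dist z x < ρ := hz.1.2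
      change dist (z + s • b i) (x + s • b i) < ρ
      rwa [dist_add_right]
  obtain ⟨O, hO, C, hC⟩ : ∃ O : Opens (Sp d), closure (Ω : Set (Sp d)) ⊆ O ∧
      PoincareOn Ω B (O ⊓ Ω) := by
    refine hb.isCompact_closure.induction_on (p := fun S => ∃ O : Opens (Sp d), S ⊆ O ∧
      PoincareOn Ω B (O ⊓ Ω)) ⟨⊥, by simp, 0, by simp [vol]⟩ ?_ ?_ ?_
    · rintro S S' hS ⟨O, hO, h⟩
      exact ⟨O, hS.trans hO, h⟩
    · rintro S S' ⟨O, hO, h⟩ ⟨O', hO', h'⟩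
      refine ⟨O ⊔ O', union_subset_union hO hO', ?_⟩
      rw [inf_sup_right]
      exact h.sup h'
    · intro x hx
      obtain ⟨N, hxN, hN⟩ := hloc x hx
      exact ⟨N, mem_nhdsWithin_of_mem_nhds (N.isOpen.mem_nhds hxN), N, subset_rfl, hN⟩
  have hOΩ : O ⊓ Ω = Ω := inf_eq_right.2 (subset_closure.trans hO)
  rw [hOΩ] at hC
  have hfin := isFiniteMeasure_vol hb
  refine ⟨C + C, fun u Du h1 h2 h3 => ?_⟩
  set c := ⨍ y, u y ∂(vol B)
  -- the mean value over the ball is small because the mean value over `Ω` vanishes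
  have hmean : ‖c‖ₑ * volume (Ω : Set (Sp d)) ≤ C * gradMass Ω Du := by
    have e1 : ∫ x, (u x - c) ∂(vol Ω) = - (c * (volume (Ω : Set (Sp d))).toReal) := by
      rw [integral_sub h2 (integrable_const _), h3, integral_const]
      simp [vol, Measure.real, mul_comm]
    calc ‖c‖ₑ * volume (Ω : Set (Sp d)) = ‖∫ x, (u x - c) ∂(vol Ω)‖ₑ := by
          rw [e1, enorm_neg, enorm_mul, Real.enorm_of_nonneg ENNReal.toReal_nonneg,
            ENNReal.ofReal_toReal hb.measure_lt_top.ne]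
      _ ≤ ∫⁻ x, ‖u x - c‖ₑ ∂(vol Ω) := enorm_integral_le_lintegral_enorm _
      _ ≤ _ := hC u Du h1 h2
  calc ∫⁻ x, ‖u x‖ₑ ∂(vol Ω) ≤ ∫⁻ x, (‖u x - c‖ₑ + ‖c‖ₑ) ∂(vol Ω) := by
        refine lintegral_mono fun x => ?_
        calc ‖u x‖ₑ = ‖(u x - c) + c‖ₑ := by rw [sub_add_cancel]
          _ ≤ _ := enorm_add_le _ _
    _ = ∫⁻ x, ‖u x - c‖ₑ ∂(vol Ω) + ‖c‖ₑ * volume (Ω : Set (Sp d)) := by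
        rw [lintegral_add_right _ measurable_const, lintegral_const]
        simp [vol]
    _ ≤ C * gradMass Ω Du + C * gradMass Ω Du := add_le_add (hC u Du h1 h2) hmean
    _ = _ := by push_cast; ring

end Poincare

/-! ### Increments of distributions `u₀ + ∂ₘ u₁` -/

section Steklov

variable {V : Type*} [NormedAddCommGroup V] [NormedSpace ℝ V] [FiniteDimensional ℝ V]

lemma lineDeriv_testFunction_apply {U : Opens V} (φ : 𝓓(U, ℝ)) (m x : V) :
    (∂_{m} φ : 𝓓(U, ℝ)) x = fderiv ℝ φ x m := by
  change (TestFunction.lineDerivCLM ℝ m φ : 𝓓(U, ℝ)) x = _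
  rw [TestFunction.lineDerivCLM_eq_fderivCLM]
  simp [TestFunction.fderivCLM_apply]

variable [MeasureSpace V] [BorelSpace V] [(volume : Measure V).IsAddHaarMeasure]

/-- The increment over a segment of a function that is of the form `u₀ + ∂ₘ u₁` in the sense of
distributions, integrated along the segment. -/
noncomputable def increment (u₀ u₁ : V → ℝ) (s : ℝ) (m : V) (x : V) : ℝ :=
  (∫ τ in (0 : ℝ)..s, u₀ (x + τ • m)) + (u₁ (x + s • m) - u₁ x)

lemma locallyIntegrableOn_increment {U A : Opens V} {s : ℝ} (hs : 0 ≤ s) {m : V}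
    (hA : Slides (A : Set V) U s m) {u₀ u₁ : V → ℝ} (h₀ : LocallyIntegrableOn u₀ (U : Set V))
    (h₁ : LocallyIntegrableOn u₁ (U : Set V)) :
    LocallyIntegrableOn (increment u₀ u₁ s m) (A : Set V) :=
  (locallyIntegrableOn_average hs hA h₀).add
    ((locallyIntegrableOn_translate hs hA h₁).sub (h₁.mono_set (hA.subset hs)))

/-- The distribution `u₀ + ∂ₘ u₁`, applied to an averaged test function. -/
lemma integral_increment_mul {U A : Opens V} {s : ℝ} (hs : 0 ≤ s) {m : V}
    (hA : Slides (A : Set V) U s m) {u₀ u₁ : V → ℝ} (h₀ : LocallyIntegrableOn u₀ (U : Set V))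
    (h₁ : LocallyIntegrableOn u₁ (U : Set V)) (φ : 𝓓(A, ℝ)) {ψ : 𝓓(U, ℝ)}
    (hψ : ∀ x, ψ x = ∫ τ in (0 : ℝ)..s, φ (x - τ • m))
    (hψd : ∀ x, fderiv ℝ ψ x m = φ x - φ (x - s • m)) :
    ∫ x, u₀ x * ψ x ∂(vol U) - ∫ x, u₁ x * fderiv ℝ ψ x m ∂(vol U)
      = ∫ x, increment u₀ u₁ s m x * φ x ∂(vol A) := by
  have a₀ := locallyIntegrableOn_average hs hA h₀
  have a₁ := locallyIntegrableOn_translate hs hA h₁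
  have a₂ := h₁.mono_set (hA.subset hs)
  have hS := isCompact_sweep φ.hasCompactSupport s m
  have huS : IntegrableOn u₁ (sweep (tsupport φ) s m) :=
    h₁.integrableOn_compact_subset (hA.sweep_subset φ.tsupport_subset) hS
  have hz : ∀ x, x ∉ tsupport φ → φ x = 0 := fun x hx => image_eq_zero_of_notMem_tsupport hx
  have e1 : ∫ x, u₁ x * fderiv ℝ ψ x m ∂(vol U)
      = ∫ x, u₁ x * φ x ∂(vol A) - ∫ x, u₁ (x + s • m) * φ x ∂(vol A) := by
    simp only [hψd, mul_sub]
    rw [integral_sub, integral_mul_translate hs hA, integral_vol_eq, ← integral_vol_eq (U := A)]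
    · intro x hx
      rw [hz x (fun h => hx (φ.tsupport_subset h)), mul_zero]
    · intro x hx
      rw [hz x (fun h => hx (hA.subset hs (φ.tsupport_subset h))), mul_zero]
    · refine (integrable_mul_of_compact hS huS φ.continuous fun x hx => ?_).restrict
      refine hz x fun h => hx ?_
      simpa using mem_sweep (m := m) h (τ := 0) ⟨le_rfl, hs⟩
    · refine (integrable_mul_of_compact (φ := fun x => φ (x - s • m)) hS huS
        (by fun_prop) fun x hx => ?_).restrict
      refine hz _ fun h => hx ?_
      simpa using mem_sweep (m := m) h (τ := s) ⟨hs, le_rfl⟩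
  rw [integral_mul_average hs hA h₀ φ hψ, e1]
  simp only [increment, add_mul, sub_mul]
  have e2 : Integrable (fun x => u₁ (x + s • m) * φ x - u₁ x * φ x) (vol A) :=
    (integrable_mul_testFunction a₁ φ).sub (integrable_mul_testFunction a₂ φ)
  rw [integral_add (integrable_mul_testFunction a₀ φ) e2,
    integral_sub (integrable_mul_testFunction a₁ φ) (integrable_mul_testFunction a₂ φ)]
  ring

lemma integrable_average_vol {U A : Opens V} {w : V → ℝ} (hw : Integrable w (vol U)) {s : ℝ}
    (hs : 0 ≤ s) {m : V} (hA : Slides (A : Set V) U s m) :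
    Integrable (fun x => ∫ τ in (0 : ℝ)..s, w (x + τ • m)) (vol A) := by
  have h1 := integrable_average ((integrable_indicator_iff U.isOpen.measurableSet).2 hw) hs m
  refine h1.integrableOn.congr_fun (fun x hx => ?_) A.isOpen.measurableSet
  refine intervalIntegral.integral_congr fun τ hτ => ?_
  rw [uIcc_of_le hs] at hτ
  exact indicator_of_mem (hA x hx τ hτ) _

lemma integrable_translate_vol {U A : Opens V} {w : V → ℝ} (hw : Integrable w (vol U)) {s : ℝ}
    (hs : 0 ≤ s) {m : V} (hA : Slides (A : Set V) U s m) :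
    Integrable (fun x => w (x + s • m)) (vol A) := by
  have h1 := ((integrable_indicator_iff U.isOpen.measurableSet).2 hw).comp_add_right (s • m)
  refine h1.integrableOn.congr_fun (fun x hx => ?_) A.isOpen.measurableSet
  exact indicator_of_mem (hA x hx s ⟨hs, le_rfl⟩) _

lemma integrable_increment {U A : Opens V} {u₀ u₁ : V → ℝ} (h₀ : Integrable u₀ (vol U))
    (h₁ : Integrable u₁ (vol U)) {s : ℝ} (hs : 0 ≤ s) {m : V} (hA : Slides (A : Set V) U s m) :
    Integrable (increment u₀ u₁ s m) (vol A) :=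
  (integrable_average_vol h₀ hs hA).add ((integrable_translate_vol h₁ hs hA).sub
    (h₁.mono_measure (Measure.restrict_mono (hA.subset hs) le_rfl)))

/-- If `∂ₑ (u₀ + ∂ₘ u₁) = h` in the sense of distributions, then the increment along `m` has the
weak derivative that one expects. -/
lemma hasWeakDeriv_increment {U A : Opens V} {s : ℝ} (hs : 0 ≤ s) {m e : V}
    (hA : Slides (A : Set V) U s m) {u₀ u₁ h : V → ℝ} (h₀ : LocallyIntegrableOn u₀ (U : Set V))
    (h₁ : LocallyIntegrableOn u₁ (U : Set V)) (hh : LocallyIntegrableOn h (U : Set V))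
    (hgrad : ∀ η : 𝓓(U, ℝ), ∫ x, u₀ x * fderiv ℝ η x e ∂(vol U)
      - ∫ x, u₁ x * fderiv ℝ (∂_{e} η : 𝓓(U, ℝ)) x m ∂(vol U) = - ∫ x, h x * η x ∂(vol U)) :
    HasWeakDeriv A (increment u₀ u₁ s m) (fun x => ∫ τ in (0 : ℝ)..s, h (x + τ • m)) e := by
  refine ⟨locallyIntegrableOn_increment hs hA h₀ h₁, locallyIntegrableOn_average hs hA hh,
    fun φ => ?_⟩
  obtain ⟨ψ, hψ, hψe, hψm, -⟩ := exists_testFunction_average hs hA φ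
  obtain ⟨ψ', hψ', -, hψ'm, -⟩ := exists_testFunction_average hs hA (∂_{e} φ : 𝓓(A, ℝ))
  have e1 : (∂_{e} ψ : 𝓓(U, ℝ)) = ψ' := by
    ext x
    rw [lineDeriv_testFunction_apply, hψe, hψ']
    simp only [lineDeriv_testFunction_apply]
  have e2 := hgrad ψ
  rw [e1, integral_mul_average hs hA hh φ hψ] at e2
  rw [← e2]
  have e3 := integral_increment_mul hs hA h₀ h₁ (∂_{e} φ : 𝓓(A, ℝ)) hψ' hψ'm
  simp only [lineDeriv_testFunction_apply] at e3
  rw [← e3]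
  congr 1
  refine integral_congr_ae (ae_of_all _ fun x => ?_)
  simp only
  rw [← e1, lineDeriv_testFunction_apply]

end Steklov

/-! ### Time averages of functions -/

section TimeAverage

variable {d : ℕ} {T : ℝ} {Ω : Opens (Sp d)}

instance : (volume : Measure (ℝ × Sp d)).IsAddHaarMeasure :=
  inferInstanceAs ((volume : Measure ℝ).prod (volume : Measure (Sp d))).IsAddHaarMeasure

lemma slides_cyl {k : ℝ} : Slides (cyl (T - k) Ω : Set (ℝ × Sp d)) (cyl T Ω) k (dirT d) := by
  rintro ⟨t, x⟩ ⟨ht, hx⟩ τ hτ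
  simp only [mem_Ioo] at ht
  refine ⟨?_, ?_⟩
  · simp only [Prod.fst_add, Prod.smul_fst, smul_eq_mul, mul_one, mem_Ioo]
    constructor <;> linarith [hτ.1, hτ.2, ht.1, ht.2]
  · simpa using hx

/-- The forward time average over a step of length `k`, set to zero where it is not defined. -/
noncomputable def timeAvg (T k : ℝ) (w : ℝ × Sp d → ℝ) (z : ℝ × Sp d) : ℝ :=
  (Iio (T - k)).indicator (fun _ => k⁻¹ * ∫ τ in (0 : ℝ)..k, w (z + τ • dirT d)) z.1

lemma cyl_mono {k : ℝ} (hk : 0 ≤ k) : cyl (T - k) Ω ≤ cyl T Ω := by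
  rintro ⟨t, x⟩ ⟨ht, hx⟩
  exact ⟨⟨ht.1, ht.2.trans_le (by simp [hk])⟩, hx⟩

lemma mem_cyl_sub_iff {k : ℝ} {z : ℝ × Sp d} (hz : z ∈ cyl T Ω) :
    z ∈ cyl (T - k) Ω ↔ z.1 ∈ Iio (T - k) := by
  refine ⟨fun h => h.1.2, fun h => ⟨⟨hz.1.1, h⟩, hz.2⟩⟩

/-- Extension by zero from the shorter cylinder. -/
lemma lintegral_indicator_cyl {k : ℝ} (hk : 0 ≤ k) (g : ℝ × Sp d → ℝ≥0∞) :
    ∫⁻ z, (Iio (T - k)).indicator (fun _ => g z) z.1 ∂(vol (cyl T Ω))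
      = ∫⁻ z, g z ∂(vol (cyl (T - k) Ω)) := by
  have hsub : (cyl (T - k) Ω : Set (ℝ × Sp d)) ⊆ cyl T Ω := cyl_mono hk
  rw [← lintegral_indicator (cyl T Ω).isOpen.measurableSet,
    ← lintegral_indicator (cyl (T - k) Ω).isOpen.measurableSet]
  refine lintegral_congr fun z => ?_
  by_cases hz : z ∈ (cyl T Ω : Set (ℝ × Sp d))
  · by_cases hz' : z ∈ (cyl (T - k) Ω : Set (ℝ × Sp d))
    · rw [indicator_of_mem hz, indicator_of_mem hz', indicator_of_mem (show z.1 ∈ Iio (T - k) from hz'.1.2)]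
    · have : z.1 ∉ Iio (T - k) := fun h => hz' ((mem_cyl_sub_iff hz).2 h)
      rw [indicator_of_mem hz, indicator_of_notMem hz', indicator_of_notMem this]
  · rw [indicator_of_notMem hz, indicator_of_notMem fun h => hz (hsub h)]

lemma integrable_indicator_cyl {k : ℝ} {g : ℝ × Sp d → ℝ}
    (hg : Integrable g (vol (cyl (T - k) Ω))) :
    Integrable (fun z => (Iio (T - k)).indicator (fun _ => g z) z.1) (vol (cyl T Ω)) := by
  have h1 := (integrable_indicator_iff (cyl (T - k) Ω).isOpen.measurableSet).2 hg
  refine h1.integrableOn.congr_fun (fun z hz => ?_) (cyl T Ω).isOpen.measurableSet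
  by_cases hz' : z ∈ (cyl (T - k) Ω : Set (ℝ × Sp d))
  · rw [indicator_of_mem hz', indicator_of_mem (show z.1 ∈ Iio (T - k) from hz'.1.2)]
  · have : z.1 ∉ Iio (T - k) := fun h => hz' ((mem_cyl_sub_iff hz).2 h)
    rw [indicator_of_notMem hz', indicator_of_notMem this]

lemma integrable_timeAvg {w : ℝ × Sp d → ℝ} (hw : Integrable w (vol (cyl T Ω))) {k : ℝ}
    (hk : 0 ≤ k) : Integrable (timeAvg T k w) (vol (cyl T Ω)) :=
  integrable_indicator_cyl ((integrable_average_vol hw hk slides_cyl).const_mul _)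

/-- Time averages are contractions of `L¹`. -/
lemma lintegral_timeAvg_le {w : ℝ × Sp d → ℝ} (hw : Integrable w (vol (cyl T Ω))) {k : ℝ}
    (hk : 0 < k) : ∫⁻ z, ‖timeAvg T k w z‖ₑ ∂(vol (cyl T Ω)) ≤ ∫⁻ z, ‖w z‖ₑ ∂(vol (cyl T Ω)) := by
  have hi : ∀ z : ℝ × Sp d, ‖timeAvg T k w z‖ₑ = (Iio (T - k)).indicator
      (fun _ => ‖k⁻¹ * ∫ τ in (0 : ℝ)..k, w (z + τ • dirT d)‖ₑ) z.1 := by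
    intro z
    by_cases h : z.1 ∈ Iio (T - k)
    · rw [timeAvg, indicator_of_mem h, indicator_of_mem h]
    · rw [timeAvg, indicator_of_notMem h, indicator_of_notMem h, enorm_zero]
  simp only [hi]
  rw [lintegral_indicator_cyl hk.le]
  have hm := hw.aestronglyMeasurable.aemeasurable
  set w' := hm.mk w with hw'
  have e : ∫⁻ z, ‖w z‖ₑ ∂(vol (cyl T Ω)) = ∫⁻ z, ‖w' z‖ₑ ∂(vol (cyl T Ω)) :=
    lintegral_congr_ae (by filter_upwards [hm.ae_eq_mk] with x hx; rw [hx])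
  -- replacing `w` by a measurable representative changes the averages on a null set only
  have hae : ∀ᵐ z ∂(vol (cyl (T - k) Ω)), ∫ τ in (0 : ℝ)..k, w (z + τ • dirT d)
      = ∫ τ in (0 : ℝ)..k, w' (z + τ • dirT d) := by
    have hw'i : Integrable w' (vol (cyl T Ω)) := hw.congr hm.ae_eq_mk
    have h0 := integrable_average_vol (hw.sub hw'i) hk.le (slides_cyl (T := T) (Ω := Ω))
    have h1 := integrable_average_vol hw hk.le (slides_cyl (T := T) (Ω := Ω))
    have h2 := integrable_average_vol hw'i hk.le (slides_cyl (T := T) (Ω := Ω))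
    have h3 := ae_eq_zero_of_forall_testFunction (IntegrableOn.locallyIntegrableOn (h1.sub h2))
      fun φ => by
        obtain ⟨ψ, hψ, -⟩ := exists_testFunction_average hk.le (slides_cyl (T := T) (Ω := Ω)) φ
        simp only [Pi.sub_apply, sub_mul]
        rw [integral_sub (integrable_mul_testFunction (IntegrableOn.locallyIntegrableOn h1) φ)
          (integrable_mul_testFunction (IntegrableOn.locallyIntegrableOn h2) φ),
          ← integral_mul_average hk.le slides_cyl (IntegrableOn.locallyIntegrableOn hw) φ hψ,
          ← integral_mul_average hk.le slides_cyl (IntegrableOn.locallyIntegrableOn hw'i) φ hψ,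
          sub_eq_zero]
        refine integral_congr_ae ?_
        filter_upwards [hm.ae_eq_mk] with x hx
        rw [hx]
    filter_upwards [h3] with z hz
    exact sub_eq_zero.1 hz
  calc ∫⁻ z, ‖k⁻¹ * ∫ τ in (0 : ℝ)..k, w (z + τ • dirT d)‖ₑ ∂(vol (cyl (T - k) Ω))
      ≤ ∫⁻ z, ‖k⁻¹‖ₑ * (∫⁻ τ in Ioc 0 k, ‖w' (z + τ • dirT d)‖ₑ) ^ (1 : ℝ)
          ∂(vol (cyl (T - k) Ω)) := by
        refine lintegral_mono_ae ?_
        filter_upwards [hae] with z hz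
        rw [hz, enorm_mul, ENNReal.rpow_one]
        gcongr
        exact enorm_average_le hk.le z _
    _ ≤ ‖k⁻¹‖ₑ * (ENNReal.ofReal k ^ (1 : ℝ) * ∫⁻ z, ‖w' z‖ₑ ^ (1 : ℝ) ∂(vol (cyl T Ω))) := by
        rw [lintegral_const_mul' _ _ enorm_ne_top]
        gcongr
        exact lintegral_average_rpow_le le_rfl hk.le hm.measurable_mk slides_cyl
    _ = ∫⁻ z, ‖w z‖ₑ ∂(vol (cyl T Ω)) := by
        simp only [ENNReal.rpow_one]
        rw [← mul_assoc, e, Real.enorm_of_nonneg (by positivity), ← ENNReal.ofReal_mul (by positivity),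
          inv_mul_cancel₀ hk.ne', ENNReal.ofReal_one, one_mul]

/-- Time averages converge in `L¹`. -/
lemma tendsto_lintegral_timeAvg (hb : Bornology.IsBounded (Ω : Set (Sp d))) {w : ℝ × Sp d → ℝ}
    (hw : Integrable w (vol (cyl T Ω))) :
    Tendsto (fun k => ∫⁻ z, ‖timeAvg T k w z - w z‖ₑ ∂(vol (cyl T Ω))) (𝓝[>] 0) (𝓝 0) := by
  have hfin := isFiniteMeasure_vol_cyl hb T
  -- the claim for continuous functions with compact support
  have hcont : ∀ g : ℝ × Sp d → ℝ, Continuous g → HasCompactSupport g →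
      Tendsto (fun k => ∫⁻ z, ‖timeAvg T k g z - g z‖ₑ ∂(vol (cyl T Ω))) (𝓝[>] 0) (𝓝 0) := by
    intro g hg hgc
    obtain ⟨B, hB⟩ := hg.bounded_above_of_compact_support hgc
    have hgi : Integrable g (vol (cyl T Ω)) := Integrable.of_bound hg.aestronglyMeasurable B
      (ae_of_all _ hB)
    have hB0 : 0 ≤ B := (norm_nonneg _).trans (hB 0)
    have hi : Tendsto (fun k => ∫ z, ‖timeAvg T k g z - g z‖ ∂(vol (cyl T Ω))) (𝓝[>] 0)
        (𝓝 (∫ _z, (0 : ℝ) ∂(vol (cyl T Ω)))) := by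
      refine tendsto_integral_filter_of_dominated_convergence (fun _ => B + B) ?_ ?_
        (integrable_const _) ?_
      · filter_upwards [self_mem_nhdsWithin] with k hk
        exact ((integrable_timeAvg hgi (le_of_lt hk)).sub hgi).aestronglyMeasurable.norm
      · filter_upwards [self_mem_nhdsWithin] with k hk
        have hk' : (0 : ℝ) < k := hk
        refine ae_of_all _ fun z => ?_
        rw [norm_norm]
        refine (norm_sub_le _ _).trans (add_le_add ?_ (hB z))
        rw [timeAvg]
        refine (norm_indicator_le_norm_self _ _).trans ?_
        rw [norm_mul, norm_inv, Real.norm_eq_abs k, abs_of_pos hk', inv_mul_le_iff₀ hk']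
        have := intervalIntegral.norm_integral_le_of_norm_le_const (a := 0) (b := k)
          (f := fun τ : ℝ => g (z + τ • dirT d)) (C := B) (fun τ _ => hB _)
        rwa [sub_zero, abs_of_pos hk', mul_comm] at this
      · filter_upwards [ae_restrict_mem (cyl T Ω).isOpen.measurableSet] with z hz
        have h1 : Tendsto (fun k => k⁻¹ * ∫ τ in (0 : ℝ)..k, g (z + τ • dirT d)) (𝓝[>] 0)
            (𝓝 (g z)) := by
          have hc : Continuous fun τ : ℝ => g (z + τ • dirT d) := by fun_prop
          have h2 := (hc.integral_hasStrictDerivAt 0 0).hasDerivAt.tendsto_slope_zero_right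
          simpa using h2
        have h2 : ∀ᶠ k in 𝓝[>] (0 : ℝ), timeAvg T k g z
            = k⁻¹ * ∫ τ in (0 : ℝ)..k, g (z + τ • dirT d) := by
          have : ∀ᶠ k in 𝓝 (0 : ℝ), k < T - z.1 := Iio_mem_nhds (by linarith [hz.1.2])
          filter_upwards [this.filter_mono nhdsWithin_le_nhds] with k hk
          rw [timeAvg, indicator_of_mem]
          simp only [mem_Iio]; linarith
        have h3 := (h1.congr' (h2.mono fun k hk => hk.symm)).sub_const (g z)
        rw [sub_self] at h3
        simpa using h3.norm
    have hi' := ENNReal.tendsto_ofReal hi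
    rw [integral_zero, ENNReal.ofReal_zero] at hi'
    refine hi'.congr' ?_
    filter_upwards [self_mem_nhdsWithin] with k hk
    exact ofReal_integral_norm_eq_lintegral_enorm ((integrable_timeAvg hgi (le_of_lt hk)).sub hgi)
  rw [ENNReal.tendsto_nhds_zero]
  intro ε hε
  rcases eq_or_ne ε ∞ with rfl | hεt
  · exact Eventually.of_forall fun _ => le_top
  obtain ⟨g, hgc, hgw, hg, -⟩ := (memLp_one_iff_integrable.2 hw).exists_hasCompactSupport_eLpNorm_sub_le
    ENNReal.one_ne_top (ε := ε / 3) (by simpa using hε.ne')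
  have hgi : Integrable g (vol (cyl T Ω)) := by
    obtain ⟨B, hB⟩ := hg.bounded_above_of_compact_support hgc
    exact Integrable.of_bound hg.aestronglyMeasurable B (ae_of_all _ hB)
  rw [eLpNorm_one_eq_lintegral_enorm] at hgw
  filter_upwards [(ENNReal.tendsto_nhds_zero.1 (hcont g hg hgc)) (ε / 3) (by simpa using hε.ne'),
    self_mem_nhdsWithin] with k hk hk0
  have hk0' : (0 : ℝ) < k := hk0
  have hlin : ∀ᵐ z ∂(vol (cyl T Ω)), timeAvg T k w z - timeAvg T k g z = timeAvg T k (w - g) z := by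
    -- on almost every line the averages are additive
    have hwm : Integrable ((cyl T Ω : Set (ℝ × Sp d)).indicator w) :=
      (integrable_indicator_iff (cyl T Ω).isOpen.measurableSet).2 hw
    have h1 := (integrable_shear hwm k (dirT d)).swap.prod_right_ae
    have h1' := ae_mono (Measure.restrict_le_self (s := (cyl T Ω : Set (ℝ × Sp d)))) h1
    filter_upwards [h1', ae_restrict_mem (cyl T Ω).isOpen.measurableSet] with z hz hzU
    by_cases h : z.1 ∈ Iio (T - k)
    · simp only [timeAvg, indicator_of_mem h]
      have hzA : z ∈ (cyl (T - k) Ω : Set (ℝ × Sp d)) := (mem_cyl_sub_iff hzU).2 h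
      have i1 : IntervalIntegrable (fun τ : ℝ => w (z + τ • dirT d)) volume 0 k := by
        rw [intervalIntegrable_iff_integrableOn_Ioc_of_le hk0'.le]
        refine IntegrableOn.congr_fun hz (fun τ hτ => ?_) measurableSet_Ioc
        exact indicator_of_mem (slides_cyl z hzA τ ⟨hτ.1.le, hτ.2⟩) _
      have i2 : IntervalIntegrable (fun τ : ℝ => g (z + τ • dirT d)) volume 0 k :=
        Continuous.intervalIntegrable (by fun_prop) _ _
      simp only [Pi.sub_apply]
      rw [intervalIntegral.integral_sub i1 i2, mul_sub]
    · simp only [timeAvg, indicator_of_notMem h, sub_zero]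
  calc ∫⁻ z, ‖timeAvg T k w z - w z‖ₑ ∂(vol (cyl T Ω))
      ≤ ∫⁻ z, (‖timeAvg T k (w - g) z‖ₑ + ‖timeAvg T k g z - g z‖ₑ + ‖(w - g) z‖ₑ)
          ∂(vol (cyl T Ω)) := by
        refine lintegral_mono_ae ?_
        filter_upwards [hlin] with z hz
        have e1 : timeAvg T k w z - w z = timeAvg T k (w - g) z + (timeAvg T k g z - g z)
            - (w - g) z := by
          rw [← hz]; simp
        rw [e1]
        exact (enorm_sub_le).trans (add_le_add (enorm_add_le _ _) le_rfl)
    _ = ∫⁻ z, ‖timeAvg T k (w - g) z‖ₑ ∂(vol (cyl T Ω))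
          + ∫⁻ z, ‖timeAvg T k g z - g z‖ₑ ∂(vol (cyl T Ω))
          + ∫⁻ z, ‖(w - g) z‖ₑ ∂(vol (cyl T Ω)) := by
        have m1 : AEMeasurable (fun z => ‖timeAvg T k (w - g) z‖ₑ) (vol (cyl T Ω)) :=
          (integrable_timeAvg (hw.sub hgi) hk0'.le).aestronglyMeasurable.enorm
        have m2 : AEMeasurable (fun z => ‖timeAvg T k g z - g z‖ₑ) (vol (cyl T Ω)) :=
          ((integrable_timeAvg hgi hk0'.le).sub hgi).aestronglyMeasurable.enorm
        have m3 : AEMeasurable (fun z => ‖timeAvg T k (w - g) z‖ₑ + ‖timeAvg T k g z - g z‖ₑ)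
            (vol (cyl T Ω)) := m1.add m2
        rw [lintegral_add_left' m3, lintegral_add_left' m1]
    _ ≤ ε / 3 + ε / 3 + ε / 3 :=
        add_le_add (add_le_add ((lintegral_timeAvg_le (hw.sub hgi) hk0').trans hgw) hk) hgw
    _ = ε := ENNReal.add_thirds ε

end TimeAverage

/-! ### Distributions with an integrable spatial gradient -/

section PressureFunction

variable {d : ℕ} {T : ℝ} {Ω : Opens (Sp d)}

lemma HasWeakDeriv.const_mul {V : Type*} [NormedAddCommGroup V] [NormedSpace ℝ V] [MeasureSpace V]
    {U : Opens V} {u w : V → ℝ} {m : V} (h : HasWeakDeriv U u w m) (c : ℝ) :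
    HasWeakDeriv U (fun x => c * u x) (fun x => c * w x) m := by
  refine ⟨h.1.smul c, h.2.1.smul c, fun φ => ?_⟩
  simp only [mul_assoc, integral_const_mul]
  rw [h.2.2 φ, mul_neg]

lemma hasWeakDeriv_zero {V : Type*} [NormedAddCommGroup V] [NormedSpace ℝ V] [MeasureSpace V]
    {U : Opens V} {m : V} : HasWeakDeriv U (fun _ => 0) (fun _ => 0) m :=
  ⟨locallyIntegrableOn_zero, locallyIntegrableOn_zero, fun φ => by simp⟩

/-- The time average of the distribution `u₀ + ∂ₜ u₁` over a step of length `k`. -/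
noncomputable def timeAvgDist (T k : ℝ) (u₀ u₁ : ℝ × Sp d → ℝ) (z : ℝ × Sp d) : ℝ :=
  (Iio (T - k)).indicator (fun _ => k⁻¹ * increment u₀ u₁ k (dirT d) z) z.1

lemma integrable_timeAvgDist {u₀ u₁ : ℝ × Sp d → ℝ} (h₀ : Integrable u₀ (vol (cyl T Ω)))
    (h₁ : Integrable u₁ (vol (cyl T Ω))) {k : ℝ} (hk : 0 ≤ k) :
    Integrable (timeAvgDist T k u₀ u₁) (vol (cyl T Ω)) :=
  integrable_indicator_cyl ((integrable_increment h₀ h₁ hk slides_cyl).const_mul _)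

lemma ae_volI_sub {k : ℝ} {P : ℝ → Prop} (h : ∀ᵐ t ∂(volI (T - k)), P t) :
    ∀ᵐ t ∂(volI T), t < T - k → P t := by
  rw [ae_restrict_iff' measurableSet_Ioo] at h ⊢
  filter_upwards [h] with t ht h1 h2
  exact ht ⟨h1.1, h2⟩

lemma ae_volI_shift {k : ℝ} (hk : 0 ≤ k) {P : ℝ → Prop} (h : ∀ᵐ t ∂(volI T), P t) :
    ∀ᵐ t ∂(volI T), t < T - k → P (t + k) := by
  rw [ae_restrict_iff' measurableSet_Ioo] at h ⊢
  have := (measurePreserving_add_right (volume : Measure ℝ) k).quasiMeasurePreserving.ae h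
  filter_upwards [this] with t ht h1 h2
  exact ht ⟨by linarith [h1.1], by linarith⟩

/-- The slices of the averages have the averaged gradients. -/
lemma hasWeakGrad_timeAvgDist (hb : Bornology.IsBounded (Ω : Set (Sp d)))
    {u₀ u₁ : ℝ × Sp d → ℝ} {h : Fin d → ℝ × Sp d → ℝ} (h₀ : Integrable u₀ (vol (cyl T Ω)))
    (h₁ : Integrable u₁ (vol (cyl T Ω))) (hh : ∀ i, Integrable (h i) (vol (cyl T Ω)))
    (hgrad : ∀ i, ∀ η : 𝓓(cyl T Ω, ℝ), ∫ z, u₀ z * fderiv ℝ η z (dirX i) ∂(vol (cyl T Ω))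
      - ∫ z, u₁ z * fderiv ℝ (∂_{(dirX i : ℝ × Sp d)} η : 𝓓(cyl T Ω, ℝ)) z (dirT d)
          ∂(vol (cyl T Ω)) = - ∫ z, h i z * η z ∂(vol (cyl T Ω))) {k : ℝ} (hk : 0 ≤ k) :
    ∀ᵐ t ∂(volI T), HasWeakGrad Ω (fun x => timeAvgDist T k u₀ u₁ (t, x))
      (fun i x => timeAvg T k (h i) (t, x)) := by
  refine ae_all_iff.2 fun i => ?_
  have h1 := hasWeakDeriv_increment hk (slides_cyl (T := T) (Ω := Ω))
    (IntegrableOn.locallyIntegrableOn h₀) (IntegrableOn.locallyIntegrableOn h₁)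
    (IntegrableOn.locallyIntegrableOn (hh i)) (hgrad i)
  have h2 := HasWeakDeriv.slice hb (integrable_increment h₀ h₁ hk slides_cyl)
    (integrable_average_vol (hh i) hk slides_cyl) h1.2.2
  filter_upwards [ae_volI_sub h2] with t ht
  by_cases htk : t ∈ Iio (T - k)
  · simp only [timeAvg, timeAvgDist, indicator_of_mem htk]
    exact (ht htk).const_mul _
  · simp only [timeAvg, timeAvgDist, indicator_of_notMem htk]
    exact hasWeakDeriv_zero

/-- The slices of the averages have mean value zero. -/
lemma integral_timeAvgDist_eq_zero {u₀ u₁ : ℝ × Sp d → ℝ} (h₀ : Integrable u₀ (vol (cyl T Ω)))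
    (h₁ : Integrable u₁ (vol (cyl T Ω)))
    (m₀ : ∀ᵐ t ∂(volI T), ∫ x, u₀ (t, x) ∂(vol Ω) = 0)
    (m₁ : ∀ᵐ t ∂(volI T), ∫ x, u₁ (t, x) ∂(vol Ω) = 0) {k : ℝ} (hk : 0 ≤ k) :
    ∀ᵐ t ∂(volI T), ∫ x, timeAvgDist T k u₀ u₁ (t, x) ∂(vol Ω) = 0 := by
  have h₀' := h₀
  have h₁' := h₁
  rw [vol_cyl] at h₀' h₁'
  have i1 := h₁'.prod_right_ae
  filter_upwards [m₁, ae_volI_shift hk m₁, i1, ae_volI_shift hk i1,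
    ae_restrict_mem measurableSet_Ioo] with t ht1 ht2 ht3 ht4 htT
  by_cases htk : t ∈ Iio (T - k)
  swap
  · simp only [timeAvgDist, indicator_of_notMem htk, integral_zero]
  simp only [timeAvgDist, indicator_of_mem htk, integral_const_mul, increment]
  have htk' : t < T - k := htk
  have hsub : Ioc t (t + k) ⊆ Ioo 0 T := fun σ hσ =>
    ⟨htT.1.trans hσ.1, hσ.2.trans_lt (by linarith)⟩
  have hi : Integrable u₀ ((volume.restrict (Ioc t (t + k))).prod (vol Ω)) :=
    h₀'.mono_measure (Measure.prod_mono (Measure.restrict_mono hsub le_rfl) le_rfl)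
  have e0 : ∀ x : Sp d, ∫ τ in (0 : ℝ)..k, u₀ ((t, x) + τ • dirT d)
      = ∫ σ in Ioc t (t + k), u₀ (σ, x) := by
    intro x
    rw [← intervalIntegral.integral_of_le (by linarith)]
    have := intervalIntegral.integral_comp_add_left (a := 0) (b := k) (fun σ => u₀ (σ, x)) t
    rw [add_zero] at this
    rw [← this]
    simp
  have e1 : ∫ x, (∫ τ in (0 : ℝ)..k, u₀ ((t, x) + τ • dirT d)) ∂(vol Ω) = 0 := by
    simp only [e0]
    rw [integral_integral_swap (f := fun x σ => u₀ (σ, x)) hi.swap]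
    have : ∀ᵐ σ ∂(volume.restrict (Ioc t (t + k))), ∫ x, u₀ (σ, x) ∂(vol Ω) = 0 :=
      ae_mono (Measure.restrict_mono hsub le_rfl) m₀
    exact integral_eq_zero_of_ae this
  have e2 : ∀ x : Sp d, (t, x) + k • dirT d = (t + k, x) := fun x => by simp
  have i0 : Integrable (fun x => ∫ τ in (0 : ℝ)..k, u₀ ((t, x) + τ • dirT d)) (vol Ω) := by
    simp only [e0]
    exact hi.integral_prod_right
  simp only [e2]
  have i4 : Integrable (fun x => u₁ (t + k, x) - u₁ (t, x)) (vol Ω) := (ht4 htk').sub ht3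
  rw [integral_add i0 i4, integral_sub (ht4 htk') ht3, e1, ht1, ht2 htk']
  simp

/-- The time averages form a Cauchy family in `L¹`, by the Poincaré inequality on the slices. -/
lemma lintegral_timeAvgDist_sub_le (hd : 0 < d) (hc : IsConnected (Ω : Set (Sp d)))
    (hb : Bornology.IsBounded (Ω : Set (Sp d))) (hL : HasLipschitzBoundary (Ω : Set (Sp d)))
    {u₀ u₁ : ℝ × Sp d → ℝ} {h : Fin d → ℝ × Sp d → ℝ} (h₀ : Integrable u₀ (vol (cyl T Ω)))
    (h₁ : Integrable u₁ (vol (cyl T Ω))) (hh : ∀ i, Integrable (h i) (vol (cyl T Ω)))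
    (m₀ : ∀ᵐ t ∂(volI T), ∫ x, u₀ (t, x) ∂(vol Ω) = 0)
    (m₁ : ∀ᵐ t ∂(volI T), ∫ x, u₁ (t, x) ∂(vol Ω) = 0)
    (hgrad : ∀ i, ∀ η : 𝓓(cyl T Ω, ℝ), ∫ z, u₀ z * fderiv ℝ η z (dirX i) ∂(vol (cyl T Ω))
      - ∫ z, u₁ z * fderiv ℝ (∂_{(dirX i : ℝ × Sp d)} η : 𝓓(cyl T Ω, ℝ)) z (dirT d)
          ∂(vol (cyl T Ω)) = - ∫ z, h i z * η z ∂(vol (cyl T Ω))) :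
    ∃ C : ℝ≥0, ∀ k l : ℝ, 0 ≤ k → 0 ≤ l →
      ∫⁻ z, ‖timeAvgDist T k u₀ u₁ z - timeAvgDist T l u₀ u₁ z‖ₑ ∂(vol (cyl T Ω))
        ≤ C * ∑ i, ∫⁻ z, ‖timeAvg T k (h i) z - timeAvg T l (h i) z‖ₑ ∂(vol (cyl T Ω)) := by
  obtain ⟨C, hC⟩ := exists_poincare hd hc hb hL
  have := isFiniteMeasure_vol hb
  refine ⟨C, fun k l hk hl => ?_⟩
  have ik := integrable_timeAvgDist h₀ h₁ hk
  have il := integrable_timeAvgDist h₀ h₁ hl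
  have jk := fun i => integrable_timeAvg (hh i) hk
  have jl := fun i => integrable_timeAvg (hh i) hl
  have ik' := ik
  have il' := il
  rw [vol_cyl] at ik' il'
  have key : ∀ᵐ t ∂(volI T), ∫⁻ x, ‖timeAvgDist T k u₀ u₁ (t, x)
      - timeAvgDist T l u₀ u₁ (t, x)‖ₑ ∂(vol Ω)
      ≤ C * ∑ i, ∫⁻ x, ‖timeAvg T k (h i) (t, x) - timeAvg T l (h i) (t, x)‖ₑ ∂(vol Ω) := by
    filter_upwards [hasWeakGrad_timeAvgDist hb h₀ h₁ hh hgrad hk,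
      hasWeakGrad_timeAvgDist hb h₀ h₁ hh hgrad hl,
      integral_timeAvgDist_eq_zero h₀ h₁ m₀ m₁ hk, integral_timeAvgDist_eq_zero h₀ h₁ m₀ m₁ hl,
      ik'.prod_right_ae, il'.prod_right_ae] with t g1 g2 z1 z2 f1 f2
    exact hC _ (fun i x => timeAvg T k (h i) (t, x) - timeAvg T l (h i) (t, x))
      (fun i => (g1 i).sub (g2 i)) (f1.sub f2) (by rw [integral_sub f1 f2, z1, z2, sub_zero])
  have hm : AEMeasurable (fun z => ‖timeAvgDist T k u₀ u₁ z - timeAvgDist T l u₀ u₁ z‖ₑ)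
      (vol (cyl T Ω)) := (ik.sub il).aestronglyMeasurable.enorm
  have hmi : ∀ i, AEMeasurable (fun z => ‖timeAvg T k (h i) z - timeAvg T l (h i) z‖ₑ)
      (vol (cyl T Ω)) := fun i => ((jk i).sub (jl i)).aestronglyMeasurable.enorm
  rw [vol_cyl] at hm hmi ⊢
  rw [lintegral_prod _ hm]
  refine (lintegral_mono_ae key).trans (le_of_eq ?_)
  rw [lintegral_const_mul' _ _ ENNReal.coe_ne_top,
    lintegral_finsetSum' _ fun i _ => (hmi i).lintegral_prod_right']
  congr 1
  exact Finset.sum_congr rfl fun i _ => (lintegral_prod _ (hmi i)).symm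

/-- A test function on the cylinder vanishes near the final time. -/
lemma exists_tsupport_subset_cyl_sub (η : 𝓓(cyl T Ω, ℝ)) :
    ∃ κ > 0, ∀ k ≤ κ, tsupport η ⊆ cyl (T - k) Ω := by
  rcases (tsupport η).eq_empty_or_nonempty with h | h
  · exact ⟨1, one_pos, fun k _ => by rw [h]; exact empty_subset _⟩
  obtain ⟨z₀, hz₀, hmax⟩ := η.hasCompactSupport.isCompact.exists_isMaxOn h continuous_fst.continuousOn
  have h0 := (η.tsupport_subset hz₀).1.2
  refine ⟨(T - z₀.1) / 2, by linarith, fun k hk z hz => ?_⟩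
  have h1 : z.1 ≤ z₀.1 := hmax hz
  have h2 := η.tsupport_subset hz
  exact ⟨⟨h2.1.1, by linarith⟩, h2.2⟩

/-- The averages converge to the distribution. -/
lemma tendsto_integral_timeAvgDist_mul {u₀ u₁ : ℝ × Sp d → ℝ}
    (h₀ : Integrable u₀ (vol (cyl T Ω))) (h₁ : Integrable u₁ (vol (cyl T Ω))) (η : 𝓓(cyl T Ω, ℝ)) :
    Tendsto (fun k => ∫ z, timeAvgDist T k u₀ u₁ z * η z ∂(vol (cyl T Ω))) (𝓝[>] 0)
      (𝓝 (∫ z, u₀ z * η z ∂(vol (cyl T Ω))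
        - ∫ z, u₁ z * fderiv ℝ η z (dirT d) ∂(vol (cyl T Ω)))) := by
  obtain ⟨κ, hκ, hκη⟩ := exists_tsupport_subset_cyl_sub η
  obtain ⟨B, hB⟩ := η.continuous.bounded_above_of_compact_support η.hasCompactSupport
  obtain ⟨L, hL⟩ := η.contDiff.lipschitzWith_of_hasCompactSupport η.hasCompactSupport (by simp)
  have hc := η.continuous
  -- the limit of the averaged test functions
  have l0 : Tendsto (fun k : ℝ => ∫ z, u₀ z * (k⁻¹ * ∫ τ in (0 : ℝ)..k, η (z - τ • dirT d))
      ∂(vol (cyl T Ω))) (𝓝[>] 0) (𝓝 (∫ z, u₀ z * η z ∂(vol (cyl T Ω)))) := by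
    refine tendsto_integral_filter_of_dominated_convergence (fun z => ‖u₀ z‖ * B) ?_ ?_
      (h₀.norm.mul_const _) ?_
    · refine Eventually.of_forall fun k => h₀.aestronglyMeasurable.mul ?_
      have : Continuous fun z : ℝ × Sp d => ∫ τ in (0 : ℝ)..k, η (z - τ • dirT d) := by
        apply intervalIntegral.continuous_parametric_intervalIntegral_of_continuous'
        fun_prop
      exact (this.const_mul _).aestronglyMeasurable
    · filter_upwards [self_mem_nhdsWithin] with k hk
      have hk' : (0 : ℝ) < k := hk
      refine ae_of_all _ fun z => ?_
      rw [norm_mul]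
      gcongr
      rw [norm_mul, norm_inv, Real.norm_eq_abs k, abs_of_pos hk', inv_mul_le_iff₀ hk']
      have := intervalIntegral.norm_integral_le_of_norm_le_const (a := 0) (b := k)
        (f := fun τ : ℝ => η (z - τ • dirT d)) (C := B) (fun τ _ => hB _)
      rwa [sub_zero, abs_of_pos hk', mul_comm] at this
    · refine ae_of_all _ fun z => ?_
      have hc : Continuous fun τ : ℝ => η (z - τ • dirT d) := by fun_prop
      have h2 := (hc.integral_hasStrictDerivAt 0 0).hasDerivAt.tendsto_slope_zero_right
      simpa using h2.const_mul (u₀ z)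
  have l1 : Tendsto (fun k : ℝ => ∫ z, u₁ z * (k⁻¹ * (η z - η (z - k • dirT d)))
      ∂(vol (cyl T Ω))) (𝓝[>] 0) (𝓝 (∫ z, u₁ z * fderiv ℝ η z (dirT d) ∂(vol (cyl T Ω)))) := by
    refine tendsto_integral_filter_of_dominated_convergence (fun z => ‖u₁ z‖ * (L * ‖dirT d‖)) ?_ ?_
      (h₁.norm.mul_const _) ?_
    · refine Eventually.of_forall fun k => h₁.aestronglyMeasurable.mul ?_
      exact Continuous.aestronglyMeasurable (by fun_prop)
    · filter_upwards [self_mem_nhdsWithin] with k hk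
      have hk' : (0 : ℝ) < k := hk
      refine ae_of_all _ fun z => ?_
      rw [norm_mul]
      gcongr
      rw [norm_mul, norm_inv, Real.norm_eq_abs k, abs_of_pos hk', inv_mul_le_iff₀ hk']
      have := hL.dist_le_mul z (z - k • dirT d)
      rw [dist_eq_norm, dist_eq_norm, sub_sub_cancel, norm_smul, Real.norm_eq_abs k,
        abs_of_pos hk'] at this
      linarith
    · refine ae_of_all _ fun z => ?_
      have h1 : HasDerivAt (fun τ : ℝ => - η (z - τ • dirT d)) (fderiv ℝ η z (dirT d)) 0 := by
        have h2 : HasDerivAt (fun τ : ℝ => z - τ • dirT d) (- dirT d) 0 := by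
          simpa using ((hasDerivAt_id (0 : ℝ)).smul_const (dirT d)).const_sub z
        have h3 : HasFDerivAt η (fderiv ℝ η z) (z - (0 : ℝ) • dirT d) := by
          rw [zero_smul, sub_zero]
          exact ((η.contDiff.differentiable (by simp)) z).hasFDerivAt
        have h4 := (h3.comp_hasDerivAt (0 : ℝ) h2).neg
        refine h4.congr_deriv ?_
        rw [map_neg, neg_neg]
      have h2 := h1.tendsto_slope_zero_right.const_mul (u₁ z)
      refine h2.congr fun k => ?_
      simp only [zero_add, zero_smul, sub_zero, smul_eq_mul]
      ring
  refine (l0.sub l1).congr' ?_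
  filter_upwards [Ioc_mem_nhdsGT hκ] with k hk
  have hk0 : 0 < k := hk.1
  let η' : 𝓓(cyl (T - k) Ω, ℝ) := ⟨η, η.contDiff, η.hasCompactSupport, hκη k hk.2⟩
  obtain ⟨ψ, hψ, -, hψm, -⟩ := exists_testFunction_average hk0.le (slides_cyl (T := T) (Ω := Ω)) η'
  have e := integral_increment_mul hk0.le slides_cyl (IntegrableOn.locallyIntegrableOn h₀)
    (IntegrableOn.locallyIntegrableOn h₁) η' hψ hψm
  simp only [hψ, hψm] at e
  have e1 : ∫ z, timeAvgDist T k u₀ u₁ z * η z ∂(vol (cyl T Ω))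
      = k⁻¹ * ∫ z, increment u₀ u₁ k (dirT d) z * η' z ∂(vol (cyl (T - k) Ω)) := by
    have hz : ∀ z ∉ (cyl (T - k) Ω : Set (ℝ × Sp d)), η z = 0 := fun z hz =>
      image_eq_zero_of_notMem_tsupport fun h => hz (hκη k hk.2 h)
    rw [← integral_const_mul, integral_vol_eq, integral_vol_eq (U := cyl (T - k) Ω)]
    · refine integral_congr_ae (ae_of_all _ fun z => ?_)
      simp only
      by_cases hzk : z ∈ (cyl (T - k) Ω : Set (ℝ × Sp d))
      · rw [timeAvgDist, indicator_of_mem (show z.1 ∈ Iio (T - k) from hzk.1.2), mul_assoc]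
        rfl
      · rw [hz z hzk, show η' z = 0 from hz z hzk]; simp
    · intro z hzk
      rw [show η' z = 0 from hz z hzk]; simp
    · intro z hzk
      rw [hz z fun h => hzk (cyl_mono hk0.le h)]; simp
  rw [e1, ← e, mul_sub, ← integral_const_mul, ← integral_const_mul]
  congr 1 <;>
  · refine integral_congr_ae (ae_of_all _ fun z => ?_)
    simp only [η', TestFunction.coe_mk]
    ring

/-- A distribution `u₀ + ∂ₜ u₁`, with `u₀` and `u₁` of mean zero on the time slices, whose spatial
gradient is an integrable function is itself an integrable function. -/
theorem exists_integrable_of_gradient (hd : 0 < d) (hc : IsConnected (Ω : Set (Sp d)))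
    (hb : Bornology.IsBounded (Ω : Set (Sp d))) (hL : HasLipschitzBoundary (Ω : Set (Sp d)))
    {u₀ u₁ : ℝ × Sp d → ℝ} {h : Fin d → ℝ × Sp d → ℝ} (h₀ : Integrable u₀ (vol (cyl T Ω)))
    (h₁ : Integrable u₁ (vol (cyl T Ω))) (hh : ∀ i, Integrable (h i) (vol (cyl T Ω)))
    (m₀ : ∀ᵐ t ∂(volI T), ∫ x, u₀ (t, x) ∂(vol Ω) = 0)
    (m₁ : ∀ᵐ t ∂(volI T), ∫ x, u₁ (t, x) ∂(vol Ω) = 0)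
    (hgrad : ∀ i, ∀ η : 𝓓(cyl T Ω, ℝ), ∫ z, u₀ z * fderiv ℝ η z (dirX i) ∂(vol (cyl T Ω))
      - ∫ z, u₁ z * fderiv ℝ (∂_{(dirX i : ℝ × Sp d)} η : 𝓓(cyl T Ω, ℝ)) z (dirT d)
          ∂(vol (cyl T Ω)) = - ∫ z, h i z * η z ∂(vol (cyl T Ω))) :
    ∃ π : ℝ × Sp d → ℝ, Integrable π (vol (cyl T Ω)) ∧
      (∀ η : 𝓓(cyl T Ω, ℝ), ∫ z, u₀ z * η z ∂(vol (cyl T Ω))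
        - ∫ z, u₁ z * fderiv ℝ η z (dirT d) ∂(vol (cyl T Ω)) = ∫ z, π z * η z ∂(vol (cyl T Ω))) ∧
      ∀ᵐ t ∂(volI T), HasWeakGrad Ω (fun x => π (t, x)) (fun i x => h i (t, x)) := by
  obtain ⟨C, hC⟩ := lintegral_timeAvgDist_sub_le hd hc hb hL h₀ h₁ hh m₀ m₁ hgrad
  let k : ℕ → ℝ := fun n => 1 / (n + 1)
  have hk0 : ∀ n, 0 < k n := fun n => by positivity
  have hk : Tendsto k atTop (𝓝[>] 0) :=
    tendsto_nhdsWithin_iff.2 ⟨tendsto_one_div_add_atTop_nhds_zero_nat, Eventually.of_forall hk0⟩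
  have hi : ∀ n, MemLp (timeAvgDist T (k n) u₀ u₁) 1 (vol (cyl T Ω)) := fun n =>
    memLp_one_iff_integrable.2 (integrable_timeAvgDist h₀ h₁ (hk0 n).le)
  let F : ℕ → Lp ℝ 1 (vol (cyl T Ω)) := fun n => (hi n).toLp _
  let b : ℕ → ℝ≥0∞ := fun n =>
    C * ∑ i, ∫⁻ z, ‖timeAvg T (k n) (h i) z - h i z‖ₑ ∂(vol (cyl T Ω))
  have hb0 : Tendsto b atTop (𝓝 0) := by
    have h1 : Tendsto (fun n => ∑ i, ∫⁻ z, ‖timeAvg T (k n) (h i) z - h i z‖ₑ ∂(vol (cyl T Ω)))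
        atTop (𝓝 (∑ _i : Fin d, 0)) :=
      tendsto_finsetSum _ fun i _ => (tendsto_lintegral_timeAvg hb (hh i)).comp hk
    rw [Finset.sum_const_zero] at h1
    simpa using ENNReal.Tendsto.const_mul h1 (Or.inr (ENNReal.coe_ne_top (r := C)))
  have hF : ∀ n m, edist (F n) (F m) ≤ b n + b m := by
    intro n m
    rw [Lp.edist_toLp_toLp, eLpNorm_one_eq_lintegral_enorm]
    refine (hC _ _ (hk0 n).le (hk0 m).le).trans ?_
    rw [← mul_add, ← Finset.sum_add_distrib]
    gcongr with i _
    have hm : AEMeasurable (fun z => ‖timeAvg T (k n) (h i) z - h i z‖ₑ) (vol (cyl T Ω)) :=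
      ((integrable_timeAvg (hh i) (hk0 n).le).sub (hh i)).aestronglyMeasurable.enorm
    rw [← lintegral_add_left' hm]
    refine lintegral_mono fun z => ?_
    rw [← edist_eq_enorm_sub, ← edist_eq_enorm_sub, ← edist_eq_enorm_sub]
    exact edist_triangle_right _ _ _
  have hcau : CauchySeq F := by
    refine EMetric.cauchySeq_iff.2 fun ε hε => ?_
    obtain ⟨N, hN⟩ := eventually_atTop.1 (hb0.eventually (Iio_mem_nhds (ENNReal.half_pos hε.ne')))
    refine ⟨N, fun m hm n hn => (hF m n).trans_lt ?_⟩
    rw [← ENNReal.add_halves ε]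
    exact ENNReal.add_lt_add (hN m hm) (hN n hn)
  obtain ⟨G, hG⟩ := cauchySeq_tendsto_of_complete hcau
  have hGi : Integrable G (vol (cyl T Ω)) := memLp_one_iff_integrable.1 (Lp.memLp G)
  have hrep : ∀ η : 𝓓(cyl T Ω, ℝ), ∫ z, u₀ z * η z ∂(vol (cyl T Ω))
      - ∫ z, u₁ z * fderiv ℝ η z (dirT d) ∂(vol (cyl T Ω))
        = ∫ z, G z * η z ∂(vol (cyl T Ω)) := by
    intro η
    refine tendsto_nhds_unique ((tendsto_integral_timeAvgDist_mul h₀ h₁ η).comp hk) ?_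
    obtain ⟨B, hB⟩ := η.continuous.bounded_above_of_compact_support η.hasCompactSupport
    refine tendsto_integral_of_L1 _ ?_ (Eventually.of_forall fun n => ?_) ?_
    · exact (integrable_mul_testFunction (IntegrableOn.locallyIntegrableOn hGi) η).1
    · exact integrable_mul_testFunction (IntegrableOn.locallyIntegrableOn
        (memLp_one_iff_integrable.1 (hi n))) η
    · have h1 : Tendsto (fun n => edist (F n) G * ENNReal.ofReal B) atTop (𝓝 0) := by
        have := ENNReal.Tendsto.mul_const (tendsto_iff_edist_tendsto_0.1 hG)
          (Or.inr (ENNReal.ofReal_ne_top (r := B)))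
        simpa using this
      refine tendsto_of_tendsto_of_tendsto_of_le_of_le tendsto_const_nhds h1 (fun _ => zero_le)
        fun n => ?_
      have e1 : edist (F n) G = ∫⁻ z, ‖timeAvgDist T (k n) u₀ u₁ z - G z‖ₑ ∂(vol (cyl T Ω)) := by
        rw [Lp.edist_def, eLpNorm_one_eq_lintegral_enorm]
        refine lintegral_congr_ae ?_
        filter_upwards [(hi n).coeFn_toLp] with z hz
        simp only [Pi.sub_apply, F]
        rw [hz]
      change _ ≤ edist (F n) G * ENNReal.ofReal B
      rw [e1, ← lintegral_mul_const' _ _ ENNReal.ofReal_ne_top]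
      refine lintegral_mono fun z => ?_
      rw [← sub_mul, enorm_mul]
      gcongr
      rw [← ofReal_norm]
      exact ENNReal.ofReal_le_ofReal (hB z)
  refine ⟨G, hGi, hrep, ae_all_iff.2 fun i => ?_⟩
  refine HasWeakDeriv.slice hb hGi (hh i) fun φ => ?_
  rw [← hgrad i φ]
  have := hrep (∂_{(dirX i : ℝ × Sp d)} φ)
  simp only [lineDeriv_testFunction_apply] at this
  exact this.symm

end PressureFunction

/-! ### Variable exponents and the Sobolev embedding -/

section Bootstrap

variable {d : ℕ} {Ω : Opens (Sp d)}

lemma ennreal_rpow_le_one_add {a : ℝ≥0∞} {p q : ℝ} (hp : 0 ≤ p) (hpq : p ≤ q) :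
    a ^ p ≤ 1 + a ^ q := by
  rcases le_total a 1 with h | h
  · exact (ENNReal.rpow_le_one h hp).trans le_self_add
  · exact (ENNReal.rpow_le_rpow_of_exponent_le h hpq).trans le_add_self

lemma lintegral_rpow_lt_top_mono {X : Type*} [MeasurableSpace X] {μ : Measure X}
    [IsFiniteMeasure μ] {u : X → ℝ≥0∞} {p q : X → ℝ} (hp : ∀ᵐ x ∂μ, 0 ≤ p x)
    (hpq : ∀ᵐ x ∂μ, p x ≤ q x) (h : ∫⁻ x, u x ^ q x ∂μ < ∞) : ∫⁻ x, u x ^ p x ∂μ < ∞ := by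
  calc ∫⁻ x, u x ^ p x ∂μ ≤ ∫⁻ x, (1 + u x ^ q x) ∂μ := lintegral_mono_ae (by
        filter_upwards [hp, hpq] with x h1 h2 using ennreal_rpow_le_one_add h1 h2)
    _ = ∫⁻ _, 1 ∂μ + ∫⁻ x, u x ^ q x ∂μ := lintegral_add_left measurable_const _
    _ < ∞ := ENNReal.add_lt_top.2 ⟨by simp [measure_lt_top], h⟩

/-- One step of the bootstrap, from integrability `min (s x) r` to `min (s x) (5 / 4 * r)`: near each
point, the exponent oscillates less than the Sobolev embedding gains. -/
lemma lintegral_rpow_min_lt_top_step (hd : d = 2 ∨ d = 3) (hb : Bornology.IsBounded (Ω : Set (Sp d)))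
    (hL : HasLipschitzBoundary (Ω : Set (Sp d))) {s : Sp d → ℝ}
    (hs : ContinuousOn s (closure Ω)) (hs1 : ∀ x ∈ Ω, 1 ≤ s x)
    {u : Sp d → ℝ} {Du : Fin d → Sp d → ℝ} (h : HasWeakGrad Ω u Du)
    (hDu : ∀ i, ∫⁻ x, ‖Du i x‖ₑ ^ s x ∂(vol Ω) < ∞) {r : ℝ} (hr : 1 ≤ r)
    (hu : ∫⁻ x, ‖u x‖ₑ ^ min (s x) r ∂(vol Ω) < ∞) :
    ∫⁻ x, ‖u x‖ₑ ^ min (s x) (5 / 4 * r) ∂(vol Ω) < ∞ := by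
  have hfin := isFiniteMeasure_vol hb
  have hcomp : IsCompact (closure (Ω : Set (Sp d))) := hb.isCompact_closure
  suffices H : ∫⁻ x in closure (Ω : Set (Sp d)) ∩ Ω, ‖u x‖ₑ ^ min (s x) (5 / 4 * r) < ∞ by
    rwa [inter_eq_right.2 subset_closure] at H
  refine hcomp.induction_on (p := fun S => ∫⁻ x in S ∩ Ω, ‖u x‖ₑ ^ min (s x) (5 / 4 * r) < ∞)
    (by simp) (fun S S' hS h' => (lintegral_mono_set (inter_subset_inter_left _ hS)).trans_lt h')
    (fun S S' h1 h2 => ?_) fun x₀ hx₀ => ?_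
  · rw [union_inter_distrib_right]
    exact (lintegral_union_le _ _ _).trans_lt (ENNReal.add_lt_top.2 ⟨h1, h2⟩)
  obtain ⟨N, hxN, s₀, hs₀, b, hbN, -⟩ := exists_inward_basis hL hx₀
  obtain ⟨ρ₁, hρ₁, hN⟩ := Metric.isOpen_iff.1 N.isOpen x₀ hxN
  obtain ⟨ρ₂, hρ₂, hosc⟩ := Metric.continuousOn_iff.1 hs x₀ hx₀ (1 / 10) (by norm_num)
  set ρ := min ρ₁ ρ₂ with hρ
  have hρ0 : 0 < ρ := lt_min hρ₁ hρ₂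
  set U : Opens (Sp d) := oball x₀ ρ ⊓ Ω with hU
  set A : Opens (Sp d) := oball x₀ (ρ / 2) ⊓ Ω with hA
  set M := ∑ i, ‖b i‖ + 1 with hM
  have hM0 : 0 < M := by positivity
  have hbM : ∀ i, ‖b i‖ ≤ M := fun i => by
    have := Finset.single_le_sum (f := fun i => ‖b i‖) (fun i _ => norm_nonneg _)
      (Finset.mem_univ i)
    linarith
  set s₁ := min s₀ (ρ / (4 * M)) with hs₁
  have hs₁0 : 0 < s₁ := lt_min hs₀ (by positivity)
  have hUΩ : U ≤ Ω := inf_le_right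
  have hslide : ∀ i, Slides (A : Set (Sp d)) U s₁ (b i) := by
    rintro i x ⟨hx1, hx2⟩ τ ⟨hτ0, hτ⟩
    have hx1' : dist x x₀ < ρ / 2 := hx1
    have h1 := hbN i x ⟨hN (by
      rw [Metric.mem_ball]; linarith [min_le_left ρ₁ ρ₂]), hx2⟩ τ ⟨hτ0, hτ.trans (min_le_left _ _)⟩
    refine ⟨?_, h1⟩
    have h2 : ‖τ • b i‖ ≤ ρ / 4 := by
      rw [norm_smul, Real.norm_eq_abs, abs_of_nonneg hτ0]
      calc τ * ‖b i‖ ≤ ρ / (4 * M) * M :=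
            mul_le_mul (hτ.trans (min_le_right _ _)) (hbM i) (norm_nonneg _) (by positivity)
        _ = ρ / 4 := by field_simp
    change dist (x + τ • b i) x₀ < ρ
    rw [dist_eq_norm] at hx1' ⊢
    calc ‖x + τ • b i - x₀‖ = ‖(x - x₀) + τ • b i‖ := by congr 1; abel
      _ ≤ ‖x - x₀‖ + ‖τ • b i‖ := norm_add_le _ _
      _ < ρ := by linarith
  -- a constant exponent below `min s r` on `U`, less the oscillation
  set r₀ := max 1 (min (s x₀) r - 1 / 10) with hr₀
  have hr₀1 : 1 ≤ r₀ := le_max_left _ _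
  have hs₀' : ∀ x ∈ U, |s x - s x₀| < 1 / 10 := by
    rintro x ⟨hx1, hx2⟩
    exact hosc x (subset_closure hx2) (lt_of_lt_of_le (show dist x x₀ < ρ from hx1) (min_le_right _ _))
  have hosc' : ∀ x ∈ U, |min (s x) r - min (s x₀) r| ≤ 1 / 10 := by
    intro x hx
    have h1 := abs_min_sub_min_le_max (s x) r (s x₀) r
    rw [sub_self, abs_zero, max_eq_left (abs_nonneg _)] at h1
    exact h1.trans (hs₀' x hx).le
  have hlow : ∀ x ∈ U, r₀ ≤ min (s x) r := by
    intro x hx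
    refine max_le (le_min (hs1 x (hUΩ hx)) hr) ?_
    linarith [(abs_le.1 (hosc' x hx)).1]
  have hup : ∀ x ∈ U, min (s x) (5 / 4 * r) ≤ r₀ * (Fintype.card (Fin d) /
      (Fintype.card (Fin d) - 1) : ℝ) := by
    intro x hx
    have h1 := (abs_le.1 (hosc' x hx)).2
    have h2 : min (s x₀) r - 1 / 10 ≤ r₀ := le_max_right _ _
    have h3 : min (s x) (5 / 4 * r) ≤ 5 / 4 * min (s x) r := by
      rcases le_total (s x) r with h4 | h4
      · rw [min_eq_left h4]
        exact (min_le_left _ _).trans (by linarith [hs1 x (hUΩ hx)])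
      · rw [min_eq_right h4]
        exact min_le_right _ _
    -- in dimension two and three the Sobolev gain is at least `3 / 2`
    have h4 : (3 / 2 : ℝ) ≤ (Fintype.card (Fin d) / (Fintype.card (Fin d) - 1) : ℝ) := by
      rw [Fintype.card_fin]
      rcases hd with rfl | rfl <;> norm_num
    nlinarith
  have hwd : ∀ i, HasWeakDeriv U u (fun x => ∑ j, b i j * Du j x) (b i) := fun i =>
    (HasWeakGrad.hasWeakDeriv h (h ⟨0, by omega⟩).1 (b i)).mono hUΩ
  have hmU : MeasurableSet (U : Set (Sp d)) := U.isOpen.measurableSet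
  have hfU : IsFiniteMeasure (vol U) := isFiniteMeasure_vol (hb.subset hUΩ)
  have hr0U : ∀ {w : Sp d → ℝ} {σ : Sp d → ℝ}, (∀ x ∈ U, r₀ ≤ σ x) →
      ∫⁻ x, ‖w x‖ₑ ^ σ x ∂(vol Ω) < ∞ → ∫⁻ x, ‖w x‖ₑ ^ r₀ ∂(vol U) < ∞ := by
    intro w σ hσ hw
    refine lintegral_rpow_lt_top_mono (p := fun _ => r₀) (q := σ)
      (ae_of_all _ fun _ => by linarith) ?_ ((lintegral_mono_set hUΩ).trans_lt hw)
    filter_upwards [ae_restrict_mem hmU] with x hx using hσ x hx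
  have hgain := lintegral_rpow_lt_top_of_slides (by rw [Fintype.card_fin]; omega) b hr₀1 hs₁0 hwd hslide
    (hr0U hlow hu) fun i => by
      have hr' : ENNReal.ofReal r₀ ≠ 0 := by simp; linarith
      have hrt : (ENNReal.ofReal r₀).toReal = r₀ := ENNReal.toReal_ofReal (by linarith)
      have hj : ∀ j, MemLp (fun x => b i j * Du j x) (ENNReal.ofReal r₀) (vol U) := fun j => by
        refine MemLp.const_mul ⟨((h j).mono hUΩ).2.1.aestronglyMeasurable, ?_⟩ _
        rw [eLpNorm_lt_top_iff_lintegral_rpow_enorm_lt_top hr' ENNReal.ofReal_ne_top, hrt]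
        exact hr0U (fun x hx => (hlow x hx).trans (min_le_left _ _)) (hDu j)
      have := (memLp_finsetSum (Finset.univ : Finset (Fin d)) fun j _ => hj j).2
      rw [eLpNorm_lt_top_iff_lintegral_rpow_enorm_lt_top hr' ENNReal.ofReal_ne_top, hrt] at this
      exact this
  refine ⟨Metric.ball x₀ (ρ / 2), mem_nhdsWithin_of_mem_nhds (Metric.ball_mem_nhds _ (by positivity)), ?_⟩
  have hAU : A ≤ U := inf_le_inf_right _ (Metric.ball_subset_ball (by linarith))
  have hfA : IsFiniteMeasure (vol A) := isFiniteMeasure_vol (hb.subset inf_le_right)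
  refine lintegral_rpow_lt_top_mono (μ := vol A) ?_ ?_ hgain
  · filter_upwards [ae_restrict_mem A.isOpen.measurableSet] with x hx
    exact le_min (by linarith [hs1 x hx.2]) (by linarith)
  · filter_upwards [ae_restrict_mem A.isOpen.measurableSet] with x hx
    exact hup x (hAU hx)

/-- A function on a bounded Lipschitz domain whose weak gradient lies in `L^{s(·)}` lies itself in
`L^{s(·)}`, for a continuous exponent `s` with values in `[1, 2]`. -/
theorem lintegral_rpow_lt_top_of_hasWeakGrad (hd : d = 2 ∨ d = 3)
    (hb : Bornology.IsBounded (Ω : Set (Sp d))) (hL : HasLipschitzBoundary (Ω : Set (Sp d)))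
    {s : Sp d → ℝ} (hs : ContinuousOn s (closure Ω)) (hs1 : ∀ x ∈ Ω, 1 ≤ s x)
    (hs2 : ∀ x ∈ Ω, s x ≤ 2) {u : Sp d → ℝ} {Du : Fin d → Sp d → ℝ} (h : HasWeakGrad Ω u Du)
    (hu : Integrable u (vol Ω)) (hDu : ∀ i, ∫⁻ x, ‖Du i x‖ₑ ^ s x ∂(vol Ω) < ∞) :
    ∫⁻ x, ‖u x‖ₑ ^ s x ∂(vol Ω) < ∞ := by
  have key : ∀ n : ℕ, ∫⁻ x, ‖u x‖ₑ ^ min (s x) ((5 / 4) ^ n) ∂(vol Ω) < ∞ := by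
    intro n
    induction n with
    | zero =>
      refine lt_of_eq_of_lt (setLIntegral_congr_fun Ω.isOpen.measurableSet fun x hx => ?_) hu.2
      rw [pow_zero, min_eq_right (hs1 x hx), ENNReal.rpow_one]
    | succ n ih =>
      rw [pow_succ']
      exact lintegral_rpow_min_lt_top_step hd hb hL hs hs1 h hDu (one_le_pow₀ (by norm_num)) ih
  refine lt_of_eq_of_lt (setLIntegral_congr_fun Ω.isOpen.measurableSet fun x hx => ?_) (key 4)
  -- `2 ≤ (5 / 4) ^ 4`
  rw [min_eq_left ((hs2 x hx).trans (by norm_num))]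

end Bootstrap

/-! ### Pointwise estimates for powers with two exponents -/

section Pointwise

/-- Two powers of the same base with different exponents. The factor `b ^ e₂` on the right belongs to
the minuend, so that no case distinction `b ≤ 1` or `b ≥ 1` is needed. -/
lemma rpow_sub_rpow_le {b e₁ e₂ : ℝ} (hb : 0 < b) :
    b ^ e₂ - b ^ e₁ ≤ |e₂ - e₁| * |Real.log b| * b ^ e₂ := by
  have h1 : Real.log b * e₁ - Real.log b * e₂ + 1 ≤ Real.exp (Real.log b * e₁ - Real.log b * e₂) :=
    Real.add_one_le_exp _
  have h2 : b ^ e₁ = b ^ e₂ * Real.exp (Real.log b * e₁ - Real.log b * e₂) := by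
    rw [Real.rpow_def_of_pos hb, Real.rpow_def_of_pos hb, ← Real.exp_add]
    congr 1; ring
  have h3 : 0 < b ^ e₂ := Real.rpow_pos_of_pos hb _
  have h4 : (e₂ - e₁) * Real.log b ≤ |e₂ - e₁| * |Real.log b| := by
    rw [← abs_mul]; exact le_abs_self _
  nlinarith

/-- A positive lower bound for the weights `(δ + x) ^ ((p - 2) / 2)`, `2 ≤ p ≤ P`. -/
lemma exists_weight_lower_bound {P δ : ℝ} (hδ : 0 < δ) :
    ∃ c : ℝ, 0 < c ∧ ∀ p ∈ Icc 2 P, ∀ x : ℝ, 0 ≤ x → c ≤ (δ + x) ^ ((p - 2) / 2) := by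
  refine ⟨min 1 δ ^ ((P - 2) / 2), Real.rpow_pos_of_pos (lt_min one_pos hδ) _, fun p hp x hx => ?_⟩
  have h0 : 0 < min 1 δ := lt_min one_pos hδ
  calc min 1 δ ^ ((P - 2) / 2) ≤ min 1 δ ^ ((p - 2) / 2) :=
        Real.rpow_le_rpow_of_exponent_ge h0 (min_le_left _ _) (by linarith [hp.2])
    _ ≤ (δ + x) ^ ((p - 2) / 2) :=
        Real.rpow_le_rpow h0.le ((min_le_right _ _).trans (by linarith)) (by linarith [hp.1])

lemma exists_log_le {δ ε c : ℝ} (hδ : 0 < δ) (hε : 0 < ε) (hc : 0 < c) :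
    ∃ C : ℝ, 0 ≤ C ∧ ∀ x y : ℝ, 0 ≤ x → c * x ≤ y → |Real.log (δ + x)| ≤ C * (1 + y) ^ ε := by
  refine ⟨|Real.log δ| + (δ + c⁻¹) ^ ε / ε, by positivity, fun x y hx hxy => ?_⟩
  have hy : 0 ≤ y := le_trans (by positivity) hxy
  have h1 : 1 ≤ (1 + y) ^ ε := Real.one_le_rpow (by linarith) hε.le
  have h2 : δ + x ≤ (δ + c⁻¹) * (1 + y) := by
    have : x ≤ c⁻¹ * y := by rw [inv_mul_eq_div, le_div_iff₀ hc]; linarith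
    have h3 : 0 < c⁻¹ := by positivity
    nlinarith [mul_nonneg hδ.le hy]
  have h3 : Real.log (δ + x) ≤ (δ + c⁻¹) ^ ε / ε * (1 + y) ^ ε := by
    calc Real.log (δ + x) ≤ (δ + x) ^ ε / ε := Real.log_le_rpow_div (by positivity) hε
      _ ≤ ((δ + c⁻¹) * (1 + y)) ^ ε / ε := by gcongr
      _ = _ := by rw [Real.mul_rpow (by positivity) (by positivity)]; ring
  have h4 : Real.log δ ≤ Real.log (δ + x) := Real.log_le_log hδ (by linarith)
  have h5 : |Real.log δ| ≤ |Real.log δ| * (1 + y) ^ ε := le_mul_of_one_le_right (abs_nonneg _) h1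
  have h6 : 0 ≤ (δ + c⁻¹) ^ ε / ε * (1 + y) ^ ε := by positivity
  rw [abs_le]
  constructor
  · linarith [neg_abs_le (Real.log δ)]
  · linarith [abs_nonneg (Real.log δ)]

variable {E : Type*} [NormedAddCommGroup E] [NormedSpace ℝ E]

/-- Differences of `A` and of the stress `a² A`, where `a = (δ + |A|) ^ ((p - 2) / 2)`, in terms of
differences of `a A`, for two different exponents `p`. -/
theorem exists_norm_sub_le {P δ ε : ℝ} (hδ : 0 < δ) (hε : 0 < ε) :
    ∃ C : ℝ, 0 ≤ C ∧ ∀ p₁ ∈ Icc 2 P, ∀ p₂ ∈ Icc 2 P, ∀ (A₁ A₂ F₁ F₂ : E) (a₁ a₂ R : ℝ),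
      a₁ = (δ + ‖A₁‖) ^ ((p₁ - 2) / 2) → a₂ = (δ + ‖A₂‖) ^ ((p₂ - 2) / 2) →
      F₁ = a₁ • A₁ → F₂ = a₂ • A₂ →
      R = ‖F₁ - F₂‖ + |p₁ - p₂| * ((1 + ‖F₁‖) ^ (1 + ε) + (1 + ‖F₂‖) ^ (1 + ε)) →
      ‖A₁ - A₂‖ ≤ C * R ∧ ‖a₁ • F₁ - a₂ • F₂‖ ≤ C * ((a₁ + a₂) * R) := by
  obtain ⟨c, hc, hcw⟩ := exists_weight_lower_bound (P := P) hδ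
  obtain ⟨K, hK, hlog⟩ := exists_log_le hδ hε hc
  -- it suffices to consider `‖A₂‖ ≤ ‖A₁‖`
  have key : ∀ p₁ ∈ Icc 2 P, ∀ p₂ ∈ Icc 2 P, ∀ (A₁ A₂ F₁ F₂ : E) (a₁ a₂ R : ℝ), ‖A₂‖ ≤ ‖A₁‖ →
      a₁ = (δ + ‖A₁‖) ^ ((p₁ - 2) / 2) → a₂ = (δ + ‖A₂‖) ^ ((p₂ - 2) / 2) →
      F₁ = a₁ • A₁ → F₂ = a₂ • A₂ →
      R = ‖F₁ - F₂‖ + |p₁ - p₂| * ((1 + ‖F₁‖) ^ (1 + ε) + (1 + ‖F₂‖) ^ (1 + ε)) →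
      ‖A₁ - A₂‖ ≤ (1 + K) * (2 / c + 2) * R ∧
        ‖a₁ • F₁ - a₂ • F₂‖ ≤ (1 + K) * (2 / c + 2) * ((a₁ + a₂) * R) := by
    intro p₁ hp₁ p₂ hp₂ A₁ A₂ F₁ F₂ a₁ a₂ R hA ha₁ ha₂ hF₁ hF₂ hR
    have hca₁ : c ≤ a₁ := ha₁ ▸ hcw p₁ hp₁ _ (norm_nonneg _)
    have hca₂ : c ≤ a₂ := ha₂ ▸ hcw p₂ hp₂ _ (norm_nonneg _)
    have ha₁0 : 0 < a₁ := hc.trans_le hca₁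
    have ha₂0 : 0 < a₂ := hc.trans_le hca₂
    have nF₁ : ‖F₁‖ = a₁ * ‖A₁‖ := by rw [hF₁, norm_smul, Real.norm_eq_abs, abs_of_pos ha₁0]
    have nF₂ : ‖F₂‖ = a₂ * ‖A₂‖ := by rw [hF₂, norm_smul, Real.norm_eq_abs, abs_of_pos ha₂0]
    have hL1 : 0 ≤ (1 + ‖F₁‖) ^ (1 + ε) := by positivity
    have hR0 : 0 ≤ R := by rw [hR]; positivity
    have hFR : ‖F₁ - F₂‖ ≤ R := by rw [hR]; exact le_add_of_nonneg_right (by positivity)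
    -- if `a₂ ≤ a₁`, the norms alone give the bound; otherwise only the change of the exponent can
    -- make `a₂` larger than `a₁`
    have hx : ‖A₂‖ * |a₁ - a₂| ≤ (1 + K) * R := by
      rcases le_total a₂ a₁ with h | h
      · rw [abs_of_nonneg (by linarith)]
        have h1 : ‖F₁‖ - ‖F₂‖ ≤ ‖F₁ - F₂‖ := norm_sub_norm_le _ _
        rw [nF₁, nF₂] at h1
        have h2 : a₁ * ‖A₂‖ ≤ a₁ * ‖A₁‖ := by gcongr
        nlinarith [mul_nonneg hK hR0]
      · rw [abs_of_nonpos (by linarith), neg_sub]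
        have hb : 0 < δ + ‖A₂‖ := by positivity
        have h1 : (δ + ‖A₂‖) ^ ((p₁ - 2) / 2) ≤ a₁ := by
          rw [ha₁]
          exact Real.rpow_le_rpow hb.le (by linarith) (by linarith [hp₁.1])
        have h2 := rpow_sub_rpow_le (e₁ := (p₁ - 2) / 2) (e₂ := (p₂ - 2) / 2) hb
        rw [← ha₂] at h2
        have h3 : |(p₂ - 2) / 2 - (p₁ - 2) / 2| ≤ |p₁ - p₂| := by
          rw [show (p₂ - 2) / 2 - (p₁ - 2) / 2 = -((p₁ - p₂) / 2) by ring, abs_neg, abs_div, abs_two]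
          linarith [abs_nonneg (p₁ - p₂)]
        have h4 := hlog ‖A₂‖ ‖F₂‖ (norm_nonneg _) (by rw [nF₂]; gcongr)
        calc ‖A₂‖ * (a₂ - a₁)
            ≤ ‖A₂‖ * (|(p₂ - 2) / 2 - (p₁ - 2) / 2| * |Real.log (δ + ‖A₂‖)| * a₂) := by
              gcongr; linarith
          _ ≤ ‖A₂‖ * (|p₁ - p₂| * (K * (1 + ‖F₂‖) ^ ε) * a₂) := by gcongr
          _ = K * (|p₁ - p₂| * ((1 + ‖F₂‖) ^ ε * ‖F₂‖)) := by rw [nF₂]; ring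
          _ ≤ K * (|p₁ - p₂| * ((1 + ‖F₁‖) ^ (1 + ε) + (1 + ‖F₂‖) ^ (1 + ε))) := by
              gcongr
              have h5 : (1 + ‖F₂‖) ^ (1 + ε) = (1 + ‖F₂‖) ^ ε * (1 + ‖F₂‖) := by
                rw [Real.rpow_add (by positivity), Real.rpow_one, mul_comm]
              rw [h5]
              have h6 : 0 ≤ (1 + ‖F₂‖) ^ ε := by positivity
              linarith
          _ ≤ K * R := by
              gcongr
              rw [hR]
              exact le_add_of_nonneg_left (norm_nonneg _)
          _ ≤ (1 + K) * R := by gcongr; linarith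
    have hcc : 0 < 2 / c := by positivity
    have hKR : 0 ≤ K * R := mul_nonneg hK hR0
    constructor
    · have e : a₁ • (A₁ - A₂) = (F₁ - F₂) + (a₂ - a₁) • A₂ := by rw [hF₁, hF₂]; module
      have h1 : a₁ * ‖A₁ - A₂‖ ≤ R + (1 + K) * R := by
        rw [← abs_of_pos ha₁0, ← Real.norm_eq_abs, ← norm_smul, e]
        refine (norm_add_le _ _).trans (add_le_add hFR ?_)
        rw [norm_smul, Real.norm_eq_abs, abs_sub_comm, mul_comm]
        exact hx
      have h2 : c * ‖A₁ - A₂‖ ≤ 2 * ((1 + K) * R) := by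
        have : c * ‖A₁ - A₂‖ ≤ a₁ * ‖A₁ - A₂‖ := by gcongr
        linarith
      have h3 : ‖A₁ - A₂‖ ≤ 2 / c * ((1 + K) * R) := by
        rw [div_mul_eq_mul_div, le_div_iff₀ hc]; linarith
      have h4 : 0 ≤ (1 + K) * R := by positivity
      linarith
    · have e : a₁ • F₁ - a₂ • F₂ = a₁ • (F₁ - F₂) + (a₁ - a₂) • F₂ := by module
      have h1 : ‖a₁ • F₁ - a₂ • F₂‖ ≤ a₁ * R + a₂ * ((1 + K) * R) := by
        rw [e]
        refine (norm_add_le _ _).trans (add_le_add ?_ ?_)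
        · rw [norm_smul, Real.norm_eq_abs, abs_of_pos ha₁0]
          gcongr
        · rw [norm_smul, Real.norm_eq_abs, nF₂]
          calc |a₁ - a₂| * (a₂ * ‖A₂‖) = a₂ * (‖A₂‖ * |a₁ - a₂|) := by ring
            _ ≤ _ := by gcongr
      have h2 : 0 ≤ a₁ * (K * R) := by positivity
      have h3 : 0 ≤ (1 + K) * ((a₁ + a₂) * R) := by positivity
      have h4 : 0 ≤ 2 / c * ((1 + K) * ((a₁ + a₂) * R)) := by positivity
      linarith
  refine ⟨(1 + K) * (2 / c + 2), by positivity, ?_⟩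
  intro p₁ hp₁ p₂ hp₂ A₁ A₂ F₁ F₂ a₁ a₂ R ha₁ ha₂ hF₁ hF₂ hR
  rcases le_total ‖A₂‖ ‖A₁‖ with h | h
  · exact key p₁ hp₁ p₂ hp₂ A₁ A₂ F₁ F₂ a₁ a₂ R h ha₁ ha₂ hF₁ hF₂ hR
  · rw [norm_sub_rev A₁, norm_sub_rev (a₁ • F₁), add_comm a₁]
    refine key p₂ hp₂ p₁ hp₁ A₂ A₁ F₂ F₁ a₂ a₁ R h ha₂ ha₁ hF₂ hF₁ ?_
    rw [hR, norm_sub_rev, abs_sub_comm, add_comm ((1 + ‖F₁‖) ^ (1 + ε))]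

end Pointwise

/-! ### The stress and the weight as functions of the tensor -/

section Tensors

variable {d : ℕ}

/-- A tensor as a vector in a Euclidean space, whose norm is the Frobenius norm `tnorm`. -/
noncomputable def tvec (A : Tensor d) : EuclideanSpace ℝ (Fin d × Fin d) :=
  WithLp.toLp 2 fun k => A k.1 k.2

@[simp] lemma tvec_apply (A : Tensor d) (k : Fin d × Fin d) : tvec A k = A k.1 k.2 := rfl

lemma norm_tvec (A : Tensor d) : ‖tvec A‖ = tnorm A := by
  rw [EuclideanSpace.norm_eq, tnorm, ddot, Fintype.sum_prod_type]
  simp [sq]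

lemma tvec_smul (c : ℝ) (A : Tensor d) : tvec (c • A) = c • tvec A := by
  ext k; simp

lemma tnorm_nonneg (A : Tensor d) : 0 ≤ tnorm A := Real.sqrt_nonneg _

lemma tsym_apply (A : Tensor d) (i j : Fin d) : tsym A i j = (A i j + A j i) / 2 := by
  simp [tsym]; ring

/-- The weight `(δ + |A^sym|) ^ ((p - 2) / 2)`. -/
noncomputable def weight (δ : ℝ) (p : ℝ × Sp d → ℝ) (z : ℝ × Sp d) (A : Tensor d) : ℝ :=
  (δ + tnorm (tsym A)) ^ ((p z - 2) / 2)

lemma weight_pos {δ : ℝ} (hδ : 0 < δ) (p : ℝ × Sp d → ℝ) (z : ℝ × Sp d) (A : Tensor d) :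
    0 < weight δ p z A := Real.rpow_pos_of_pos (by linarith [tnorm_nonneg (tsym A)]) _

lemma stress_eq {ν₀ δ : ℝ} (hδ : 0 < δ) (p : ℝ × Sp d → ℝ) (z : ℝ × Sp d) (A : Tensor d) :
    tvec (stress ν₀ δ p z A) = ν₀ • weight δ p z A • tvec (Fmap δ p z A) := by
  have h0 : 0 < δ + tnorm (tsym A) := by linarith [tnorm_nonneg (tsym A)]
  rw [stress, Fmap, tvec_smul, tvec_smul, smul_smul, smul_smul, weight, mul_assoc,
    ← Real.rpow_add h0]
  congr 3; ring

/-- Differences of the symmetric gradient and of the stress, componentwise. -/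
theorem exists_abs_stress_sub_le {P δ ε : ℝ} (ν₀ : ℝ) (hδ : 0 < δ) (hε : 0 < ε)
    (p : ℝ × Sp d → ℝ) :
    ∃ C : ℝ, 0 ≤ C ∧ ∀ z z' : ℝ × Sp d, p z ∈ Icc 2 P → p z' ∈ Icc 2 P → ∀ (A A' : Tensor d) (R : ℝ),
      R = ∑ k : Fin d × Fin d, |Fmap δ p z A k.1 k.2 - Fmap δ p z' A' k.1 k.2|
        + |p z - p z'| * ((1 + tnorm (Fmap δ p z A)) ^ (1 + ε)
            + (1 + tnorm (Fmap δ p z' A')) ^ (1 + ε)) →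
      ∀ i j, |tsym A i j - tsym A' i j| ≤ C * R ∧
        |stress ν₀ δ p z A i j - stress ν₀ δ p z' A' i j|
          ≤ C * ((weight δ p z A + weight δ p z' A') * R) := by
  obtain ⟨C, hC, h⟩ := exists_norm_sub_le (E := EuclideanSpace ℝ (Fin d × Fin d)) (P := P) hδ hε
  refine ⟨C + |ν₀| * C, by positivity, fun z z' hz hz' A A' R hR i j => ?_⟩
  obtain ⟨h1, h2⟩ := h (p z) hz (p z') hz' (tvec (tsym A)) (tvec (tsym A')) (tvec (Fmap δ p z A))
    (tvec (Fmap δ p z' A')) (weight δ p z A) (weight δ p z' A') _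
    (by rw [norm_tvec]; rfl) (by rw [norm_tvec]; rfl) (by rw [Fmap, tvec_smul]; rfl)
    (by rw [Fmap, tvec_smul]; rfl) rfl
  rw [norm_tvec, norm_tvec] at h1 h2
  have hsum : ‖tvec (Fmap δ p z A) - tvec (Fmap δ p z' A')‖
      ≤ ∑ k : Fin d × Fin d, |Fmap δ p z A k.1 k.2 - Fmap δ p z' A' k.1 k.2| := by
    have := norm_sum_le (E := EuclideanSpace ℝ (Fin d × Fin d)) Finset.univ
      fun k => (tvec (Fmap δ p z A) - tvec (Fmap δ p z' A')) k •
        (EuclideanSpace.single k (1 : ℝ) : EuclideanSpace ℝ (Fin d × Fin d))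
    refine le_trans (le_of_eq ?_) (this.trans (le_of_eq ?_))
    · congr 1
      ext k
      simp [Pi.single_apply]
    · simp [norm_smul]
  have hRR : ‖tvec (Fmap δ p z A) - tvec (Fmap δ p z' A')‖ + |p z - p z'| *
      ((1 + tnorm (Fmap δ p z A)) ^ (1 + ε) + (1 + tnorm (Fmap δ p z' A')) ^ (1 + ε)) ≤ R := by
    rw [hR]; gcongr
  have hR0 : 0 ≤ R := by
    refine le_trans ?_ hRR
    have := tnorm_nonneg (Fmap δ p z A)
    have := tnorm_nonneg (Fmap δ p z' A')
    positivity
  have w1 := weight_pos hδ p z A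
  have w2 := weight_pos hδ p z' A'
  constructor
  · have h3 := PiLp.norm_apply_le (tvec (tsym A) - tvec (tsym A')) (i, j)
    have h4 : |tsym A i j - tsym A' i j| ≤ C * R := by
      refine le_trans (le_of_eq ?_) (h3.trans (h1.trans (by gcongr)))
      simp
    refine h4.trans ?_
    have : 0 ≤ |ν₀| * C * R := by positivity
    linarith
  · have h3 := PiLp.norm_apply_le (tvec (stress ν₀ δ p z A) - tvec (stress ν₀ δ p z' A')) (i, j)
    have h4 : |stress ν₀ δ p z A i j - stress ν₀ δ p z' A' i j|
        ≤ |ν₀| * (C * ((weight δ p z A + weight δ p z' A') * R)) := by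
      refine le_trans (le_of_eq ?_) (h3.trans ?_)
      · simp
      · rw [stress_eq hδ, stress_eq hδ, ← smul_sub, norm_smul, Real.norm_eq_abs]
        gcongr
        exact h2.trans (by gcongr)
    refine h4.trans ?_
    have : 0 ≤ C * ((weight δ p z A + weight δ p z' A') * R) := by positivity
    linarith

end Tensors

/-! ### Square integrable functions -/

section L2

variable {X : Type*} [MeasurableSpace X] {μ : Measure X}

lemma sqrt_integral_sq {f : X → ℝ} (hf : MemLp f 2 μ) :
    √(∫ x, f x ^ 2 ∂μ) = (eLpNorm f 2 μ).toReal := by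
  rw [hf.eLpNorm_eq_integral_rpow_norm two_ne_zero ENNReal.ofNat_ne_top, Real.sqrt_eq_rpow,
    ENNReal.toReal_ofReal (by positivity)]
  simp

lemma integral_mul_le_sqrt {f g : X → ℝ} (hf : MemLp f 2 μ) (hg : MemLp g 2 μ) :
    ∫ x, ‖f x‖ * ‖g x‖ ∂μ ≤ √(∫ x, f x ^ 2 ∂μ) * √(∫ x, g x ^ 2 ∂μ) := by
  have := integral_mul_norm_le_Lp_mul_Lq Real.HolderConjugate.two_two
    (by simpa using hf) (by simpa using hg)
  refine this.trans (le_of_eq ?_)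
  rw [Real.sqrt_eq_rpow, Real.sqrt_eq_rpow]
  simp

lemma eLpNorm_two_le_of_lintegral_le {Y : Type*} [MeasurableSpace Y] {ν : Measure Y} {f : X → ℝ}
    {g : Y → ℝ} {s : ℝ} (h : ∫⁻ x, ‖f x‖ₑ ^ (2 : ℝ) ∂μ
      ≤ ENNReal.ofReal s ^ (2 : ℝ) * ∫⁻ y, ‖g y‖ₑ ^ (2 : ℝ) ∂ν) :
    eLpNorm f 2 μ ≤ ENNReal.ofReal s * eLpNorm g 2 ν := by
  rw [eLpNorm_eq_lintegral_rpow_enorm_toReal two_ne_zero ENNReal.ofNat_ne_top,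
    eLpNorm_eq_lintegral_rpow_enorm_toReal two_ne_zero ENNReal.ofNat_ne_top]
  simp only [ENNReal.toReal_ofNat]
  refine (ENNReal.rpow_le_rpow h (by norm_num)).trans (le_of_eq ?_)
  rw [ENNReal.mul_rpow_of_nonneg _ _ (by norm_num), ← ENNReal.rpow_mul]
  norm_num

end L2

/-! ### Weak derivatives from weighted increments -/

section Composition

variable {V : Type*} [NormedAddCommGroup V] [NormedSpace ℝ V] [FiniteDimensional ℝ V]
  [MeasureSpace V] [BorelSpace V] [(volume : Measure V).IsAddHaarMeasure]

/-- Near the support of a test function there is room for short translations. -/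
lemma exists_slides_of_testFunction {U : Opens V} (φ : 𝓓(U, ℝ)) (m : V) :
    ∃ A : Opens V, tsupport φ ⊆ A ∧ ∃ s₀ > 0, ∀ s ≤ s₀, Slides (A : Set V) U s m := by
  obtain ⟨ρ, hρ, hsub⟩ := φ.hasCompactSupport.isCompact.exists_cthickening_subset_open U.isOpen
    φ.tsupport_subset
  refine ⟨⟨Metric.thickening (ρ / 2) (tsupport φ), Metric.isOpen_thickening⟩,
    Metric.self_subset_thickening (by positivity) _, ρ / (2 * (‖m‖ + 1)), by positivity, ?_⟩
  intro s hs x hx τ hτ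
  obtain ⟨y, hy, hxy⟩ := Metric.mem_thickening_iff.1 hx
  refine hsub (Metric.thickening_subset_cthickening _ _ (Metric.mem_thickening_iff.2 ⟨y, hy, ?_⟩))
  have h1 : ‖τ • m‖ ≤ ρ / 2 := by
    rw [norm_smul, Real.norm_eq_abs, abs_of_nonneg hτ.1]
    calc τ * ‖m‖ ≤ ρ / (2 * (‖m‖ + 1)) * (‖m‖ + 1) :=
          mul_le_mul (hτ.2.trans hs) (by linarith) (norm_nonneg _) (by positivity)
      _ = ρ / 2 := by field_simp
  rw [dist_eq_norm] at hxy ⊢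
  calc ‖x + τ • m - y‖ = ‖(x - y) + τ • m‖ := by congr 1; abel
    _ ≤ ‖x - y‖ + ‖τ • m‖ := norm_add_le _ _
    _ < ρ := by linarith

lemma HasWeakDeriv.eLpNorm_diff_le {U A : Opens V} {u w : V → ℝ} {s : ℝ} {m : V}
    (h : HasWeakDeriv U u w m) (hs : 0 ≤ s) (hA : Slides (A : Set V) U s m) :
    eLpNorm (fun x => u (x + s • m) - u x) 2 (vol A)
      ≤ ENNReal.ofReal s * eLpNorm w 2 (vol U) :=
  eLpNorm_two_le_of_lintegral_le (h.lintegral_diff_rpow_le one_le_two hs hA)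

lemma eLpNorm_translate_le {U A : Opens V} {u : V → ℝ} {s : ℝ} {m : V} (hs : 0 ≤ s)
    (hA : Slides (A : Set V) U s m) :
    eLpNorm (fun x => u (x + s • m)) 2 (vol A) ≤ eLpNorm u 2 (vol U) := by
  have := eLpNorm_two_le_of_lintegral_le (f := fun x => u (x + s • m)) (g := u) (s := 1)
    (μ := vol A) (ν := vol U) (by
      rw [ENNReal.ofReal_one, ENNReal.one_rpow, one_mul]
      exact lintegral_slide_le hA ⟨hs, le_rfl⟩ fun x => ‖u x‖ₑ ^ (2 : ℝ))
  simpa using this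

lemma memLp_translate {U A : Opens V} [IsFiniteMeasure (vol U)] {u : V → ℝ} {s : ℝ} {m : V}
    (hu : MemLp u 2 (vol U)) (hs : 0 ≤ s) (hA : Slides (A : Set V) U s m) :
    MemLp (fun x => u (x + s • m)) 2 (vol A) :=
  ⟨(integrable_translate_vol (hu.integrable one_le_two) hs hA).aestronglyMeasurable,
    (eLpNorm_translate_le hs hA).trans_lt hu.2⟩

/-- Shift a difference from the test function to `u`. -/
lemma integral_mul_shift_sub {U A : Opens V} {u : V → ℝ} {s : ℝ} {m : V} (hs0 : 0 ≤ s)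
    (hA : Slides (A : Set V) U s m) (hul : LocallyIntegrableOn u (U : Set V)) {φ : 𝓓(U, ℝ)}
    (hφA : tsupport φ ⊆ A) :
    ∫ x, u x * (φ (x - s • m) - φ x) ∂(vol U) = ∫ x, (u (x + s • m) - u x) * φ x ∂(vol A) := by
  have hAU : (A : Set V) ⊆ U := hA.subset hs0
  let φ' : 𝓓(A, ℝ) := ⟨φ, φ.contDiff, φ.hasCompactSupport, hφA⟩
  have huA : LocallyIntegrableOn u (A : Set V) := hul.mono_set hAU
  have htl := locallyIntegrableOn_translate hs0 hA hul
  have hφ0 : ∀ x, x ∉ (A : Set V) → φ x = 0 := fun x hx =>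
    image_eq_zero_of_notMem_tsupport fun h => hx (hφA h)
  have hS : IsCompact (sweep (tsupport φ) s m) := isCompact_sweep φ.hasCompactSupport s m
  have h1 : ∫ x, u x * φ (x - s • m) ∂(vol U) = ∫ x, u (x + s • m) * φ x ∂(vol A) :=
    integral_mul_translate hs0 hA u φ'
  have h2 : ∫ x, u x * φ x ∂(vol U) = ∫ x, u x * φ x ∂(vol A) := by
    rw [integral_vol_eq, integral_vol_eq]
    · intro x hx; rw [hφ0 x hx, mul_zero]
    · intro x hx; rw [hφ0 x fun h => hx (hAU h), mul_zero]
  have i1 : Integrable (fun x => u x * φ (x - s • m)) (vol U) := by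
    refine (integrable_mul_of_compact (φ := fun x => φ (x - s • m)) hS
      (hul.integrableOn_compact_subset (hA.sweep_subset hφA) hS)
      (by have := φ.continuous; fun_prop) fun x hx => ?_).restrict
    refine image_eq_zero_of_notMem_tsupport fun h => hx ?_
    simpa using mem_sweep (m := m) h (τ := s) ⟨hs0, le_rfl⟩
  simp only [mul_sub, sub_mul]
  rw [integral_sub i1 (integrable_mul_testFunction hul φ), h1, h2]
  exact (integral_sub (integrable_mul_testFunction htl φ')
    (integrable_mul_testFunction huA φ')).symm

/-- A substitute for the chain rule: if the increments of `u` along `m` are controlled by those of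
functions `F i` with a weak derivative in `L²`, with a weight `a`, then `u` has a weak derivative of
the form `a κ` with `κ` in `L²`. -/
theorem HasWeakDeriv.exists_of_increments {ι : Type*} [Fintype ι] {U : Opens V}
    [IsFiniteMeasure (vol U)] {u a ℓ : V → ℝ} {F : ι → V → ℝ} {m : V}
    (hu : Integrable u (vol U)) (ha : MemLp a 2 (vol U)) (hℓ : MemLp ℓ 2 (vol U))
    (hF : ∀ i, ∃ w, HasWeakDeriv U (F i) w m ∧ MemLp w 2 (vol U))
    (hpt : ∀ z ∈ U, ∀ s : ℝ, 0 ≤ s → z + s • m ∈ U → |u (z + s • m) - u z| ≤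
      (a (z + s • m) + a z) * (∑ i, |F i (z + s • m) - F i z| + s * (ℓ (z + s • m) + ℓ z))) :
    ∃ κ : V → ℝ, MemLp κ 2 (vol U) ∧ HasWeakDeriv U u (fun x => a x * κ x) m := by
  choose w hw hw2 using hF
  set N : ℝ≥0∞ := ∑ i, eLpNorm (w i) 2 (vol U) + (eLpNorm ℓ 2 (vol U) + eLpNorm ℓ 2 (vol U)) with hN
  have hNt : N ≠ ∞ := ENNReal.add_ne_top.2 ⟨ENNReal.sum_ne_top.2 fun i _ => (hw2 i).2.ne,
    ENNReal.add_ne_top.2 ⟨hℓ.2.ne, hℓ.2.ne⟩⟩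
  refine HasWeakDeriv.exists_of_diff_bound (C := N.toReal) hu ha fun φ => ?_
  obtain ⟨A, hφA, s₀, hs₀, hslide⟩ := exists_slides_of_testFunction φ m
  filter_upwards [Ioc_mem_nhdsGT hs₀] with s hs
  have hs0 : 0 ≤ s := hs.1.le
  have hA := hslide s hs.2
  have hAU : (A : Set V) ⊆ U := hA.subset hs0
  let φ' : 𝓓(A, ℝ) := ⟨φ, φ.contDiff, φ.hasCompactSupport, hφA⟩
  have hul : LocallyIntegrableOn u (U : Set V) := IntegrableOn.locallyIntegrableOn hu
  have e1 := integral_mul_shift_sub hs0 hA hul hφA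
  set R : V → ℝ := fun x => ∑ i, |F i (x + s • m) - F i x| + s * (ℓ (x + s • m) + ℓ x) with hR
  have hle : vol A ≤ vol U := Measure.restrict_mono hAU le_rfl
  have mF : ∀ i, MemLp (fun x => |F i (x + s • m) - F i x|) 2 (vol A) := fun i => by
    have h1 : MemLp (fun x => F i (x + s • m) - F i x) 2 (vol A) :=
      ⟨((locallyIntegrableOn_translate hs0 hA (hw i).1).sub
        ((hw i).1.mono_set hAU)).aestronglyMeasurable,
        ((hw i).eLpNorm_diff_le hs0 hA).trans_lt (ENNReal.mul_lt_top ENNReal.ofReal_lt_top (hw2 i).2)⟩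
    exact h1.norm
  have mℓ1 : MemLp (fun x => ℓ (x + s • m)) 2 (vol A) := memLp_translate hℓ hs0 hA
  have mℓ2 : MemLp ℓ 2 (vol A) := hℓ.mono_measure hle
  have mS : MemLp (fun x => ∑ i, |F i (x + s • m) - F i x|) 2 (vol A) :=
    memLp_finsetSum _ fun i _ => mF i
  have mL : MemLp (fun x => s * (ℓ (x + s • m) + ℓ x)) 2 (vol A) := (mℓ1.add mℓ2).const_mul s
  have mR : MemLp R 2 (vol A) := mS.add mL
  have hRN : √(∫ x, R x ^ 2 ∂(vol A)) ≤ s * N.toReal := by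
    rw [sqrt_integral_sq mR]
    have h1 : eLpNorm R 2 (vol A) ≤ ENNReal.ofReal s * N := by
      calc eLpNorm R 2 (vol A)
          ≤ eLpNorm (fun x => ∑ i, |F i (x + s • m) - F i x|) 2 (vol A)
            + eLpNorm (fun x => s * (ℓ (x + s • m) + ℓ x)) 2 (vol A) :=
            eLpNorm_add_le mS.1 mL.1 one_le_two
        _ ≤ ENNReal.ofReal s * ∑ i, eLpNorm (w i) 2 (vol U)
            + ENNReal.ofReal s * (eLpNorm ℓ 2 (vol U) + eLpNorm ℓ 2 (vol U)) := by
            gcongr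
            · have h2 := eLpNorm_sum_le (f := fun i x => |F i (x + s • m) - F i x|)
                (s := Finset.univ) (μ := vol A) (p := 2) (fun i _ => (mF i).1) one_le_two
              rw [Finset.mul_sum]
              refine le_trans (le_of_eq ?_) (h2.trans (Finset.sum_le_sum fun i _ => ?_))
              · congr 1; ext x; simp [Finset.sum_apply]
              · refine le_trans (le_of_eq ?_) ((hw i).eLpNorm_diff_le hs0 hA)
                exact eLpNorm_norm (f := fun x => F i (x + s • m) - F i x)
            · have h3 : eLpNorm (fun x => s * (ℓ (x + s • m) + ℓ x)) 2 (vol A)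
                  = ‖s‖ₑ * eLpNorm (fun x => ℓ (x + s • m) + ℓ x) 2 (vol A) :=
                eLpNorm_const_smul s (fun x => ℓ (x + s • m) + ℓ x) 2 (vol A)
              rw [h3, Real.enorm_of_nonneg hs0]
              gcongr
              exact (eLpNorm_add_le mℓ1.1 mℓ2.1 one_le_two).trans (add_le_add
                (eLpNorm_translate_le hs0 hA) (eLpNorm_mono_measure _ hle))
        _ = ENNReal.ofReal s * N := by simp only [hN, mul_add]
    have h2 := ENNReal.toReal_mono (ENNReal.mul_ne_top ENNReal.ofReal_ne_top hNt) h1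
    rwa [ENNReal.toReal_mul, ENNReal.toReal_ofReal hs0] at h2
  have m1 : MemLp (fun x => a x * φ' x) 2 (vol A) :=
    memLp_mul_testFunction (ha.mono_measure hle) φ'
  have m2 : MemLp (fun x => a (x + s • m) * φ' x) 2 (vol A) :=
    memLp_mul_testFunction (memLp_translate ha hs0 hA) φ'
  have hle1 : √(∫ x, (a x * φ' x) ^ 2 ∂(vol A)) ≤ √(∫ x, (a x * φ x) ^ 2 ∂(vol U)) := by
    refine Real.sqrt_le_sqrt (integral_mono_measure hle (ae_of_all _ fun _ => sq_nonneg _) ?_)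
    exact (memLp_mul_testFunction ha φ).integrable_sq
  have hle2 : √(∫ x, (a (x + s • m) * φ' x) ^ 2 ∂(vol A))
      ≤ √(∫ x, (a x * φ (x - s • m)) ^ 2 ∂(vol U)) := by
    have m3 : MemLp (fun x => a x * φ (x - s • m)) 2 (vol U) := by
      have hc : Continuous fun x => φ (x - s • m) := by have := φ.continuous; fun_prop
      obtain ⟨B, hB⟩ := φ.continuous.bounded_above_of_compact_support φ.hasCompactSupport
      have := ha.mul (q := 2) (r := 2) (p := ∞)
        (memLp_top_of_bound (μ := vol U) hc.aestronglyMeasurable B (ae_of_all _ fun x => hB _))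
      exact this.ae_eq (ae_of_all _ fun x => by simp [mul_comm])
    rw [sqrt_integral_sq m2, sqrt_integral_sq m3]
    refine ENNReal.toReal_mono m3.2.ne ?_
    have := eLpNorm_translate_le (u := fun x => a x * φ (x - s • m)) hs0 hA
    simp only [add_sub_cancel_right] at this
    exact this
  have i1 := (m1.norm.integrable_mul mR.norm)
  have i2 := (m2.norm.integrable_mul mR.norm)
  rw [e1]
  calc |∫ x, (u (x + s • m) - u x) * φ x ∂(vol A)|
      ≤ ∫ x, (‖a (x + s • m) * φ' x‖ * ‖R x‖ + ‖a x * φ' x‖ * ‖R x‖) ∂(vol A) := by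
        rw [← Real.norm_eq_abs]
        refine norm_integral_le_of_norm_le (i2.add i1) ?_
        filter_upwards [ae_restrict_mem A.isOpen.measurableSet] with x hx
        have h1 := hpt x (hAU hx) s hs0 (hA x hx s ⟨hs0, le_rfl⟩)
        have h2 : (a (x + s • m) + a x) * R x ≤ (|a (x + s • m)| + |a x|) * |R x| := by
          refine (le_abs_self _).trans ?_
          rw [abs_mul]
          gcongr
          exact abs_add_le _ _
        rw [norm_mul, norm_mul, norm_mul, Real.norm_eq_abs, Real.norm_eq_abs, Real.norm_eq_abs,
          Real.norm_eq_abs, Real.norm_eq_abs]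
        calc |u (x + s • m) - u x| * |φ x| ≤ ((|a (x + s • m)| + |a x|) * |R x|) * |φ x| := by
              gcongr; exact h1.trans h2
          _ = |a (x + s • m)| * |φ' x| * |R x| + |a x| * |φ' x| * |R x| := by
              change _ = |a (x + s • m)| * |φ x| * |R x| + |a x| * |φ x| * |R x|
              ring
    _ = ∫ x, ‖a (x + s • m) * φ' x‖ * ‖R x‖ ∂(vol A) + ∫ x, ‖a x * φ' x‖ * ‖R x‖ ∂(vol A) :=
        integral_add i2 i1
    _ ≤ √(∫ x, (a x * φ (x - s • m)) ^ 2 ∂(vol U)) * (s * N.toReal)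
          + √(∫ x, (a x * φ x) ^ 2 ∂(vol U)) * (s * N.toReal) := by
        gcongr
        · exact (integral_mul_le_sqrt m2 mR).trans (by gcongr)
        · exact (integral_mul_le_sqrt m1 mR).trans (by gcongr)
    _ = _ := by ring

end Composition

/-! ### The Sobolev embedding on the space-time cylinder -/

section SpaceTimeEmbedding

variable {d : ℕ} {T : ℝ} {Ω : Opens (Sp d)}

lemma sum_smul_dirX (e : Sp d) : ∑ j, e j • (dirX j : ℝ × Sp d) = (0, e) := by
  have h := sum_smul_stdVec e
  refine Prod.ext ?_ ?_
  · simp [Prod.fst_sum]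
  · rw [Prod.snd_sum]
    simpa using h

lemma memLp_two_iff_lintegral {X : Type*} [MeasurableSpace X] {μ : Measure X} {u : X → ℝ}
    (hu : AEStronglyMeasurable u μ) : MemLp u 2 μ ↔ ∫⁻ x, ‖u x‖ₑ ^ (2 : ℝ) ∂μ < ∞ := by
  have := eLpNorm_lt_top_iff_lintegral_rpow_enorm_lt_top (f := u) (μ := μ) two_ne_zero
    ENNReal.ofNat_ne_top
  rw [ENNReal.toReal_ofNat] at this
  exact ⟨fun h => this.1 h.2, fun h => ⟨hu, this.2 h⟩⟩

/-- The Sobolev embedding `W^{1,2} ⊂ L^{2 (d + 1) / d}` on a part of the cylinder, for a time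
direction `σ = ±1`. -/
lemma lintegral_rpow_lt_top_of_slides_cyl (hd : 0 < d) {u wt : ℝ × Sp d → ℝ}
    {w : Fin d → ℝ × Sp d → ℝ} (hu : MemLp u 2 (vol (cyl T Ω)))
    (ht : HasWeakDeriv (cyl T Ω) u wt (dirT d)) (ht2 : MemLp wt 2 (vol (cyl T Ω)))
    (hx : ∀ j, HasWeakDeriv (cyl T Ω) u (w j) (dirX j)) (hx2 : ∀ j, MemLp (w j) 2 (vol (cyl T Ω)))
    (σ : ℤˣ) {A : Opens (ℝ × Sp d)} {s : ℝ} (hs : 0 < s) (b : Module.Basis (Fin d) ℝ (Sp d))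
    (hA : Slides (A : Set (ℝ × Sp d)) (cyl T Ω) s ((σ : ℤ) • dirT d))
    (hAb : ∀ i, Slides (A : Set (ℝ × Sp d)) (cyl T Ω) s (0, b i)) :
    ∫⁻ z, ‖u z‖ₑ ^ (2 * ((d + 1) / d : ℝ)) ∂(vol A) < ∞ := by
  let B : Module.Basis (Unit ⊕ Fin d) ℝ (ℝ × Sp d) :=
    ((Module.Basis.singleton Unit ℝ).unitsSMul fun _ => Units.map (Int.castRingHom ℝ) σ).prod b
  have hBl : ∀ i, B (Sum.inl i) = (σ : ℤ) • dirT d := by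
    intro i
    refine Prod.ext ?_ ?_
    · simp [B, Module.Basis.unitsSMul_apply, Units.smul_def]
    · simp [B]
  have hBr : ∀ i, B (Sum.inr i) = (0, b i) := by
    intro i
    refine Prod.ext ?_ ?_ <;> simp [B]
  let W : Unit ⊕ Fin d → ℝ × Sp d → ℝ :=
    Sum.elim (fun _ z => ((σ : ℤ) : ℝ) * wt z) fun i z => ∑ j, b i j * w j z
  have hW : ∀ i, HasWeakDeriv (cyl T Ω) u (W i) (B i) := by
    rintro (i | i)
    · rw [hBl]
      have := HasWeakDeriv.sum_smul (I := {()}) (w := fun _ => wt) (m := fun _ => dirT d) ht.1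
        (fun _ _ => ht) (fun _ => ((σ : ℤ) : ℝ))
      simpa [W] using this
    · rw [hBr, ← sum_smul_dirX]
      exact HasWeakDeriv.sum_smul ht.1 (fun j _ => hx j) _
  have hW2 : ∀ i, MemLp (W i) 2 (vol (cyl T Ω)) := by
    rintro (i | i)
    · exact ht2.const_mul _
    · exact memLp_finsetSum _ fun j _ => (hx2 j).const_mul _
  have hcard : Fintype.card (Unit ⊕ Fin d) = d + 1 := by simp [add_comm]
  have := lintegral_rpow_lt_top_of_slides (by rw [hcard]; omega) B one_le_two hs hW
    (A := A) (by
      rintro (i | i)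
      · rw [hBl]; exact hA
      · rw [hBr]; exact hAb i)
    ((memLp_two_iff_lintegral hu.1).1 hu) fun i => (memLp_two_iff_lintegral (hW2 i).1).1 (hW2 i)
  rw [hcard] at this
  simpa using this

/-- The Sobolev embedding `W^{1,2} ⊂ L^{2 (d + 1) / d}` on the space-time cylinder. -/
theorem lintegral_rpow_cyl_lt_top (hd : 0 < d) (hT : 0 < T)
    (hb : Bornology.IsBounded (Ω : Set (Sp d))) (hL : HasLipschitzBoundary (Ω : Set (Sp d)))
    {u wt : ℝ × Sp d → ℝ} {w : Fin d → ℝ × Sp d → ℝ} (hu : MemLp u 2 (vol (cyl T Ω)))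
    (ht : HasWeakDeriv (cyl T Ω) u wt (dirT d)) (ht2 : MemLp wt 2 (vol (cyl T Ω)))
    (hx : ∀ j, HasWeakDeriv (cyl T Ω) u (w j) (dirX j))
    (hx2 : ∀ j, MemLp (w j) 2 (vol (cyl T Ω))) :
    ∫⁻ z, ‖u z‖ₑ ^ (2 * ((d + 1) / d : ℝ)) ∂(vol (cyl T Ω)) < ∞ := by
  have hcomp : IsCompact (closure (Ω : Set (Sp d))) := hb.isCompact_closure
  set g : ℝ × Sp d → ℝ≥0∞ := fun z => ‖u z‖ₑ ^ (2 * ((d + 1) / d : ℝ)) with hg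
  suffices H : ∫⁻ z in Ioo 0 T ×ˢ (closure (Ω : Set (Sp d)) ∩ Ω), g z < ∞ by
    rw [inter_eq_right.2 subset_closure] at H
    exact H
  refine hcomp.induction_on (p := fun S => ∫⁻ z in Ioo 0 T ×ˢ (S ∩ Ω), g z < ∞)
    (by simp) (fun S S' hS h' => (lintegral_mono_set
      (prod_mono le_rfl (inter_subset_inter_left _ hS))).trans_lt h')
    (fun S S' h1 h2 => ?_) fun x₀ hx₀ => ?_
  · rw [union_inter_distrib_right, prod_union]
    exact (lintegral_union_le _ _ _).trans_lt (ENNReal.add_lt_top.2 ⟨h1, h2⟩)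
  obtain ⟨N, hxN, s₀, hs₀, b, hbN, -⟩ := exists_inward_basis hL hx₀
  refine ⟨N, mem_nhdsWithin_of_mem_nhds (N.isOpen.mem_nhds hxN), ?_⟩
  set s := min s₀ (T / 3) with hs
  have hs0 : 0 < s := lt_min hs₀ (by positivity)
  have hs1 : s ≤ T / 3 := min_le_right _ _
  -- slide forward in time on the first two thirds of the cylinder, backward on the last two thirds
  let A₁ : Opens (ℝ × Sp d) := ⟨Ioo 0 (2 * T / 3) ×ˢ ((N ⊓ Ω : Opens (Sp d)) : Set (Sp d)),
    isOpen_Ioo.prod (N ⊓ Ω).isOpen⟩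
  let A₂ : Opens (ℝ × Sp d) := ⟨Ioo (T / 3) T ×ˢ ((N ⊓ Ω : Opens (Sp d)) : Set (Sp d)),
    isOpen_Ioo.prod (N ⊓ Ω).isOpen⟩
  have h1 : ∫⁻ z, g z ∂(vol A₁) < ∞ := by
    refine lintegral_rpow_lt_top_of_slides_cyl hd hu ht ht2 hx hx2 1 hs0 b ?_ ?_
    · rintro ⟨t, x⟩ ⟨ht1, hx1⟩ τ hτ
      refine ⟨?_, ?_⟩
      · have := ht1.1; have := ht1.2; have := hτ.1; have := hτ.2
        simp only at *
        constructor <;> simp <;> linarith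
      · simpa using hx1.2
    · rintro i ⟨t, x⟩ ⟨ht1, hx1⟩ τ hτ
      refine ⟨?_, ?_⟩
      · have := ht1.1; have := ht1.2
        simp only at *
        constructor <;> simp <;> linarith
      · exact hbN i x hx1 τ ⟨hτ.1, hτ.2.trans (min_le_left _ _)⟩
  have h2 : ∫⁻ z, g z ∂(vol A₂) < ∞ := by
    refine lintegral_rpow_lt_top_of_slides_cyl hd hu ht ht2 hx hx2 (-1) hs0 b ?_ ?_
    · rintro ⟨t, x⟩ ⟨ht1, hx1⟩ τ hτ
      refine ⟨?_, ?_⟩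
      · have := ht1.1; have := ht1.2; have := hτ.1; have := hτ.2
        simp only at *
        constructor <;> simp <;> linarith
      · simpa using hx1.2
    · rintro i ⟨t, x⟩ ⟨ht1, hx1⟩ τ hτ
      refine ⟨?_, ?_⟩
      · have := ht1.1; have := ht1.2
        simp only at *
        constructor <;> simp <;> linarith
      · exact hbN i x hx1 τ ⟨hτ.1, hτ.2.trans (min_le_left _ _)⟩
  have hsub : Ioo 0 T ×ˢ ((N : Set (Sp d)) ∩ Ω) ⊆ (A₁ : Set (ℝ × Sp d)) ∪ A₂ := by
    rintro ⟨t, x⟩ ⟨ht1, hx1⟩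
    rcases lt_or_ge t (2 * T / 3) with h | h
    · exact Or.inl ⟨⟨ht1.1, h⟩, hx1⟩
    · exact Or.inr ⟨⟨by simp only at *; linarith, ht1.2⟩, hx1⟩
  exact ((lintegral_mono_set hsub).trans (lintegral_union_le _ _ _)).trans_lt
    (ENNReal.add_lt_top.2 ⟨h1, h2⟩)

end SpaceTimeEmbedding

/-! ### Bounded difference quotients -/

section DifferenceQuotients

variable {V : Type*} [NormedAddCommGroup V] [NormedSpace ℝ V] [FiniteDimensional ℝ V]
  [MeasureSpace V] [BorelSpace V] [(volume : Measure V).IsAddHaarMeasure]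

/-- A function in `L²` with bounded difference quotients has a weak derivative in `L²`. -/
theorem HasWeakDeriv.exists_of_eLpNorm_diff_le {U : Opens V} [IsFiniteMeasure (vol U)] {u : V → ℝ}
    {m : V} {N : ℝ≥0∞} (hN : N ≠ ∞) (hu : MemLp u 2 (vol U))
    (h : ∀ φ : 𝓓(U, ℝ), ∀ᶠ s in 𝓝[>] (0 : ℝ), ∃ A : Opens V, tsupport φ ⊆ A ∧
      Slides (A : Set V) U s m ∧
      eLpNorm (fun x => u (x + s • m) - u x) 2 (vol A) ≤ ENNReal.ofReal s * N) :
    ∃ κ : V → ℝ, MemLp κ 2 (vol U) ∧ HasWeakDeriv U u κ m := by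
  have hui := hu.integrable one_le_two
  obtain ⟨κ, hκ, hd⟩ := HasWeakDeriv.exists_of_diff_bound (a := fun _ => 1) (C := N.toReal) (m := m)
    hui (memLp_const 1) fun φ => by
    filter_upwards [h φ, self_mem_nhdsWithin] with s ⟨A, hφA, hA, hs⟩ hs0
    have hs0 : 0 ≤ s := le_of_lt hs0
    have hle : vol A ≤ vol U := Measure.restrict_mono (hA.subset hs0) le_rfl
    rw [integral_mul_shift_sub hs0 hA (IntegrableOn.locallyIntegrableOn hui) hφA]
    have m1 : MemLp (fun x => u (x + s • m) - u x) 2 (vol A) :=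
      (memLp_translate hu hs0 hA).sub (hu.mono_measure hle)
    have m2 : MemLp φ 2 (vol U) := by
      simpa using memLp_mul_testFunction (memLp_const (μ := vol U) (p := 2) (1 : ℝ)) φ
    have h1 : |∫ x, (u (x + s • m) - u x) * φ x ∂(vol A)|
        ≤ ∫ x, ‖u (x + s • m) - u x‖ * ‖φ x‖ ∂(vol A) := by
      simp only [← norm_mul]
      exact norm_integral_le_integral_norm fun x => (u (x + s • m) - u x) * φ x
    have h2 : √(∫ x, (u (x + s • m) - u x) ^ 2 ∂(vol A)) ≤ s * N.toReal := by
      rw [sqrt_integral_sq m1]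
      have := ENNReal.toReal_mono (ENNReal.mul_ne_top ENNReal.ofReal_ne_top hN) hs
      rwa [ENNReal.toReal_mul, ENNReal.toReal_ofReal hs0] at this
    have h3 : √(∫ x, φ x ^ 2 ∂(vol A)) ≤ √(∫ x, φ x ^ 2 ∂(vol U)) :=
      Real.sqrt_le_sqrt (integral_mono_measure hle (ae_of_all _ fun _ => sq_nonneg _)
        m2.integrable_sq)
    simp only [one_mul]
    calc |∫ x, (u (x + s • m) - u x) * φ x ∂(vol A)|
        ≤ √(∫ x, (u (x + s • m) - u x) ^ 2 ∂(vol A)) * √(∫ x, φ x ^ 2 ∂(vol A)) :=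
          h1.trans (integral_mul_le_sqrt m1 (m2.mono_measure hle))
      _ ≤ (s * N.toReal) * √(∫ x, φ x ^ 2 ∂(vol U)) := by gcongr
      _ = s * (N.toReal * (√(∫ x, φ x ^ 2 ∂(vol U)) + 0)) := by ring
      _ ≤ _ := by gcongr; positivity
  exact ⟨κ, hκ, by simpa using hd⟩

end DifferenceQuotients

/-! ### Zero boundary values -/

section ZeroTrace

variable {d : ℕ} {Ω : Opens (Sp d)}

/-- The one-dimensional Poincaré inequality for test functions on a bounded set. -/
lemma exists_poincare_testFunction (hb : Bornology.IsBounded (Ω : Set (Sp d))) (i : Fin d) :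
    ∃ R : ℝ≥0, ∀ φ : 𝓓(Ω, ℝ),
      eLpNorm φ 2 (vol Ω) ≤ R * eLpNorm (fun x => fderiv ℝ φ x (stdVec i)) 2 (vol Ω) := by
  obtain ⟨s, hs⟩ := hb.exists_norm_le
  rcases (Ω : Set (Sp d)).eq_empty_or_nonempty with h0 | ⟨x₀, hx₀⟩
  · exact ⟨0, fun φ => by simp [vol, h0]⟩
  have hs0 : 0 ≤ s := (norm_nonneg _).trans (hs x₀ hx₀)
  set r := 2 * s + 1 with hr
  refine ⟨r.toNNReal, fun φ => ?_⟩
  have hout : ∀ x ∈ Ω, x + r • stdVec i ∉ (Ω : Set (Sp d)) := by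
    intro x hx h
    have h1 := hs _ h
    have h2 := hs x hx
    have h3 : ‖r • (stdVec i : Sp d)‖ = r := by
      rw [norm_smul, Real.norm_eq_abs, abs_of_pos (by positivity)]; simp
    have h4 := norm_sub_norm_le (r • (stdVec i : Sp d)) (-x)
    rw [sub_neg_eq_add, add_comm (r • (stdVec i : Sp d)), norm_neg] at h4
    linarith
  have hc := continuous_fderiv_apply φ (stdVec i)
  have hftc : ∀ x ∈ Ω, φ x = - ∫ τ in (0 : ℝ)..r, fderiv ℝ φ (x + τ • stdVec i) (stdVec i) := by
    intro x hx
    have h1 : ∀ τ : ℝ, HasDerivAt (fun τ : ℝ => φ (x + τ • stdVec i))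
        (fderiv ℝ φ (x + τ • stdVec i) (stdVec i)) τ := fun τ => by
      have h2 : HasDerivAt (fun τ : ℝ => x + τ • (stdVec i : Sp d)) (stdVec i) τ := by
        simpa using ((hasDerivAt_id τ).smul_const (stdVec i : Sp d)).const_add x
      exact ((φ.contDiff.differentiable (by simp)) _).hasFDerivAt.comp_hasDerivAt τ h2
    rw [intervalIntegral.integral_eq_sub_of_hasDerivAt (fun τ _ => h1 τ)
      (Continuous.intervalIntegrable (by fun_prop) _ _)]
    rw [image_eq_zero_of_notMem_tsupport fun h => hout x hx (φ.tsupport_subset h)]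
    simp
  have h1 : ∫⁻ x, ‖φ x‖ₑ ^ (2 : ℝ) ∂(vol Ω) ≤ ENNReal.ofReal r ^ (2 : ℝ) *
      ∫⁻ x, ‖fderiv ℝ φ x (stdVec i)‖ₑ ^ (2 : ℝ) ∂(vol (⊤ : Opens (Sp d))) := by
    refine le_trans (setLIntegral_mono' Ω.isOpen.measurableSet fun x hx => ?_)
      (lintegral_average_rpow_le (A := Ω) (U := ⊤) (m := stdVec i) one_le_two
        (by positivity : 0 ≤ r) hc.measurable fun _ _ _ _ => mem_univ _)
    refine ENNReal.rpow_le_rpow ?_ (by norm_num)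
    rw [hftc x hx, enorm_neg]
    exact enorm_average_le (w := fun x => fderiv ℝ φ x (stdVec i)) (by positivity) x (stdVec i)
  have h2 : ∫⁻ x, ‖fderiv ℝ φ x (stdVec i)‖ₑ ^ (2 : ℝ) ∂(vol (⊤ : Opens (Sp d)))
      = ∫⁻ x, ‖fderiv ℝ φ x (stdVec i)‖ₑ ^ (2 : ℝ) ∂(vol Ω) := by
    have : (vol (⊤ : Opens (Sp d))) = volume := by simp [vol]
    rw [this, ← setLIntegral_eq_of_support_subset]
    intro x hx
    by_contra h
    refine hx ?_
    simp [fderiv_eq_zero_of_notMem φ (fun h' => h (φ.tsupport_subset h')) (stdVec i)]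
  rw [h2] at h1
  exact eLpNorm_two_le_of_lintegral_le h1

/-- The pair `(u, w)` is a limit in `L²` of pairs `(φ, ∂ᵢ φ)` of test functions. -/
def InTestClosure (Ω : Opens (Sp d)) (i : Fin d) (u w : Sp d → ℝ) : Prop :=
  MemLp u 2 (vol Ω) ∧ MemLp w 2 (vol Ω) ∧ ∀ ε : ℝ≥0∞, 0 < ε → ∃ φ : 𝓓(Ω, ℝ),
    eLpNorm (fun x => u x - φ x) 2 (vol Ω) ≤ ε ∧
    eLpNorm (fun x => w x - fderiv ℝ φ x (stdVec i)) 2 (vol Ω) ≤ ε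

lemma InTestClosure.sub {i : Fin d} {u w u' w' : Sp d → ℝ} (h : InTestClosure Ω i u w)
    (h' : InTestClosure Ω i u' w') :
    InTestClosure Ω i (fun x => u x - u' x) (fun x => w x - w' x) := by
  refine ⟨h.1.sub h'.1, h.2.1.sub h'.2.1, fun ε hε => ?_⟩
  obtain ⟨φ, h1, h2⟩ := h.2.2 (ε / 2) (ENNReal.half_pos hε.ne')
  obtain ⟨φ', h1', h2'⟩ := h'.2.2 (ε / 2) (ENNReal.half_pos hε.ne')
  have hd : ∀ φ : 𝓓(Ω, ℝ), Differentiable ℝ φ := fun φ => φ.contDiff.differentiable (by simp)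
  have hm : ∀ φ : 𝓓(Ω, ℝ), AEStronglyMeasurable φ (vol Ω) := fun φ =>
    φ.continuous.aestronglyMeasurable
  have hm' : ∀ φ : 𝓓(Ω, ℝ), AEStronglyMeasurable (fun x => fderiv ℝ φ x (stdVec i)) (vol Ω) :=
    fun φ => (continuous_fderiv_apply φ _).aestronglyMeasurable
  refine ⟨φ - φ', ?_, ?_⟩
  · have e : (fun x => u x - u' x - (φ - φ') x) = (fun x => u x - φ x) - fun x => u' x - φ' x := by
      ext x; simp; ring
    rw [e, ← ENNReal.add_halves ε]
    exact (eLpNorm_sub_le (h.1.1.sub (hm φ)) (h'.1.1.sub (hm φ')) one_le_two).trans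
      (add_le_add h1 h1')
  · have e : (fun x => w x - w' x - fderiv ℝ (φ - φ' : 𝓓(Ω, ℝ)) x (stdVec i))
        = (fun x => w x - fderiv ℝ φ x (stdVec i)) - fun x => w' x - fderiv ℝ φ' x (stdVec i) := by
      ext x
      rw [FunLike.coe_sub, fderiv_sub (hd φ x) (hd φ' x)]
      simp; ring
    rw [e, ← ENNReal.add_halves ε]
    exact (eLpNorm_sub_le (h.2.1.1.sub (hm' φ)) (h'.2.1.1.sub (hm' φ')) one_le_two).trans
      (add_le_add h2 h2')

lemma InTestClosure.eLpNorm_le {i : Fin d} {R : ℝ≥0}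
    (hR : ∀ φ : 𝓓(Ω, ℝ),
      eLpNorm φ 2 (vol Ω) ≤ R * eLpNorm (fun x => fderiv ℝ φ x (stdVec i)) 2 (vol Ω))
    {u w : Sp d → ℝ} (h : InTestClosure Ω i u w) :
    eLpNorm u 2 (vol Ω) ≤ R * eLpNorm w 2 (vol Ω) := by
  refine ENNReal.le_of_forall_pos_le_add fun ε hε _ => ?_
  set ε' : ℝ≥0∞ := ε / (1 + R) with hε'
  have h1R : (1 + R : ℝ≥0∞) ≠ ∞ := by simp
  have hε'0 : 0 < ε' := ENNReal.div_pos (by exact_mod_cast hε.ne') h1R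
  obtain ⟨φ, h1, h2⟩ := h.2.2 ε' hε'0
  have hmφ : AEStronglyMeasurable φ (vol Ω) := φ.continuous.aestronglyMeasurable
  have hmφ' : AEStronglyMeasurable (fun x => fderiv ℝ φ x (stdVec i)) (vol Ω) :=
    (continuous_fderiv_apply φ _).aestronglyMeasurable
  have e1 : eLpNorm u 2 (vol Ω) ≤ ε' + eLpNorm φ 2 (vol Ω) := by
    have := eLpNorm_add_le (h.1.1.sub hmφ) hmφ one_le_two (μ := vol Ω)
    rw [sub_add_cancel] at this
    exact this.trans (add_le_add h1 le_rfl)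
  have e2 : eLpNorm (fun x => fderiv ℝ φ x (stdVec i)) 2 (vol Ω) ≤ eLpNorm w 2 (vol Ω) + ε' := by
    have := eLpNorm_sub_le h.2.1.1 (h.2.1.1.sub hmφ') one_le_two (μ := vol Ω)
    rw [sub_sub_cancel] at this
    exact this.trans (add_le_add le_rfl h2)
  calc eLpNorm u 2 (vol Ω) ≤ ε' + R * (eLpNorm w 2 (vol Ω) + ε') :=
        e1.trans (add_le_add le_rfl ((hR φ).trans (by gcongr)))
    _ = R * eLpNorm w 2 (vol Ω) + ε' * (1 + R) := by ring
    _ = R * eLpNorm w 2 (vol Ω) + ε := by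
        rw [hε', ENNReal.div_mul_cancel (by simp) h1R]

/-- For exponents `s ≥ 2` the Luxembourg norm controls the norm of `L²`. -/
lemma exists_eLpNorm_two_lt_of_luxNorm [IsFiniteMeasure (vol Ω)] {s : Sp d → ℝ}
    (hs : ∀ x ∈ Ω, 2 ≤ s x) {ε : ℝ≥0∞} (hε : 0 < ε) :
    ∃ ε' : ℝ≥0∞, 0 < ε' ∧ ∀ u : Sp d → ℝ, luxNorm (vol Ω) s u < ε' → eLpNorm u 2 (vol Ω) ≤ ε := by
  set M : ℝ≥0∞ := (vol Ω univ + 1) ^ (1 / 2 : ℝ) with hM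
  have hMt : M ≠ ∞ := ENNReal.rpow_ne_top_of_nonneg (by norm_num)
    (ENNReal.add_ne_top.2 ⟨measure_ne_top _ _, ENNReal.one_ne_top⟩)
  have hM0 : M ≠ 0 := by
    rw [hM, Ne, ENNReal.rpow_eq_zero_iff]
    simp
  refine ⟨ε / M, ENNReal.div_pos hε.ne' hMt, fun u hu => ?_⟩
  simp only [luxNorm, iInf_lt_iff] at hu
  obtain ⟨l, hl, hmod, hlε⟩ := hu
  have h1 : ∫⁻ x, ‖u x / l‖ₑ ^ (2 : ℝ) ∂(vol Ω) ≤ vol Ω univ + 1 := by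
    calc ∫⁻ x, ‖u x / l‖ₑ ^ (2 : ℝ) ∂(vol Ω)
        ≤ ∫⁻ x, (1 + ENNReal.ofReal (|u x / l| ^ s x)) ∂(vol Ω) := by
          refine setLIntegral_mono' Ω.isOpen.measurableSet fun x hx => ?_
          rw [← ENNReal.ofReal_rpow_of_nonneg (abs_nonneg _) (by linarith [hs x hx]),
            ← Real.norm_eq_abs, ofReal_norm]
          exact ennreal_rpow_le_one_add (by norm_num) (hs x hx)
      _ = vol Ω univ + modular (vol Ω) s (fun x => u x / l) := by
          rw [lintegral_add_left measurable_const, lintegral_one, modular]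
      _ ≤ vol Ω univ + 1 := by gcongr
  have h2 : ∫⁻ x, ‖u x‖ₑ ^ (2 : ℝ) ∂(vol Ω) ≤ ENNReal.ofReal l ^ (2 : ℝ) * (vol Ω univ + 1) := by
    refine le_trans (le_of_eq ?_) (mul_le_mul_right h1 _)
    rw [← lintegral_const_mul' _ _ (by simp)]
    refine lintegral_congr fun x => ?_
    rw [← ENNReal.mul_rpow_of_nonneg _ _ (by norm_num), ← Real.enorm_of_nonneg hl.le, ← enorm_mul,
      mul_div_cancel₀ _ hl.ne']
  have h3 : eLpNorm u 2 (vol Ω) ≤ ENNReal.ofReal l * M := by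
    rw [eLpNorm_eq_lintegral_rpow_enorm_toReal two_ne_zero ENNReal.ofNat_ne_top,
      ENNReal.toReal_ofNat]
    refine (ENNReal.rpow_le_rpow h2 (by norm_num)).trans (le_of_eq ?_)
    rw [ENNReal.mul_rpow_of_nonneg _ _ (by norm_num), ← ENNReal.rpow_mul]
    norm_num [hM]
  calc eLpNorm u 2 (vol Ω) ≤ ENNReal.ofReal l * M := h3
    _ ≤ ε / M * M := by gcongr
    _ = ε := ENNReal.div_mul_cancel hM0 hMt

lemma InW10.inTestClosure (hb : Bornology.IsBounded (Ω : Set (Sp d))) {s u w : Sp d → ℝ}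
    (hs : ∀ x ∈ Ω, 2 ≤ s x) (h : InW10 Ω s u) {i : Fin d} (hu : MemLp u 2 (vol Ω))
    (hw : MemLp w 2 (vol Ω)) (hd : HasWeakDeriv Ω u w (stdVec i)) : InTestClosure Ω i u w := by
  have := isFiniteMeasure_vol hb
  obtain ⟨Du, ⟨-, hDu⟩, happ⟩ := h
  refine ⟨hu, hw, fun ε hε => ?_⟩
  obtain ⟨ε', hε', hlux⟩ := exists_eLpNorm_two_lt_of_luxNorm hs hε
  obtain ⟨φ, hφ⟩ := happ ε' hε'
  refine ⟨φ, hlux _ (lt_of_le_of_lt le_self_add hφ), ?_⟩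
  refine le_trans (eLpNorm_mono_ae ?_) (hlux _ (lt_of_le_of_lt le_add_self hφ))
  filter_upwards [hd.ae_unique (hDu i).1] with x hx
  rw [hx, norm_norm]
  have h1 : fderiv ℝ φ x (stdVec i) = gradient φ x i := by
    have h2 : inner ℝ (gradient φ x) (stdVec i) = fderiv ℝ φ x (stdVec i) := by
      rw [gradient, InnerProductSpace.toDual_symm_apply]
    rw [← h2, EuclideanSpace.inner_single_right]
    simp
  rw [h1]
  exact PiLp.norm_apply_le (Du x - gradient φ x) i

end ZeroTrace

/-! ### Time derivatives of functions with zero boundary values -/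

section TimeDerivative

variable {d : ℕ} {T : ℝ} {Ω : Opens (Sp d)}

/-- A function with zero boundary values has a weak time derivative in `L²` as soon as one of its
spatial derivatives has. -/
theorem exists_timeDeriv_of_spatial (hb : Bornology.IsBounded (Ω : Set (Sp d)))
    {u D w p : ℝ × Sp d → ℝ} {i : Fin d} (hu : MemLp u 2 (vol (cyl T Ω)))
    (hD : MemLp D 2 (vol (cyl T Ω)))
    (hweak : ∀ φ : 𝓓(cyl T Ω, ℝ), ∫ z, u z * fderiv ℝ φ z (dirX i) ∂(vol (cyl T Ω))
      = - ∫ z, D z * φ z ∂(vol (cyl T Ω)))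
    (hDt : HasWeakDeriv (cyl T Ω) D w (dirT d)) (hw : MemLp w 2 (vol (cyl T Ω)))
    (hp : ∀ z ∈ cyl T Ω, 2 ≤ p z)
    (hslice : ∀ᵐ t ∂(volI T), InW10 Ω (fun x => p (t, x)) (fun x => u (t, x))) :
    ∃ κ : ℝ × Sp d → ℝ, MemLp κ 2 (vol (cyl T Ω)) ∧ HasWeakDeriv (cyl T Ω) u κ (dirT d) := by
  have hfin := isFiniteMeasure_vol_cyl hb T
  have hfinΩ := isFiniteMeasure_vol hb
  have hui := hu.integrable one_le_two
  have hDi := hD.integrable one_le_two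
  obtain ⟨R, hR⟩ := exists_poincare_testFunction hb i
  have hsq : ∀ {g : ℝ × Sp d → ℝ}, MemLp g 2 (vol (cyl T Ω)) →
      ∀ᵐ t ∂(volI T), MemLp (fun x => g (t, x)) 2 (vol Ω) := by
    intro g hg
    have h1 := hg.integrable_sq
    have h2 := (hg.integrable one_le_two)
    rw [vol_cyl] at h1 h2
    filter_upwards [h1.prod_right_ae, h2.prod_right_ae] with t ht1 ht2
    exact (memLp_two_iff_integrable_sq ht2.1).2 ht1
  have htc : ∀ᵐ t ∂(volI T), InTestClosure Ω i (fun x => u (t, x)) (fun x => D (t, x)) := by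
    filter_upwards [hslice, HasWeakDeriv.slice hb hui hDi hweak, hsq hu, hsq hD,
      ae_restrict_mem measurableSet_Ioo] with t h1 h2 h3 h4 h5
    exact h1.inTestClosure hb (fun x hx => hp _ ⟨h5, hx⟩) h3 h4 h2
  have key : ∀ s : ℝ, 0 ≤ s → eLpNorm (fun z => u (z + s • dirT d) - u z) 2 (vol (cyl (T - s) Ω))
      ≤ ENNReal.ofReal s * (R * eLpNorm w 2 (vol (cyl T Ω))) := by
    intro s hs
    have h1 := hDt.eLpNorm_diff_le hs (slides_cyl (T := T) (Ω := Ω) (k := s))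
    have h2 : eLpNorm (fun z => u (z + s • dirT d) - u z) 2 (vol (cyl (T - s) Ω))
        ≤ ENNReal.ofReal R * eLpNorm (fun z => D (z + s • dirT d) - D z) 2
          (vol (cyl (T - s) Ω)) := by
      refine eLpNorm_two_le_of_lintegral_le ?_
      have m1 : ∀ {g : ℝ × Sp d → ℝ}, MemLp g 2 (vol (cyl T Ω)) →
          AEMeasurable (fun z => ‖g (z + s • dirT d) - g z‖ₑ ^ (2 : ℝ))
            ((volI (T - s)).prod (vol Ω)) := by
        intro g hg
        rw [← vol_cyl]
        exact ((memLp_translate hg hs slides_cyl).1.sub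
          (hg.1.mono_measure (Measure.restrict_mono (cyl_mono hs) le_rfl))).enorm.pow_const _
      rw [vol_cyl, lintegral_prod _ (m1 hu), lintegral_prod _ (m1 hD),
        ← lintegral_const_mul' _ _ (by simp)]
      have hT : Ioo 0 (T - s) ⊆ Ioo 0 T := Ioo_subset_Ioo_right (by linarith)
      have hsh : ∀ᵐ t ∂(volI (T - s)),
          InTestClosure Ω i (fun x => u (t + s, x)) (fun x => D (t + s, x)) := by
        have := ae_volI_shift hs htc
        have := ae_mono (Measure.restrict_mono hT le_rfl) this
        filter_upwards [this, ae_restrict_mem measurableSet_Ioo] with t ht1 ht2 using ht1 ht2.2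
      refine lintegral_mono_ae ?_
      filter_upwards [ae_mono (Measure.restrict_mono hT le_rfl) htc, hsh] with t ht1 ht2
      have h3 := (ht2.sub ht1).eLpNorm_le hR
      have h4 := ENNReal.rpow_le_rpow h3 (z := 2) (by norm_num)
      rw [ENNReal.mul_rpow_of_nonneg _ _ (by norm_num),
        eLpNorm_eq_lintegral_rpow_enorm_toReal two_ne_zero ENNReal.ofNat_ne_top,
        eLpNorm_eq_lintegral_rpow_enorm_toReal two_ne_zero ENNReal.ofNat_ne_top,
        ENNReal.toReal_ofNat, ← ENNReal.rpow_mul, ← ENNReal.rpow_mul] at h4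
      norm_num at h4 ⊢
      exact h4
    calc _ ≤ _ := h2
      _ ≤ ENNReal.ofReal R * (ENNReal.ofReal s * eLpNorm w 2 (vol (cyl T Ω))) := by gcongr
      _ = _ := by rw [ENNReal.ofReal_coe_nnreal]; ring
  refine HasWeakDeriv.exists_of_eLpNorm_diff_le (N := R * eLpNorm w 2 (vol (cyl T Ω)))
    (ENNReal.mul_ne_top ENNReal.coe_ne_top hw.2.ne) hu fun φ => ?_
  obtain ⟨κ, hκ, hκφ⟩ := exists_tsupport_subset_cyl_sub φ
  filter_upwards [Ioc_mem_nhdsGT hκ] with s hs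
  exact ⟨cyl (T - s) Ω, hκφ s hs.2, slides_cyl, key s hs.1.le⟩

end TimeDerivative

/-! ### Lipschitz continuous exponents -/

section Exponent

variable {d : ℕ} {T : ℝ} {Ω : Opens (Sp d)} {p : ℝ × Sp d → ℝ}

lemma InC011.continuousOn (hp : InC011 T Ω p) :
    ContinuousOn p (Icc 0 T ×ˢ closure (Ω : Set (Sp d))) := by
  obtain ⟨c, hc⟩ := hp
  refine (LipschitzOnWith.of_dist_le_mul (K := (2 * |c|).toNNReal) ?_).continuousOn
  rintro ⟨t, x⟩ ⟨ht, hx⟩ ⟨t', x'⟩ ⟨ht', hx'⟩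
  rw [Real.dist_eq, Real.coe_toNNReal _ (by positivity)]
  have h1 := hc t ht x hx t' ht' x' hx'
  have h2 : |t - t'| ≤ dist (t, x) (t', x') := by
    rw [← Real.dist_eq]; exact le_max_left _ _
  have h3 : ‖x - x'‖ ≤ dist (t, x) (t', x') := by
    rw [← dist_eq_norm]; exact le_max_right _ _
  calc _ ≤ c * (|t - t'| + ‖x - x'‖) := h1
    _ ≤ |c| * (|t - t'| + ‖x - x'‖) := by gcongr; exact le_abs_self c
    _ ≤ |c| * (dist (t, x) (t', x') + dist (t, x) (t', x')) := by gcongr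
    _ = _ := by ring

lemma cyl_subset_closed : (cyl T Ω : Set (ℝ × Sp d)) ⊆ Icc 0 T ×ˢ closure (Ω : Set (Sp d)) :=
  prod_mono Ioo_subset_Icc_self subset_closure

lemma InC011.exists_lipschitz (hp : InC011 T Ω p) :
    ∃ c : ℝ, 0 ≤ c ∧ ∀ z ∈ cyl T Ω, ∀ z' ∈ cyl T Ω, |p z - p z'| ≤ c * ‖z - z'‖ := by
  obtain ⟨c, hc⟩ := hp
  refine ⟨2 * |c|, by positivity, ?_⟩
  rintro ⟨t, x⟩ hz ⟨t', x'⟩ hz'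
  have h1 := hc t (cyl_subset_closed hz).1 x (cyl_subset_closed hz).2 t' (cyl_subset_closed hz').1
    x' (cyl_subset_closed hz').2
  have h2 : |t - t'| ≤ ‖(t, x) - (t', x')‖ := norm_fst_le ((t, x) - (t', x'))
  have h3 : ‖x - x'‖ ≤ ‖(t, x) - (t', x')‖ := norm_snd_le ((t, x) - (t', x'))
  calc _ ≤ c * (|t - t'| + ‖x - x'‖) := h1
    _ ≤ |c| * (|t - t'| + ‖x - x'‖) := by gcongr; exact le_abs_self c
    _ ≤ |c| * (‖(t, x) - (t', x')‖ + ‖(t, x) - (t', x')‖) := by gcongr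
    _ = _ := by ring

lemma InC011.exists_bound (hb : Bornology.IsBounded (Ω : Set (Sp d))) (hp : InC011 T Ω p) :
    ∃ P : ℝ, ∀ z ∈ cyl T Ω, |p z| ≤ P := by
  obtain ⟨P, hP⟩ := (isCompact_Icc.prod hb.isCompact_closure).exists_bound_of_continuousOn
    hp.continuousOn
  exact ⟨P, fun z hz => hP z (cyl_subset_closed hz)⟩

/-- By continuity, the lower bound holds everywhere, up to the boundary. -/
lemma InC011.two_le (hb : Bornology.IsBounded (Ω : Set (Sp d))) (hT : 0 < T) (hp : InC011 T Ω p)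
    (hp2 : 2 ≤ pMinus T Ω p) {t : ℝ} (ht : t ∈ Icc 0 T) {x : Sp d}
    (hx : x ∈ closure (Ω : Set (Sp d))) : 2 ≤ p (t, x) := by
  obtain ⟨P, hP⟩ := hp.exists_bound hb
  have hmeas := (cyl T Ω).isOpen.measurableSet
  have hbd : ∀ᵐ z ∂(vol (cyl T Ω)), -P ≤ p z := by
    filter_upwards [ae_restrict_mem hmeas] with z hz using (abs_le.1 (hP z hz)).1
  have hae : ∀ᵐ z ∂(vol (cyl T Ω)), 2 ≤ p z := by
    filter_upwards [ae_essInf_le (f := p) (μ := vol (cyl T Ω)) ⟨-P, hbd⟩] with z hz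
      using hp2.trans hz
  have hin : ∀ z ∈ (cyl T Ω : Set (ℝ × Sp d)), 2 ≤ p z := by
    have hopen : IsOpen ((cyl T Ω : Set (ℝ × Sp d)) ∩ p ⁻¹' Iio 2) :=
      (hp.continuousOn.mono cyl_subset_closed).isOpen_inter_preimage (cyl T Ω).isOpen isOpen_Iio
    have hnull : volume ((cyl T Ω : Set (ℝ × Sp d)) ∩ p ⁻¹' Iio 2) = 0 := by
      rw [ae_restrict_iff' hmeas] at hae
      refine measure_mono_null (fun z hz => ?_) hae
      intro h
      exact absurd (h hz.1) (not_le.2 hz.2)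
    have hempty := (hopen.measure_eq_zero_iff volume).1 hnull
    intro z hz
    by_contra h
    have : z ∈ (cyl T Ω : Set (ℝ × Sp d)) ∩ p ⁻¹' Iio 2 := ⟨hz, not_le.1 h⟩
    rw [hempty] at this
    exact this
  have hcl : closure (cyl T Ω : Set (ℝ × Sp d)) = Icc 0 T ×ˢ closure (Ω : Set (Sp d)) := by
    change closure (Ioo 0 T ×ˢ (Ω : Set (Sp d))) = _
    rw [closure_prod_eq, closure_Ioo hT.ne]
  refine le_on_closure hin continuousOn_const (by rw [hcl]; exact hp.continuousOn) ?_
  rw [hcl]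
  exact ⟨ht, hx⟩

lemma InC011.aemeasurable (hp : InC011 T Ω p) : AEMeasurable p (vol (cyl T Ω)) :=
  (hp.continuousOn.mono cyl_subset_closed).aemeasurable (cyl T Ω).isOpen.measurableSet

lemma InC011.two_le_pPlus (hb : Bornology.IsBounded (Ω : Set (Sp d)))
    (hne : (Ω : Set (Sp d)).Nonempty) (hT : 0 < T) (hp : InC011 T Ω p)
    (hp2 : 2 ≤ pMinus T Ω p) : 2 ≤ pPlus T Ω p := by
  obtain ⟨P, hP⟩ := hp.exists_bound hb
  have hmeas := (cyl T Ω).isOpen.measurableSet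
  have hbd : ∀ᵐ z ∂(vol (cyl T Ω)), p z ≤ P := by
    filter_upwards [ae_restrict_mem hmeas] with z hz using (abs_le.1 (hP z hz)).2
  have hpos : volume (cyl T Ω : Set (ℝ × Sp d)) ≠ 0 :=
    ((cyl T Ω).isOpen.measure_pos volume ((nonempty_Ioo.2 hT).prod hne)).ne'
  have : NeBot (ae (vol (cyl T Ω))) := by
    rw [ae_neBot]
    intro h
    rw [Measure.restrict_eq_zero] at h
    exact hpos h
  obtain ⟨z, hz, hzm⟩ := ((ae_le_essSup (f := p) (μ := vol (cyl T Ω)) ⟨P, hbd⟩).and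
    (ae_restrict_mem hmeas)).exists
  exact (hp.two_le hb hT hp2 (cyl_subset_closed hzm).1 (cyl_subset_closed hzm).2).trans hz

/-- Conjugate exponents of exponents `p ≥ 2` lie in `[1, 2]`. -/
lemma conj_mem {s : ℝ} (hs : 2 ≤ s) : 1 ≤ s / (s - 1) ∧ s / (s - 1) ≤ 2 := by
  have h : 0 < s - 1 := by linarith
  rw [le_div_iff₀ h, div_le_iff₀ h]
  constructor <;> linarith

lemma continuousOn_conj (hb : Bornology.IsBounded (Ω : Set (Sp d))) (hT : 0 < T)
    (hp : InC011 T Ω p) (hp2 : 2 ≤ pMinus T Ω p) {t : ℝ} (ht : t ∈ Icc 0 T) :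
    ContinuousOn (fun x => conj p (t, x)) (closure (Ω : Set (Sp d))) := by
  have h1 : ContinuousOn (fun x => p (t, x)) (closure (Ω : Set (Sp d))) :=
    hp.continuousOn.comp (by fun_prop) fun x hx => ⟨ht, hx⟩
  refine h1.div (h1.sub continuousOn_const) fun x hx => ?_
  have := hp.two_le hb hT hp2 ht hx
  linarith

end Exponent

/-! ### Functions with finite modular -/

section Modular

variable {X : Type*} [MeasurableSpace X] {μ : Measure X} {s : X → ℝ}

lemma modular_eq (hs : ∀ᵐ x ∂μ, 0 ≤ s x) (u : X → ℝ) :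
    modular μ s u = ∫⁻ x, ‖u x‖ₑ ^ s x ∂μ := by
  refine lintegral_congr_ae ?_
  filter_upwards [hs] with x hx
  rw [← ENNReal.ofReal_rpow_of_nonneg (abs_nonneg _) hx, ← Real.norm_eq_abs, ofReal_norm]

lemma InLp.memLp_two [IsFiniteMeasure μ] (hs : ∀ᵐ x ∂μ, 2 ≤ s x) {u : X → ℝ} (h : InLp μ s u) :
    MemLp u 2 μ := by
  rw [memLp_two_iff_lintegral h.1]
  refine lintegral_rpow_lt_top_mono (p := fun _ => 2) (ae_of_all _ fun _ => by norm_num) hs ?_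
  rw [← modular_eq (by filter_upwards [hs] with x hx using by linarith)]
  exact h.2

lemma InLp.integrable [IsFiniteMeasure μ] (hs : ∀ᵐ x ∂μ, 1 ≤ s x) {u : X → ℝ} (h : InLp μ s u) :
    Integrable u μ := by
  refine ⟨h.1, ?_⟩
  have := lintegral_rpow_lt_top_mono (u := fun x => ‖u x‖ₑ) (p := fun _ => 1)
    (ae_of_all _ fun _ => by norm_num) hs (by
      rw [← modular_eq (by filter_upwards [hs] with x hx using by linarith)]
      exact h.2)
  simpa [HasFiniteIntegral] using this

lemma InLp.mono (hs : ∀ᵐ x ∂μ, 0 ≤ s x) {u v : X → ℝ} (hv : InLp μ s v)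
    (hu : AEStronglyMeasurable u μ) (h : ∀ᵐ x ∂μ, |u x| ≤ |v x|) : InLp μ s u := by
  refine ⟨hu, lt_of_le_of_lt (lintegral_mono_ae ?_) hv.2⟩
  filter_upwards [hs, h] with x h1 h2
  exact ENNReal.ofReal_le_ofReal (Real.rpow_le_rpow (abs_nonneg _) h2 h1)

lemma InLp.add (hsm : AEMeasurable s μ) (hs : ∀ᵐ x ∂μ, 1 ≤ s x ∧ s x ≤ 2) {u v : X → ℝ} (hu : InLp μ s u)
    (hv : InLp μ s v) : InLp μ s (fun x => u x + v x) := by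
  refine ⟨hu.1.add hv.1, ?_⟩
  have hu' := hu.2
  have hv' := hv.2
  simp only [modular] at hu' hv' ⊢
  have hle : ∫⁻ x, ENNReal.ofReal (|u x + v x| ^ s x) ∂μ ≤
      ∫⁻ x, 4 * (ENNReal.ofReal (|u x| ^ s x) + ENNReal.ofReal (|v x| ^ s x)) ∂μ := by
    refine lintegral_mono_ae ?_
    filter_upwards [hs] with x ⟨h1, h2⟩
    have hs0 : 0 ≤ s x := by linarith
    have key : |u x + v x| ^ s x ≤ 4 * (|u x| ^ s x + |v x| ^ s x) := by
      have h3 : |u x + v x| ≤ 2 * max |u x| |v x| := by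
        have := abs_add_le (u x) (v x)
        have := le_max_left |u x| |v x|
        have := le_max_right |u x| |v x|
        linarith
      have hm : 0 ≤ max |u x| |v x| := (abs_nonneg _).trans (le_max_left _ _)
      have h4 : (max |u x| |v x|) ^ s x ≤ |u x| ^ s x + |v x| ^ s x := by
        have := Real.rpow_nonneg (abs_nonneg (u x)) (s x)
        have := Real.rpow_nonneg (abs_nonneg (v x)) (s x)
        rcases max_choice |u x| |v x| with h | h <;> rw [h] <;> linarith
      have h5 : (2 : ℝ) ^ s x ≤ 4 := by
        calc (2 : ℝ) ^ s x ≤ 2 ^ (2 : ℝ) := Real.rpow_le_rpow_of_exponent_le (by norm_num) h2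
          _ = 4 := by norm_num
      calc |u x + v x| ^ s x ≤ (2 * max |u x| |v x|) ^ s x :=
            Real.rpow_le_rpow (abs_nonneg _) h3 hs0
        _ = 2 ^ s x * (max |u x| |v x|) ^ s x := Real.mul_rpow (by norm_num) hm
        _ ≤ 4 * (|u x| ^ s x + |v x| ^ s x) := by
            gcongr
    refine (ENNReal.ofReal_le_ofReal key).trans (le_of_eq ?_)
    rw [ENNReal.ofReal_mul (by norm_num), ENNReal.ofReal_add (Real.rpow_nonneg (abs_nonneg _) _)
      (Real.rpow_nonneg (abs_nonneg _) _)]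
    norm_num
  refine hle.trans_lt ?_
  have hm : AEMeasurable (fun x => ENNReal.ofReal (|u x| ^ s x)) μ :=
    (hu.1.norm.aemeasurable.pow hsm).ennreal_ofReal
  rw [lintegral_const_mul' _ _ (by norm_num), lintegral_add_left' hm]
  exact ENNReal.mul_lt_top (by norm_num) (ENNReal.add_lt_top.2 ⟨hu', hv'⟩)

lemma InLp.sum {ι : Type*} (I : Finset ι) (hsm : AEMeasurable s μ)
    (hs : ∀ᵐ x ∂μ, 1 ≤ s x ∧ s x ≤ 2) {u : ι → X → ℝ} (hu : ∀ i ∈ I, InLp μ s (u i)) :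
    InLp μ s (fun x => ∑ i ∈ I, u i x) := by
  classical
  induction I using Finset.induction_on with
  | empty =>
    simp only [Finset.sum_empty]
    refine ⟨aestronglyMeasurable_const, ?_⟩
    rw [modular_eq (by filter_upwards [hs] with x hx using by linarith [hx.1])]
    refine lt_of_eq_of_lt (lintegral_congr_ae (g := fun _ => 0) ?_) (by simp)
    filter_upwards [hs] with x hx
    rw [enorm_zero, ENNReal.zero_rpow_of_pos (by linarith [hx.1])]
  | insert i I hi ih =>
    simp only [Finset.sum_insert hi]
    exact InLp.add hsm hs (hu i (Finset.mem_insert_self i I))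
      (ih fun j hj => hu j (Finset.mem_insert_of_mem hj))

end Modular

/-! ### Integrability of the parts of the pressure -/

section Auxiliary

variable {d : ℕ} {T : ℝ} {Ω : Opens (Sp d)}

lemma InLinftyLr0.integrable (hb : Bornology.IsBounded (Ω : Set (Sp d))) {r : ℝ} (hr : 1 ≤ r)
    {u : ℝ × Sp d → ℝ} (h : InLinftyLr0 T Ω r u) : Integrable u (vol (cyl T Ω)) := by
  have hfin := isFiniteMeasure_vol hb
  obtain ⟨hm, C, hC⟩ := h
  refine ⟨hm, ?_⟩
  rw [vol_cyl] at hm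
  rw [HasFiniteIntegral, vol_cyl, lintegral_prod _ hm.enorm]
  set K : ℝ≥0∞ := C * vol Ω univ ^ (1 / (1 : ℝ≥0∞).toReal - 1 / (ENNReal.ofReal r).toReal) with hK
  have hKt : K ≠ ∞ := by
    refine ENNReal.mul_ne_top ENNReal.coe_ne_top (ENNReal.rpow_ne_top_of_nonneg ?_
      (measure_ne_top _ _))
    rw [ENNReal.toReal_ofReal (by linarith), ENNReal.toReal_one, div_one, sub_nonneg,
      div_le_one (by linarith)]
    exact hr
  have hle : ∀ᵐ t ∂(volI T), ∫⁻ x, ‖u (t, x)‖ₑ ∂(vol Ω) ≤ K := by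
    filter_upwards [hC] with t ht
    have h1 := eLpNorm_le_eLpNorm_mul_rpow_measure_univ (p := 1) (q := ENNReal.ofReal r)
      (by rw [← ENNReal.ofReal_one]; exact ENNReal.ofReal_le_ofReal hr) ht.1.1
    rw [eLpNorm_one_eq_lintegral_enorm] at h1
    refine h1.trans ?_
    rw [hK]
    gcongr
    exact ht.2.1
  calc ∫⁻ t, ∫⁻ x, ‖u (t, x)‖ₑ ∂(vol Ω) ∂(volI T) ≤ ∫⁻ _, K ∂(volI T) := lintegral_mono_ae hle
    _ < ∞ := by
      rw [lintegral_const]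
      exact ENNReal.mul_lt_top hKt.lt_top (measure_lt_top _ _)

end Auxiliary

/-! ### Inequalities for the weight -/

section WeightEstimates

/-- A form of Young's inequality for the weight `b ^ ((p - 2) / 2)`. -/
lemma rpow_conj_le {b p κ : ℝ} (hb : 0 < b) (hp : 2 ≤ p) :
    |b ^ ((p - 2) / 2) * κ| ^ (p / (p - 1)) ≤ b ^ p + κ ^ 2 := by
  have hp1 : 0 < p - 1 := by linarith
  have hp0 : 0 < p := by linarith
  have ha : 0 < b ^ ((p - 2) / 2) := Real.rpow_pos_of_pos hb _
  have hbp : 0 < b ^ p := Real.rpow_pos_of_pos hb _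
  rw [abs_mul, abs_of_pos ha]
  rcases le_total |κ| (b ^ (p / 2)) with h | h
  · have h1 : b ^ ((p - 2) / 2) * |κ| ≤ b ^ (p - 1) := by
      calc b ^ ((p - 2) / 2) * |κ| ≤ b ^ ((p - 2) / 2) * b ^ (p / 2) := by gcongr
        _ = b ^ (p - 1) := by rw [← Real.rpow_add hb]; congr 1; ring
    calc (b ^ ((p - 2) / 2) * |κ|) ^ (p / (p - 1)) ≤ (b ^ (p - 1)) ^ (p / (p - 1)) :=
          Real.rpow_le_rpow (by positivity) h1 (by positivity)
      _ = b ^ p := by rw [← Real.rpow_mul hb.le]; congr 1; field_simp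
      _ ≤ b ^ p + κ ^ 2 := le_add_of_nonneg_right (sq_nonneg _)
  · have hκ : 0 < |κ| := (Real.rpow_pos_of_pos hb _).trans_le h
    have h1 : b ^ ((p - 2) / 2) ≤ |κ| ^ ((p - 2) / p) := by
      calc b ^ ((p - 2) / 2) = (b ^ (p / 2)) ^ ((p - 2) / p) := by
            rw [← Real.rpow_mul hb.le]; congr 1; field_simp
        _ ≤ |κ| ^ ((p - 2) / p) :=
            Real.rpow_le_rpow (by positivity) h (div_nonneg (by linarith) hp0.le)
    have h2 : b ^ ((p - 2) / 2) * |κ| ≤ |κ| ^ ((p - 2) / p + 1) := by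
      rw [Real.rpow_add hκ, Real.rpow_one]
      gcongr
    calc (b ^ ((p - 2) / 2) * |κ|) ^ (p / (p - 1)) ≤ (|κ| ^ ((p - 2) / p + 1)) ^ (p / (p - 1)) :=
          Real.rpow_le_rpow (by positivity) h2 (by positivity)
      _ = |κ| ^ (2 : ℝ) := by rw [← Real.rpow_mul hκ.le]; congr 1; field_simp; ring
      _ = κ ^ 2 := by rw [Real.rpow_two, sq_abs]
      _ ≤ b ^ p + κ ^ 2 := le_add_of_nonneg_left hbp.le

lemma exists_rpow_le {P δ : ℝ} (hδ : 0 < δ) :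
    ∃ K : ℝ, 0 ≤ K ∧ ∀ p ∈ Icc 2 P, ∀ x : ℝ, 0 ≤ x →
      ((δ + x) ^ ((p - 2) / 2)) ^ 2 ≤ K * (1 + ((δ + x) ^ ((p - 2) / 2) * x) ^ 2) ∧
      (δ + x) ^ p ≤ K * (1 + ((δ + x) ^ ((p - 2) / 2) * x) ^ 2) := by
  refine ⟨(1 + δ) ^ P + (1 + δ) ^ 2, by positivity, fun p hp x hx => ?_⟩
  have hb : 0 < δ + x := by linarith
  have e1 : ((δ + x) ^ ((p - 2) / 2)) ^ 2 = (δ + x) ^ (p - 2) := by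
    rw [← Real.rpow_natCast, ← Real.rpow_mul hb.le]; congr 1; push_cast; ring
  have e2 : (δ + x) ^ p = (δ + x) ^ (p - 2) * (δ + x) ^ 2 := by
    rw [← Real.rpow_natCast (δ + x) 2, ← Real.rpow_add hb]; congr 1; push_cast; ring
  have hw : 0 < (δ + x) ^ (p - 2) := Real.rpow_pos_of_pos hb _
  rw [mul_pow, e1]
  have hK : 0 < (1 + δ) ^ P := by positivity
  have hK2 : 1 ≤ (1 + δ) ^ 2 := by nlinarith
  rcases le_total x 1 with h | h
  · have h1 : ∀ e ∈ Icc 0 P, (δ + x) ^ e ≤ (1 + δ) ^ P := fun e he =>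
      (Real.rpow_le_rpow hb.le (by linarith) he.1).trans
        (Real.rpow_le_rpow_of_exponent_le (by linarith) he.2)
    have h2 := h1 (p - 2) ⟨by linarith [hp.1], by linarith [hp.2]⟩
    have h3 := h1 p ⟨by linarith [hp.1], hp.2⟩
    have h4 : 0 ≤ ((1 + δ) ^ P + (1 + δ) ^ 2) * ((δ + x) ^ (p - 2) * x ^ 2) := by positivity
    constructor <;> nlinarith
  · have hx2 : 1 ≤ x ^ 2 := by nlinarith
    have h1 : (δ + x) ^ (p - 2) ≤ (δ + x) ^ (p - 2) * x ^ 2 := le_mul_of_one_le_right hw.le hx2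
    have h2 : (δ + x) ^ 2 ≤ (1 + δ) ^ 2 * x ^ 2 := by
      rw [← mul_pow]
      exact pow_le_pow_left₀ hb.le (by nlinarith) 2
    have h3 : (δ + x) ^ p ≤ (1 + δ) ^ 2 * ((δ + x) ^ (p - 2) * x ^ 2) := by
      rw [e2]
      calc _ ≤ (δ + x) ^ (p - 2) * ((1 + δ) ^ 2 * x ^ 2) := by gcongr
        _ = _ := by ring
    have h4 : 0 ≤ (δ + x) ^ (p - 2) * x ^ 2 := by positivity
    have h5 : 0 ≤ (1 + δ) ^ P * ((δ + x) ^ (p - 2) * x ^ 2) := by positivity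
    constructor <;> nlinarith

end WeightEstimates

/-! ### Regularity of the stress -/

section RegularFlow

variable {d : ℕ}

/-- The tensor field `Dv` is regular for the exponent `p`: the function `F(·, ·, Dv)` lies in
`W^{1,2}` of the space-time cylinder, and `p` is Lipschitz continuous with values in `[2, P]`. -/
structure IsRegular (T : ℝ) (Ω : Opens (Sp d)) (δ P c : ℝ) (p : ℝ × Sp d → ℝ)
    (Dv : ℝ × Sp d → Tensor d) : Prop where
  pos : 0 < δ
  exponent : ∀ z ∈ cyl T Ω, p z ∈ Icc 2 P
  aemeasurable : AEMeasurable p (vol (cyl T Ω))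
  lipschitz : ∀ z ∈ cyl T Ω, ∀ z' ∈ cyl T Ω, |p z - p z'| ≤ c * ‖z - z'‖
  measurable : ∀ i j, AEStronglyMeasurable (fun z => Dv z i j) (vol (cyl T Ω))
  memLp : ∀ i j, MemLp (fun z => Fmap δ p z (Dv z) i j) 2 (vol (cyl T Ω))
  time : ∀ i j, ∃ w, HasWeakDeriv (cyl T Ω) (fun z => Fmap δ p z (Dv z) i j) w (dirT d) ∧
    MemLp w 2 (vol (cyl T Ω))
  space : ∀ i j k, ∃ w, HasWeakDeriv (cyl T Ω) (fun z => Fmap δ p z (Dv z) i j) w (dirX k) ∧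
    MemLp w 2 (vol (cyl T Ω))

variable {T : ℝ} {Ω : Opens (Sp d)} {δ P c : ℝ} {p : ℝ × Sp d → ℝ} {Dv : ℝ × Sp d → Tensor d}

lemma aemeasurable_tnorm {X : Type*} [MeasurableSpace X] {μ : Measure X} {A : X → Tensor d}
    (hA : ∀ i j, AEMeasurable (fun x => A x i j) μ) : AEMeasurable (fun x => tnorm (A x)) μ := by
  unfold tnorm ddot
  refine AEMeasurable.sqrt ?_
  exact Finset.aemeasurable_fun_sum _ fun i _ => Finset.aemeasurable_fun_sum _ fun j _ =>
    (hA i j).mul (hA i j)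

lemma tnorm_le_sum (A : Tensor d) : tnorm A ≤ ∑ k : Fin d × Fin d, |A k.1 k.2| := by
  rw [tnorm, ddot, ← Fintype.sum_prod_type' (f := fun i j => A i j * A i j)]
  refine Real.sqrt_le_iff.2 ⟨Finset.sum_nonneg fun _ _ => abs_nonneg _, ?_⟩
  refine le_trans (le_of_eq ?_) (Finset.sum_sq_le_sq_sum_of_nonneg fun k _ => abs_nonneg _)
  exact Finset.sum_congr rfl fun k _ => by rw [sq_abs, sq]

lemma tnorm_smul (r : ℝ) (A : Tensor d) : tnorm (r • A) = |r| * tnorm A := by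
  rw [← norm_tvec, tvec_smul, norm_smul, norm_tvec, Real.norm_eq_abs]

lemma tnorm_Fmap (hδ : 0 < δ) (z : ℝ × Sp d) (A : Tensor d) :
    tnorm (Fmap δ p z A) = weight δ p z A * tnorm (tsym A) := by
  rw [Fmap, tnorm_smul, abs_of_pos]
  · rfl
  · exact weight_pos hδ p z A

namespace IsRegular

lemma aemeasurable_tnorm_tsym (h : IsRegular T Ω δ P c p Dv) :
    AEMeasurable (fun z => tnorm (tsym (Dv z))) (vol (cyl T Ω)) := by
  refine aemeasurable_tnorm fun i j => ?_
  simp only [tsym_apply]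
  exact ((h.measurable i j).aemeasurable.add (h.measurable j i).aemeasurable).div_const 2

lemma aestronglyMeasurable_weight (h : IsRegular T Ω δ P c p Dv) :
    AEStronglyMeasurable (fun z => weight δ p z (Dv z)) (vol (cyl T Ω)) :=
  ((h.aemeasurable_tnorm_tsym.const_add δ).pow
    ((h.aemeasurable.sub_const 2).div_const 2)).aestronglyMeasurable

lemma memLp_tnorm (h : IsRegular T Ω δ P c p Dv) :
    MemLp (fun z => tnorm (Fmap δ p z (Dv z))) 2 (vol (cyl T Ω)) := by
  have h1 : MemLp (fun z => ∑ k : Fin d × Fin d, |Fmap δ p z (Dv z) k.1 k.2|) 2 (vol (cyl T Ω)) :=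
    memLp_finsetSum _ fun k _ => (h.memLp k.1 k.2).norm
  refine h1.mono (aemeasurable_tnorm fun i j =>
    (h.memLp i j).1.aemeasurable).aestronglyMeasurable (ae_of_all _ fun z => ?_)
  rw [Real.norm_of_nonneg (tnorm_nonneg _),
    Real.norm_of_nonneg (Finset.sum_nonneg fun _ _ => abs_nonneg _)]
  exact tnorm_le_sum _

lemma memLp_weight [IsFiniteMeasure (vol (cyl T Ω))] (h : IsRegular T Ω δ P c p Dv) :
    MemLp (fun z => weight δ p z (Dv z)) 2 (vol (cyl T Ω)) := by
  obtain ⟨K, hK, hKw⟩ := exists_rpow_le (P := P) h.pos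
  rw [memLp_two_iff_integrable_sq h.aestronglyMeasurable_weight]
  refine Integrable.mono' (((integrable_const (1 : ℝ)).add h.memLp_tnorm.integrable_sq).const_mul K)
    (h.aestronglyMeasurable_weight.pow 2) ?_
  filter_upwards [ae_restrict_mem (cyl T Ω).isOpen.measurableSet] with z hz
  rw [Real.norm_of_nonneg (sq_nonneg _)]
  refine ((hKw (p z) (h.exponent z hz) _ (tnorm_nonneg (tsym (Dv z)))).1).trans (le_of_eq ?_)
  simp only [Pi.add_apply]
  rw [tnorm_Fmap h.pos]
  rfl

/-- `a κ ∈ L^{p'(·)}` for the weight `a` and `κ ∈ L²`. -/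
lemma inLp_weight_mul [IsFiniteMeasure (vol (cyl T Ω))] (h : IsRegular T Ω δ P c p Dv)
    {κ : ℝ × Sp d → ℝ} (hκ : MemLp κ 2 (vol (cyl T Ω))) :
    InLp (vol (cyl T Ω)) (conj p) (fun z => weight δ p z (Dv z) * κ z) := by
  obtain ⟨K, hK, hKw⟩ := exists_rpow_le (P := P) h.pos
  refine ⟨h.aestronglyMeasurable_weight.mul hκ.1, ?_⟩
  have hi := (((integrable_const (1 : ℝ)).add h.memLp_tnorm.integrable_sq).const_mul K).add
    hκ.integrable_sq
  refine lt_of_le_of_lt (lintegral_mono_ae ?_) hi.lintegral_lt_top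
  filter_upwards [ae_restrict_mem (cyl T Ω).isOpen.measurableSet] with z hz
  refine ENNReal.ofReal_le_ofReal ?_
  have h0 := tnorm_nonneg (tsym (Dv z))
  have hpos := h.pos
  refine (rpow_conj_le (by linarith) (h.exponent z hz).1).trans ?_
  have h1 := (hKw (p z) (h.exponent z hz) _ h0).2
  simp only [Pi.add_apply]
  rw [tnorm_Fmap h.pos]
  exact add_le_add h1 le_rfl

lemma ae_conj_mem (h : IsRegular T Ω δ P c p Dv) :
    ∀ᵐ z ∂(vol (cyl T Ω)), 1 ≤ conj p z ∧ conj p z ≤ 2 := by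
  filter_upwards [ae_restrict_mem (cyl T Ω).isOpen.measurableSet] with z hz
  exact conj_mem (h.exponent z hz).1

lemma aemeasurable_conj (h : IsRegular T Ω δ P c p Dv) :
    AEMeasurable (conj p) (vol (cyl T Ω)) :=
  h.aemeasurable.div (h.aemeasurable.sub_const 1)

/-- The function that accounts for the oscillation of the exponent in difference quotients. Its power
`1 + 1 / d` is such that it is square integrable by `lintegral_rpow_cyl_lt_top`. -/
lemma memLp_oscillation (hd : 0 < d) (hT : 0 < T) (hb : Bornology.IsBounded (Ω : Set (Sp d)))
    (hL : HasLipschitzBoundary (Ω : Set (Sp d))) (h : IsRegular T Ω δ P c p Dv) :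
    MemLp (fun z => (1 + tnorm (Fmap δ p z (Dv z))) ^ (1 + 1 / (d : ℝ))) 2 (vol (cyl T Ω)) := by
  have hfin := isFiniteMeasure_vol_cyl hb T
  have hd' : (0 : ℝ) < d := by exact_mod_cast hd
  set q : ℝ := 2 * ((d + 1) / d : ℝ) with hq
  have hq0 : 0 < q := by positivity
  have hqr : (ENNReal.ofReal q).toReal = q := ENNReal.toReal_ofReal hq0.le
  have hqne : ENNReal.ofReal q ≠ 0 := by simpa using hq0
  have h1 : ∀ i j, MemLp (fun z => Fmap δ p z (Dv z) i j) (ENNReal.ofReal q) (vol (cyl T Ω)) := by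
    intro i j
    obtain ⟨wt, hwt, hwt2⟩ := h.time i j
    choose w hw hw2 using h.space i j
    refine ⟨(h.memLp i j).1, ?_⟩
    rw [eLpNorm_lt_top_iff_lintegral_rpow_enorm_lt_top hqne ENNReal.ofReal_ne_top, hqr]
    exact lintegral_rpow_cyl_lt_top hd hT hb hL (h.memLp i j) hwt hwt2 hw hw2
  have hm : AEStronglyMeasurable (fun z => 1 + tnorm (Fmap δ p z (Dv z))) (vol (cyl T Ω)) :=
    aestronglyMeasurable_const.add h.memLp_tnorm.1
  have h2 : MemLp (fun z => 1 + tnorm (Fmap δ p z (Dv z))) (ENNReal.ofReal q) (vol (cyl T Ω)) := by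
    refine ((memLp_const (1 : ℝ)).add (memLp_finsetSum (Finset.univ : Finset (Fin d × Fin d))
      fun k _ => (h1 k.1 k.2).norm)).mono hm (ae_of_all _ fun z => ?_)
    rw [Real.norm_of_nonneg (by linarith [tnorm_nonneg (Fmap δ p z (Dv z))])]
    refine le_trans ?_ (le_abs_self _)
    simp only [Pi.add_apply]
    exact add_le_add le_rfl (tnorm_le_sum _)
  have h3 := h2.2
  rw [eLpNorm_lt_top_iff_lintegral_rpow_enorm_lt_top hqne ENNReal.ofReal_ne_top, hqr] at h3
  have hm2 : AEStronglyMeasurable (fun z => (1 + tnorm (Fmap δ p z (Dv z))) ^ (1 + 1 / (d : ℝ)))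
      (vol (cyl T Ω)) := (hm.aemeasurable.pow_const _).aestronglyMeasurable
  rw [memLp_two_iff_lintegral hm2]
  refine lt_of_eq_of_lt (lintegral_congr fun z => ?_) h3
  have h0 : 0 ≤ 1 + tnorm (Fmap δ p z (Dv z)) := by linarith [tnorm_nonneg (Fmap δ p z (Dv z))]
  rw [Real.enorm_of_nonneg (by positivity), Real.enorm_of_nonneg h0,
    ← ENNReal.ofReal_rpow_of_nonneg h0 (by positivity), ← ENNReal.rpow_mul]
  congr 1
  rw [hq]; field_simp

/-- Increments of the symmetric gradient and of the stress along a direction of length one. -/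
lemma exists_increment_le (ν₀ : ℝ) (hd : 0 < d) (h : IsRegular T Ω δ P c p Dv) :
    ∃ C : ℝ, 0 ≤ C ∧ ∀ m : ℝ × Sp d, ‖m‖ = 1 → ∀ z ∈ cyl T Ω, ∀ s : ℝ, 0 ≤ s →
      z + s • m ∈ cyl T Ω → ∀ R : ℝ,
      R = ∑ k : Fin d × Fin d, |Fmap δ p (z + s • m) (Dv (z + s • m)) k.1 k.2
          - Fmap δ p z (Dv z) k.1 k.2|
        + s * (c * (1 + tnorm (Fmap δ p (z + s • m) (Dv (z + s • m)))) ^ (1 + 1 / (d : ℝ))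
            + c * (1 + tnorm (Fmap δ p z (Dv z))) ^ (1 + 1 / (d : ℝ))) →
      ∀ i j, |tsym (Dv (z + s • m)) i j - tsym (Dv z) i j| ≤ (C / 2 + C / 2) * R ∧
        |stress ν₀ δ p (z + s • m) (Dv (z + s • m)) i j - stress ν₀ δ p z (Dv z) i j|
          ≤ (C * weight δ p (z + s • m) (Dv (z + s • m)) + C * weight δ p z (Dv z)) * R := by
  obtain ⟨C, hC, hpt⟩ := exists_abs_stress_sub_le (P := P) ν₀ h.pos
    (show (0 : ℝ) < 1 / d by positivity) p
  refine ⟨C, hC, fun m hm z hz s hs hz' R hR i j => ?_⟩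
  obtain ⟨h1, h2⟩ := hpt (z + s • m) z (h.exponent _ hz') (h.exponent z hz) (Dv (z + s • m)) (Dv z)
    _ rfl i j
  have hlip := h.lipschitz _ hz' z hz
  rw [add_sub_cancel_left, norm_smul, hm, mul_one, Real.norm_eq_abs, abs_of_nonneg hs] at hlip
  have p1 : 0 ≤ (1 + tnorm (Fmap δ p (z + s • m) (Dv (z + s • m)))) ^ (1 + 1 / (d : ℝ)) :=
    Real.rpow_nonneg (by linarith [tnorm_nonneg (Fmap δ p (z + s • m) (Dv (z + s • m)))]) _
  have p2 : 0 ≤ (1 + tnorm (Fmap δ p z (Dv z))) ^ (1 + 1 / (d : ℝ)) :=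
    Real.rpow_nonneg (by linarith [tnorm_nonneg (Fmap δ p z (Dv z))]) _
  have hRle := mul_le_mul_of_nonneg_right hlip (add_nonneg p1 p2)
  have w1 := weight_pos h.pos p (z + s • m) (Dv (z + s • m))
  have w2 := weight_pos h.pos p z (Dv z)
  have hRR : ∑ k : Fin d × Fin d, |Fmap δ p (z + s • m) (Dv (z + s • m)) k.1 k.2
      - Fmap δ p z (Dv z) k.1 k.2| + |p (z + s • m) - p z|
        * ((1 + tnorm (Fmap δ p (z + s • m) (Dv (z + s • m)))) ^ (1 + 1 / (d : ℝ))
          + (1 + tnorm (Fmap δ p z (Dv z))) ^ (1 + 1 / (d : ℝ))) ≤ R := by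
    rw [hR]
    exact add_le_add le_rfl (hRle.trans (le_of_eq (by ring)))
  constructor
  · refine h1.trans ?_
    rw [add_halves]
    exact mul_le_mul_of_nonneg_left hRR hC
  · refine h2.trans ?_
    rw [← mul_add, mul_assoc]
    exact mul_le_mul_of_nonneg_left (mul_le_mul_of_nonneg_left hRR (by positivity)) hC

end IsRegular

end RegularFlow

section StressDerivatives

variable {d : ℕ} {T : ℝ} {Ω : Opens (Sp d)} {δ P c : ℝ} {p : ℝ × Sp d → ℝ}
  {Dv : ℝ × Sp d → Tensor d}

namespace IsRegular

lemma integrable_stress [IsFiniteMeasure (vol (cyl T Ω))] (ν₀ : ℝ) (h : IsRegular T Ω δ P c p Dv)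
    (i j : Fin d) : Integrable (fun z => stress ν₀ δ p z (Dv z) i j) (vol (cyl T Ω)) := by
  have h1 := (h.memLp_weight.integrable_mul (h.memLp i j)).const_mul ν₀
  refine h1.congr (ae_of_all _ fun z => ?_)
  have := congrArg (fun A : EuclideanSpace ℝ (Fin d × Fin d) => A (i, j))
    (stress_eq (ν₀ := ν₀) h.pos p z (Dv z))
  simpa using this.symm

/-- The derivatives of the stress: a substitute for the chain rule. -/
lemma exists_stress_deriv (ν₀ : ℝ) (hd : 0 < d) (hT : 0 < T)
    (hb : Bornology.IsBounded (Ω : Set (Sp d))) (hL : HasLipschitzBoundary (Ω : Set (Sp d)))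
    (h : IsRegular T Ω δ P c p Dv) (i j k : Fin d) :
    ∃ κ : ℝ × Sp d → ℝ, MemLp κ 2 (vol (cyl T Ω)) ∧ HasWeakDeriv (cyl T Ω)
      (fun z => stress ν₀ δ p z (Dv z) i j) (fun z => weight δ p z (Dv z) * κ z) (dirX k) := by
  have hfin := isFiniteMeasure_vol_cyl hb T
  obtain ⟨C, hC, hpt⟩ := h.exists_increment_le ν₀ hd
  obtain ⟨κ, hκ, hκd⟩ := HasWeakDeriv.exists_of_increments (m := (dirX k : ℝ × Sp d))
    (a := fun z => C * weight δ p z (Dv z))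
    (ℓ := fun z => c * (1 + tnorm (Fmap δ p z (Dv z))) ^ (1 + 1 / (d : ℝ)))
    (F := fun (k : Fin d × Fin d) z => Fmap δ p z (Dv z) k.1 k.2)
    (h.integrable_stress ν₀ i j) (h.memLp_weight.const_mul C)
    ((h.memLp_oscillation hd hT hb hL).const_mul c) (fun l => h.space l.1 l.2 k)
    fun z hz s hs hz' => (hpt _ (by simp [Prod.norm_def]) z hz s hs hz' _ rfl i j).2
  refine ⟨fun z => C * κ z, hκ.const_mul C, ?_⟩
  have e : (fun z => weight δ p z (Dv z) * (C * κ z)) = fun z => C * weight δ p z (Dv z) * κ z := by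
    ext z; ring
  rw [e]
  exact hκd

lemma exists_diag_timeDeriv (hd : 0 < d) (hT : 0 < T)
    (hb : Bornology.IsBounded (Ω : Set (Sp d))) (hL : HasLipschitzBoundary (Ω : Set (Sp d)))
    (h : IsRegular T Ω δ P c p Dv) (i : Fin d) (hi : Integrable (fun z => Dv z i i) (vol (cyl T Ω))) :
    ∃ w : ℝ × Sp d → ℝ, MemLp w 2 (vol (cyl T Ω)) ∧
      HasWeakDeriv (cyl T Ω) (fun z => Dv z i i) w (dirT d) := by
  have hfin := isFiniteMeasure_vol_cyl hb T
  obtain ⟨C, hC, hpt⟩ := h.exists_increment_le 0 hd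
  obtain ⟨κ, hκ, hκd⟩ := HasWeakDeriv.exists_of_increments (m := dirT d)
    (a := fun _ => C / 2)
    (ℓ := fun z => c * (1 + tnorm (Fmap δ p z (Dv z))) ^ (1 + 1 / (d : ℝ)))
    (F := fun (k : Fin d × Fin d) z => Fmap δ p z (Dv z) k.1 k.2)
    hi (memLp_const _) ((h.memLp_oscillation hd hT hb hL).const_mul c)
    (fun l => h.time l.1 l.2) fun z hz s hs hz' => by
      have := (hpt (dirT d) (by simp [Prod.norm_def]) z hz s hs hz' _ rfl i i).1
      simpa only [tsym_apply, add_self_div_two] using this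
  exact ⟨fun z => C / 2 * κ z, hκ.const_mul _, hκd⟩

end IsRegular

end StressDerivatives

/-! ### The pressure gradient -/

section Momentum

variable {d : ℕ} {T : ℝ} {Ω : Opens (Sp d)}

lemma HasSymGrad.ae_symm {v : ℝ × Sp d → Sp d} {Dv : ℝ × Sp d → Tensor d}
    (h : HasSymGrad T Ω v Dv) : ∀ᵐ z ∂(vol (cyl T Ω)), ∀ i j, Dv z i j = Dv z j i := by
  refine ae_all_iff.2 fun i => ae_all_iff.2 fun j => ?_
  have := ae_eq_zero_of_forall_testFunction ((h.2.1 i j).sub (h.2.1 j i)) fun φ => by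
    simp only [Pi.sub_apply, sub_mul]
    rw [integral_sub (integrable_mul_testFunction (h.2.1 i j) φ)
      (integrable_mul_testFunction (h.2.1 j i) φ)]
    have h1 := h.2.2 i j φ
    have h2 := h.2.2 j i φ
    have h3 : ∫ z, (1 / 2 : ℝ) * (v z i * fderiv ℝ φ z (dirX j) + v z j * fderiv ℝ φ z (dirX i))
        ∂(vol (cyl T Ω)) = ∫ z, (1 / 2 : ℝ) * (v z j * fderiv ℝ φ z (dirX i)
          + v z i * fderiv ℝ φ z (dirX j)) ∂(vol (cyl T Ω)) := by
      congr 1; ext z; ring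
    linarith
  filter_upwards [this] with z hz
  exact sub_eq_zero.1 hz

lemma HasSymGrad.diag {v : ℝ × Sp d → Sp d} {Dv : ℝ × Sp d → Tensor d}
    (h : HasSymGrad T Ω v Dv) (i : Fin d) (φ : 𝓓(cyl T Ω, ℝ)) :
    ∫ z, v z i * fderiv ℝ φ z (dirX i) ∂(vol (cyl T Ω)) = - ∫ z, Dv z i i * φ z ∂(vol (cyl T Ω)) := by
  rw [← h.2.2 i i φ]
  congr 1; ext z; ring

/-- The test vector field `η eᵢ`. -/
noncomputable def testSingle (i : Fin d) (η : 𝓓(cyl T Ω, ℝ)) : Fin d → 𝓓(cyl T Ω, ℝ) := Pi.single i η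

lemma testSingle_apply (i k : Fin d) (η : 𝓓(cyl T Ω, ℝ)) (z : ℝ × Sp d) :
    testSingle i η k z = if k = i then η z else 0 := by
  rcases eq_or_ne k i with rfl | h
  · simp [testSingle]
  · simp [testSingle, h]

lemma fderiv_testSingle (i k : Fin d) (η : 𝓓(cyl T Ω, ℝ)) (z m : ℝ × Sp d) :
    fderiv ℝ (testSingle i η k) z m = if k = i then fderiv ℝ η z m else 0 := by
  rcases eq_or_ne k i with rfl | h
  · simp [testSingle]
  · have : (testSingle i η k : ℝ × Sp d → ℝ) = fun _ => 0 := by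
      ext z; rw [testSingle_apply, if_neg h]
    rw [this]; simp [h]

lemma testDiv_testSingle (i : Fin d) (η : 𝓓(cyl T Ω, ℝ)) :
    testDiv (testSingle i η) = (∂_{(dirX i : ℝ × Sp d)} η : 𝓓(cyl T Ω, ℝ)) := by
  rw [testDiv, Finset.sum_eq_single i]
  · simp [testSingle]
  · intro k _ hk
    ext z
    rw [lineDeriv_testFunction_apply, fderiv_testSingle, if_neg hk]
    rfl
  · simp

lemma ddot_testSymGrad_single {A : Tensor d} (hA : ∀ i j, A i j = A j i) (i : Fin d)
    (η : 𝓓(cyl T Ω, ℝ)) (z : ℝ × Sp d) :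
    ddot A (testSymGrad (testSingle i η) z) = ∑ j, A i j * fderiv ℝ η z (dirX j) := by
  have h1 : ∀ k l, A k l * testSymGrad (testSingle i η) z k l
      = (if k = i then A k l * fderiv ℝ η z (dirX l) / 2 else 0)
        + (if l = i then A k l * fderiv ℝ η z (dirX k) / 2 else 0) := by
    intro k l
    simp only [testSymGrad, Matrix.of_apply, fderiv_testSingle]
    split_ifs <;> ring
  simp only [ddot, h1, Finset.sum_add_distrib]
  rw [Finset.sum_comm (f := fun k l => if l = i then A k l * fderiv ℝ η z (dirX k) / 2 else 0)]
  have h2 : ∀ k, ∑ l, (if k = i then A k l * fderiv ℝ η z (dirX l) / 2 else 0)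
      = if k = i then ∑ l, A k l * fderiv ℝ η z (dirX l) / 2 else 0 := by
    intro k; split_ifs <;> simp
  have h3 : ∀ l, ∑ k, (if l = i then A k l * fderiv ℝ η z (dirX k) / 2 else 0)
      = if l = i then ∑ k, A k l * fderiv ℝ η z (dirX k) / 2 else 0 := by
    intro k; split_ifs <;> simp
  simp only [h2, h3, Finset.sum_ite_eq', Finset.mem_univ, if_true]
  rw [← Finset.sum_add_distrib]
  refine Finset.sum_congr rfl fun k _ => ?_
  rw [hA k i]; ring

lemma stress_symm (ν₀ δ : ℝ) (p : ℝ × Sp d → ℝ) (z : ℝ × Sp d) (A : Tensor d) (i j : Fin d) :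
    stress ν₀ δ p z A i j = stress ν₀ δ p z A j i := by
  simp only [stress, Matrix.smul_apply, tsym_apply, add_comm]

/-- The pressure gradient, computed from the momentum equation. -/
theorem IsWeakSolution.pressure_gradient {ν₀ δ : ℝ} {p : ℝ × Sp d → ℝ} {g : ℝ × Sp d → Sp d}
    {G : ℝ × Sp d → Tensor d} {v₀ : Lp (Sp d) 2 (vol Ω)} {v : ℝ × Sp d → Sp d}
    {Dv : ℝ × Sp d → Tensor d} {q : 𝓓'(cyl T Ω, ℝ)} (h : IsWeakSolution T Ω ν₀ δ p g G v₀ v Dv q)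
    {f : ℝ × Sp d → Sp d} (hf : IsForce T Ω g G f) {i : Fin d} {vt : ℝ × Sp d → ℝ}
    {S' : Fin d → ℝ × Sp d → ℝ} (hvt : HasWeakDeriv (cyl T Ω) (fun z => v z i) vt (dirT d))
    (hS : ∀ j, HasWeakDeriv (cyl T Ω) (fun z => stress ν₀ δ p z (Dv z) i j) (S' j) (dirX j))
    (η : 𝓓(cyl T Ω, ℝ)) :
    q (∂_{(dirX i : ℝ × Sp d)} η : 𝓓(cyl T Ω, ℝ))
      = - ∫ z, (f z i - vt z + ∑ j, S' j z) * η z ∂(vol (cyl T Ω)) := by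
  have h1 := h.momentum (testSingle i η)
  rw [testDiv_testSingle, ← hf.2] at h1
  have e1 : ∫ z, ∑ k, v z k * fderiv ℝ (testSingle i η k) z (dirT d) ∂(vol (cyl T Ω))
      = - ∫ z, vt z * η z ∂(vol (cyl T Ω)) := by
    rw [← hvt.2.2 η]
    congr 1; ext z
    simp [fderiv_testSingle]
  have e2 : ∫ z, ddot (stress ν₀ δ p z (Dv z)) (testSymGrad (testSingle i η) z) ∂(vol (cyl T Ω))
      = - ∑ j, ∫ z, S' j z * η z ∂(vol (cyl T Ω)) := by
    simp only [ddot_testSymGrad_single (stress_symm ν₀ δ p _ _)]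
    rw [integral_finsetSum _ fun j _ => integrable_mul_fderiv (hS j).1 η _, ← Finset.sum_neg_distrib]
    exact Finset.sum_congr rfl fun j _ => (hS j).2.2 η
  have e3 : ∫ z, ∑ k, f z k * testSingle i η k z ∂(vol (cyl T Ω))
      = ∫ z, f z i * η z ∂(vol (cyl T Ω)) := by
    congr 1; ext z
    simp [testSingle_apply]
  have if1 := integrable_mul_testFunction (hf.1 i) η
  have iv := integrable_mul_testFunction hvt.2.1 η
  have iS := fun j => integrable_mul_testFunction (hS j).2.1 η
  have e4 : ∫ z, (f z i - vt z + ∑ j, S' j z) * η z ∂(vol (cyl T Ω))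
      = ∫ z, f z i * η z ∂(vol (cyl T Ω)) - ∫ z, vt z * η z ∂(vol (cyl T Ω))
        + ∑ j, ∫ z, S' j z * η z ∂(vol (cyl T Ω)) := by
    have ifv : Integrable (fun z => f z i * η z - vt z * η z) (vol (cyl T Ω)) := if1.sub iv
    rw [← integral_finsetSum _ fun j _ => iS j, ← integral_sub if1 iv,
      ← integral_add ifv (integrable_finsetSum _ fun j _ => iS j)]
    congr 1; ext z
    simp only [add_mul, sub_mul, Finset.sum_mul]
  rw [e1, e2, e3] at h1
  rw [e4]
  linarith

end Momentum

/-! ### Sobolev regularity of the pressure -/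

section Assembly

variable {d : ℕ} {T : ℝ} {Ω : Opens (Sp d)}

/-- A distribution in the pressure space whose gradient lies in `L^{p'(·,·)}` is a function, with
slices in `W^{1,p'(t,·)}`. -/
theorem InPressureSpace.exists_sobolevPressure (hd : d = 2 ∨ d = 3)
    (hc : IsConnected (Ω : Set (Sp d))) (hb : Bornology.IsBounded (Ω : Set (Sp d)))
    (hL : HasLipschitzBoundary (Ω : Set (Sp d))) (hT : 0 < T) {p : ℝ × Sp d → ℝ}
    (hp : InC011 T Ω p) (hp2 : 2 ≤ pMinus T Ω p) {r : ℝ} (hr : 1 ≤ r) {q : 𝓓'(cyl T Ω, ℝ)}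
    (hq : InPressureSpace T Ω r q) {h : Fin d → ℝ × Sp d → ℝ}
    (hh : ∀ i, InLp (vol (cyl T Ω)) (conj p) (h i))
    (hgrad : ∀ i, ∀ η : 𝓓(cyl T Ω, ℝ), q (∂_{(dirX i : ℝ × Sp d)} η : 𝓓(cyl T Ω, ℝ))
      = - ∫ z, h i z * η z ∂(vol (cyl T Ω))) :
    ∃ π : ℝ × Sp d → ℝ, IsSobolevPressure T Ω (conj p) q π (fun z => WithLp.toLp 2 fun i => h i z) := by
  have hfinQ := isFiniteMeasure_vol_cyl hb T
  have hfin := isFiniteMeasure_vol hb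
  have hconj : ∀ t ∈ Ioo 0 T, ∀ x ∈ closure (Ω : Set (Sp d)),
      1 ≤ conj p (t, x) ∧ conj p (t, x) ≤ 2 := fun t ht x hx =>
    conj_mem (hp.two_le hb hT hp2 (Ioo_subset_Icc_self ht) hx)
  have hconjQ : ∀ᵐ z ∂(vol (cyl T Ω)), 1 ≤ conj p z ∧ conj p z ≤ 2 := by
    filter_upwards [ae_restrict_mem (cyl T Ω).isOpen.measurableSet] with z hz
    exact hconj z.1 hz.1 z.2 (subset_closure hz.2)
  have hcp : ∀ᵐ z ∂(vol (cyl T Ω)), 0 ≤ conj p z := by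
    filter_upwards [hconjQ] with z hz using by linarith [hz.1]
  have hcm : AEMeasurable (conj p) (vol (cyl T Ω)) :=
    hp.aemeasurable.div (hp.aemeasurable.sub_const 1)
  obtain ⟨u₀, u₁, h₀, h₁, hrep⟩ := hq
  have i0 := h₀.integrable hb hr
  have i1 := h₁.integrable hb hr
  have hhi : ∀ i, Integrable (h i) (vol (cyl T Ω)) := fun i =>
    (hh i).integrable (by filter_upwards [hconjQ] with z hz using hz.1)
  obtain ⟨-, C₀, hm0⟩ := h₀
  obtain ⟨-, C₁, hm1⟩ := h₁
  obtain ⟨π, hπ, hπq, hπs⟩ := exists_integrable_of_gradient (by omega) hc hb hL i0 i1 hhi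
    (by filter_upwards [hm0] with t ht using ht.2.2) (by filter_upwards [hm1] with t ht using ht.2.2)
    fun i η => by
      rw [← hgrad i η, hrep]
      simp only [lineDeriv_testFunction_apply]
  refine ⟨π, IntegrableOn.locallyIntegrableOn hπ, fun η => (hrep η).trans (hπq η), ?_, ?_⟩
  · have hm : AEMeasurable (fun z i => h i z) (vol (cyl T Ω)) :=
      aemeasurable_pi_lambda _ fun i => (hhi i).aestronglyMeasurable.aemeasurable
    exact ((WithLp.measurable_toLp 2 (Fin d → ℝ)).comp_aemeasurable hm).aestronglyMeasurable
  have hslice : ∀ i, ∀ᵐ t ∂(volI T), ∫⁻ x, ‖h i (t, x)‖ₑ ^ conj p (t, x) ∂(vol Ω) < ∞ := by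
    intro i
    have hm : AEMeasurable (fun z => ‖h i z‖ₑ ^ conj p z) ((volI T).prod (vol Ω)) := by
      rw [← vol_cyl]
      exact (hhi i).aestronglyMeasurable.enorm.pow hcm
    have h2 := (hh i).2
    rw [modular_eq hcp, vol_cyl, lintegral_prod _ hm] at h2
    exact ae_lt_top' hm.lintegral_prod_right' h2.ne
  have hms : ∀ᵐ t ∂(volI T), Integrable (fun x => π (t, x)) (vol Ω) := by
    rw [vol_cyl] at hπ
    exact hπ.prod_right_ae
  filter_upwards [hπs, hms, ae_all_iff.2 hslice, ae_restrict_mem measurableSet_Ioo]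
    with t ht1 ht2 ht3 ht4
  have hpos : ∀ᵐ x ∂(vol Ω), 0 ≤ conj p (t, x) := by
    filter_upwards [ae_restrict_mem Ω.isOpen.measurableSet] with x hx
    linarith [(hconj t ht4 x (subset_closure hx)).1]
  refine ⟨⟨ht2.1, ?_⟩, fun i => ⟨ht1 i, (ht1 i).2.1.aestronglyMeasurable, ?_⟩⟩
  · rw [modular_eq hpos]
    exact lintegral_rpow_lt_top_of_hasWeakGrad hd hb hL
      (continuousOn_conj hb hT hp hp2 (Ioo_subset_Icc_self ht4))
      (fun x hx => (hconj t ht4 x (subset_closure hx)).1)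
      (fun x hx => (hconj t ht4 x (subset_closure hx)).2) ht1 ht2 ht3
  · rw [modular_eq hpos]
    exact ht3 i

end Assembly

end PxStokes

open PxStokes in
theorem lemma3p4 (d : ℕ) (hd : d = 2 ∨ d = 3)
    (Ω : Opens (PxStokes.Sp d)) (hΩ : PxStokes.IsPolyhedralLipschitzDomain Ω)
    (T : ℝ) (hT : 0 < T) (ν₀ δ : ℝ) (hν₀ : 0 < ν₀) (hδ : 0 < δ)
    (p : ℝ × PxStokes.Sp d → ℝ) (hp : PxStokes.InC011 T Ω p)
    (hp2 : 2 ≤ PxStokes.pMinus T Ω p)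
    (g : ℝ × PxStokes.Sp d → PxStokes.Sp d)
    (hg : ∀ i, PxStokes.InLp (PxStokes.vol (PxStokes.cyl T Ω))
      (fun _ => PxStokes.pMinus T Ω p / (PxStokes.pMinus T Ω p - 1)) (fun z => g z i))
    (G : ℝ × PxStokes.Sp d → PxStokes.Tensor d)
    (hG : ∀ i j, PxStokes.InLp (PxStokes.vol (PxStokes.cyl T Ω)) (PxStokes.conj p)
      (fun z => G z i j))
    (hGsym : ∀ᵐ z ∂(PxStokes.vol (PxStokes.cyl T Ω)), (G z).IsSymm)
    (v₀ : Lp (PxStokes.Sp d) 2 (PxStokes.vol Ω)) (hv₀ : v₀ ∈ PxStokes.solenoidal Ω)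
    (v : ℝ × PxStokes.Sp d → PxStokes.Sp d) (Dv : ℝ × PxStokes.Sp d → PxStokes.Tensor d)
    (q : 𝓓'(PxStokes.cyl T Ω, ℝ))
    (hsol : PxStokes.IsWeakSolution T Ω ν₀ δ p g G v₀ v Dv q)
    (hFt : ∀ i j, PxStokes.InW12L2 T Ω (fun z => PxStokes.Fmap δ p z (Dv z) i j))
    (hFx : ∀ i j, PxStokes.InL2W12 T Ω (fun z => PxStokes.Fmap δ p z (Dv z) i j))
    (hv : ∀ i, PxStokes.InLinftyW12 T Ω (fun z => v z i))
    (f : ℝ × PxStokes.Sp d → PxStokes.Sp d) (hf : PxStokes.IsForce T Ω g G f) :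
    ((∀ i, PxStokes.InLp (PxStokes.vol (PxStokes.cyl T Ω)) (PxStokes.conj p) (fun z => f z i)) →
      ∃ (π : ℝ × PxStokes.Sp d → ℝ) (Dπ : ℝ × PxStokes.Sp d → PxStokes.Sp d),
        PxStokes.IsSobolevPressure T Ω (PxStokes.conj p) q π Dπ ∧
        PxStokes.InLp (PxStokes.vol (PxStokes.cyl T Ω)) (PxStokes.conj p) (fun z => ‖Dπ z‖)) ∧
    (Integrable (fun z => (δ + PxStokes.tnorm (Dv z)) ^ (2 - p z) * ‖f z‖ ^ 2)
        (PxStokes.vol (PxStokes.cyl T Ω)) →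
      ∃ (π : ℝ × PxStokes.Sp d → ℝ) (Dπ : ℝ × PxStokes.Sp d → PxStokes.Sp d),
        PxStokes.IsSobolevPressure T Ω (PxStokes.conj p) q π Dπ ∧
        Integrable (fun z => (δ + PxStokes.tnorm (Dv z)) ^ (2 - p z) * ‖Dπ z‖ ^ 2)
          (PxStokes.vol (PxStokes.cyl T Ω))) := by
  obtain ⟨hc, hb, -, hL⟩ := hΩ
  have hd0 : 0 < d := by omega
  have hfinQ := isFiniteMeasure_vol_cyl hb T
  have hmeas := (cyl T Ω).isOpen.measurableSet
  obtain ⟨c, hc0, hlip⟩ := hp.exists_lipschitz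
  obtain ⟨P, hP⟩ := hp.exists_bound hb
  have hp2Q : ∀ z ∈ cyl T Ω, 2 ≤ p z := fun z hz =>
    hp.two_le hb hT hp2 (cyl_subset_closed hz).1 (cyl_subset_closed hz).2
  have hreg : IsRegular T Ω δ P c p Dv :=
    { pos := hδ
      exponent := fun z hz => ⟨hp2Q z hz, (abs_le.1 (hP z hz)).2⟩
      aemeasurable := hp.aemeasurable
      lipschitz := hlip
      measurable := fun i j => (hsol.velocity.memLp_symGrad i j).1
      memLp := fun i j => (hFt i j).1
      time := fun i j => (hFt i j).2
      space := fun i j k => (hFx i j).2 k }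
  have hp2ae : ∀ᵐ z ∂(vol (cyl T Ω)), 2 ≤ p z := by
    filter_upwards [ae_restrict_mem hmeas] with z hz using hp2Q z hz
  have hvL : ∀ i, MemLp (fun z => v z i) 2 (vol (cyl T Ω)) := fun i =>
    (hsol.velocity.memLp i).memLp_two hp2ae
  have hDL : ∀ i j, MemLp (fun z => Dv z i j) 2 (vol (cyl T Ω)) := fun i j =>
    (hsol.velocity.memLp_symGrad i j).memLp_two hp2ae
  -- the time derivative of the velocity
  have hvt : ∀ i, ∃ κ, MemLp κ 2 (vol (cyl T Ω)) ∧
      HasWeakDeriv (cyl T Ω) (fun z => v z i) κ (dirT d) := by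
    intro i
    obtain ⟨w, hw, hwd⟩ := hreg.exists_diag_timeDeriv hd0 hT hb hL i ((hDL i i).integrable one_le_two)
    refine exists_timeDeriv_of_spatial hb (hvL i) (hDL i i) (hsol.velocity.symGrad.diag i) hwd hw
      hp2Q ?_
    filter_upwards [hsol.velocity.slice] with t ht using ht i
  choose vt hvt2 hvtd using hvt
  -- the divergence of the stress
  choose κ hκ2 hκd using fun i j => hreg.exists_stress_deriv ν₀ hd0 hT hb hL i j j
  set a : ℝ × Sp d → ℝ := fun z => weight δ p z (Dv z) with ha
  have ha0 : ∀ z, 0 < a z := fun z => weight_pos hδ p z (Dv z)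
  let h : Fin d → ℝ × Sp d → ℝ := fun i z => f z i - vt i z + ∑ j, a z * κ i j z
  have hgrad : ∀ i, ∀ η : 𝓓(cyl T Ω, ℝ), q (∂_{(dirX i : ℝ × Sp d)} η : 𝓓(cyl T Ω, ℝ))
      = - ∫ z, h i z * η z ∂(vol (cyl T Ω)) := fun i η =>
    hsol.pressure_gradient hf (hvtd i) (fun j => hκd i j) η
  -- all but the force is of the form `a H` with `H` in `L²`
  let H : Fin d → ℝ × Sp d → ℝ := fun i z => ∑ j, κ i j z - (a z)⁻¹ * vt i z
  have hhH : ∀ i z, h i z = f z i + a z * H i z := by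
    intro i z
    have := (ha0 z).ne'
    simp only [h, H, mul_sub, Finset.mul_sum]
    rw [mul_inv_cancel_left₀ this]
    ring
  obtain ⟨c₀, hc₀, hc₀w⟩ := exists_weight_lower_bound (P := P) hδ
  have hainv : MemLp (fun z => (a z)⁻¹) ∞ (vol (cyl T Ω)) := by
    refine memLp_top_of_bound hreg.aestronglyMeasurable_weight.aemeasurable.inv.aestronglyMeasurable
      c₀⁻¹ ?_
    filter_upwards [ae_restrict_mem hmeas] with z hz
    rw [Real.norm_of_nonneg (inv_nonneg.2 (ha0 z).le)]
    exact inv_anti₀ hc₀ (hc₀w (p z) (hreg.exponent z hz) _ (tnorm_nonneg _))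
  have hH : ∀ i, MemLp (H i) 2 (vol (cyl T Ω)) := fun i =>
    (memLp_finsetSum _ fun j _ => hκ2 i j).sub ((hvt2 i).mul hainv)
  have hr : 1 ≤ pPlus T Ω p / (pPlus T Ω p - 1) :=
    (conj_mem (hp.two_le_pPlus hb hc.nonempty hT hp2)).1
  have hcm := hreg.aemeasurable_conj
  have hc12 := hreg.ae_conj_mem
  have hcp : ∀ᵐ z ∂(vol (cyl T Ω)), 0 ≤ conj p z := by
    filter_upwards [hc12] with z hz using by linarith [hz.1]
  constructor
  · intro hfp
    have hh : ∀ i, InLp (vol (cyl T Ω)) (conj p) (h i) := fun i => by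
      have : h i = fun z => f z i + a z * H i z := funext (hhH i)
      rw [this]
      exact (hfp i).add hcm hc12 (hreg.inLp_weight_mul (hH i))
    obtain ⟨π, hπ⟩ := InPressureSpace.exists_sobolevPressure hd hc hb hL hT hp hp2 hr hsol.pressure
      hh hgrad
    refine ⟨π, _, hπ, ?_⟩
    have hsum := InLp.sum Finset.univ hcm hc12 (u := fun i z => |h i z|) fun i _ =>
      (hh i).mono hcp (hh i).1.norm (ae_of_all _ fun z => by rw [abs_abs])
    refine hsum.mono hcp hπ.measurable_grad.norm (ae_of_all _ fun z => ?_)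
    rw [abs_norm]
    rw [abs_of_nonneg (Finset.sum_nonneg fun _ _ => abs_nonneg _), EuclideanSpace.norm_eq]
    refine Real.sqrt_le_iff.2 ⟨Finset.sum_nonneg fun _ _ => abs_nonneg _, ?_⟩
    exact Finset.sum_sq_le_sq_sum_of_nonneg fun i _ => abs_nonneg (h i z)
  · intro hfw
    have hsym : ∀ᵐ z ∂(vol (cyl T Ω)), (δ + tnorm (Dv z)) ^ (2 - p z) = ((a z)⁻¹) ^ 2 := by
      filter_upwards [hsol.velocity.symGrad.ae_symm] with z hz
      have h1 : tsym (Dv z) = Dv z := by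
        ext i j
        rw [tsym_apply, hz j i, add_self_div_two]
      have hpos : 0 < δ + tnorm (Dv z) := by linarith [tnorm_nonneg (Dv z)]
      simp only [ha, weight, h1]
      rw [← Real.rpow_neg hpos.le, ← Real.rpow_natCast, ← Real.rpow_mul hpos.le]
      congr 1; push_cast; ring
    have hfm : ∀ i, AEStronglyMeasurable (fun z => f z i) (vol (cyl T Ω)) := fun i =>
      (hf.1 i).aestronglyMeasurable
    have hfa : ∀ i, MemLp (fun z => (a z)⁻¹ * f z i) 2 (vol (cyl T Ω)) := by
      intro i
      have hm : AEStronglyMeasurable (fun z => (a z)⁻¹ * f z i) (vol (cyl T Ω)) :=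
        hainv.1.mul (hfm i)
      rw [memLp_two_iff_integrable_sq hm]
      refine hfw.mono' (hm.pow 2) ?_
      filter_upwards [hsym] with z hz
      rw [hz, Real.norm_of_nonneg (sq_nonneg _), mul_pow]
      refine mul_le_mul_of_nonneg_left ?_ (sq_nonneg _)
      rw [← sq_abs]
      exact pow_le_pow_left₀ (abs_nonneg _) (PiLp.norm_apply_le (f z) i) 2
    let K : Fin d → ℝ × Sp d → ℝ := fun i z => (a z)⁻¹ * f z i + H i z
    have hK : ∀ i, MemLp (K i) 2 (vol (cyl T Ω)) := fun i => (hfa i).add (hH i)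
    have hhK : ∀ i z, h i z = a z * K i z := by
      intro i z
      rw [hhH, mul_add, mul_inv_cancel_left₀ (ha0 z).ne']
    have hh : ∀ i, InLp (vol (cyl T Ω)) (conj p) (h i) := fun i => by
      have : h i = fun z => a z * K i z := funext (hhK i)
      rw [this]
      exact hreg.inLp_weight_mul (hK i)
    obtain ⟨π, hπ⟩ := InPressureSpace.exists_sobolevPressure hd hc hb hL hT hp hp2 hr hsol.pressure
      hh hgrad
    refine ⟨π, _, hπ, ?_⟩
    have hi : Integrable (fun z => ∑ i, K i z ^ 2) (vol (cyl T Ω)) :=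
      integrable_finsetSum _ fun i _ => (hK i).integrable_sq
    refine hi.congr ?_
    filter_upwards [hsym] with z hz
    rw [hz, EuclideanSpace.norm_sq_eq, Finset.mul_sum]
    refine Finset.sum_congr rfl fun i _ => ?_
    rw [Real.norm_eq_abs, sq_abs]
    simp only [hhK]
    rw [mul_pow, ← mul_assoc, ← mul_pow, inv_mul_cancel₀ (ha0 z).ne', one_pow, one_mul]
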